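/- Let $n\ge 1$, let $m_1,\dots,m_{n-1}$ be natural numbers, and let $m=m_1+\dots+m_{n-1}$. Let $C_1,\dots,C_{n-1}\subset\mathbb{R}^m$ be nonempty compact convex sets; they may be of any dimensions and in any position (in particular $\dim C_i=m_i$ is allowed, and $C_i$ may lie in the $i$-th coordinate block $\mathbb{R}^{m_i}$ of $\mathbb{R}^m=\mathbb{R}^{m_1}\times\dots\times\mathbb{R}^{m_{n-1}}$). Let $f_{ij}$ ($1\le i\le n-1$, $1\le j\le m_i$) be probability densities on $\mathbb{R}^n$. Let $\mathbf{X}=[\mathbf{X}_1\cdots\mathbf{X}_{n-1}]$ be the random $n\times m$ matrix with blocks $\mathbf{X}_i=[X_{i1}\cdots X_{im_i}]$, whose columns $X_{ij}$ are independent random vectors in $\mathbb{R}^n$ with densities $f_{ij}$. Let $\mathbf{X}^{\#}$ be the random $n\times m$ matrix formed in the same way from independent columns $X^*_{ij}$ with densities $f_{ij}^*$. Here $f^*(x)=\int_0^\infty \mathbf{1}_{\{f>t\}^*}(x)\,dt$ is the symmetric decreasing rearrangement of $f$, where $A^*$ is the open Euclidean ball centered at the origin with the same volume as $A$. For an $n\times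 m$ matrix $T$ with columns $x_1,\dots,x_m$ write $TC=\{\sum_k c_kx_k:\ c\in C\}$. For compact convex sets $K_1,\dots,K_{n-1}\subset\mathbb{R}^n$, let $\Pi^\circ(K_1,\dots,K_{n-1})$ be the polar of the mixed projection body $\Pi(K_1,\dots,K_{n-1})$, whose support function is $\theta\mapsto nV(K_1,\dots,K_{n-1},[0,\theta])$, with $V$ the mixed volume in $\mathbb{R}^n$; that is, $$\Pi^\circ(K_1,\dots,K_{n-1})=\{\theta\in\mathbb{R}^n:\ nV(K_1,\dots,K_{n-1},[0,\theta])\le 1\}.$$ Let $\nu$ be a radial measure with decreasing density, i.e. $d\nu(x)=\rho(\|x\|)\,dx$ with $\rho:[0,\infty)\to[0,\infty]$ non-increasing. Then $$\mathbb{E}\,\nu\big(\Pi^{\circ}(\mathbf{X}C_1,\dots,\mathbf{X}C_{n-1})\big)\ \le\ \mathbb{E}\,\nu\big(\Pi^{\circ}(\mathbf{X}^{\#}C_1,\dots,\mathbf{X}^{\#}C_{n-1})\big),$$ where both sides may be $+\infty$. -/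

import Mathlib

open MeasureTheory ProbabilityTheory
open scoped ENNReal NNReal Pointwise

noncomputable section

namespace Petty

/-- The mixed volume `V(K₁, …, Kₙ)` of `n` compact convex sets in `ℝⁿ`, by polarization of the volume:
`n! V(K₁, …, Kₙ) = ∑_{S ⊆ {1, …, n}} (-1)^(n - |S|) vol(∑_{i ∈ S} Kᵢ)` (Minkowski sums).
That this is the coefficient in Minkowski's volume polynomial is `mixedVolume_eq_coeff`. -/
def mixedVolume {n : ℕ} (K : Fin n → Set (EuclideanSpace ℝ (Fin n))) : ℝ :=
  (n.factorial : ℝ)⁻¹ *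
    ∑ S : Finset (Fin n), (-1 : ℝ) ^ (n - S.card) * volume.real (∑ i ∈ S, K i)

/-- Whenever the volume of `λ₁K₁ + ⋯ + λₙKₙ` is the polynomial
`∑_{i₁, …, iₙ} λ_{i₁} ⋯ λ_{iₙ} a(i₁, …, iₙ)` with symmetric coefficients `a`, the coefficient
`a(1, …, n)` is the mixed volume of `K₁, …, Kₙ`. -/
theorem mixedVolume_eq_coeff {n : ℕ} (K : Fin n → Set (EuclideanSpace ℝ (Fin n)))
    (hne : ∀ i, (K i).Nonempty)
    (a : (Fin n → Fin n) → ℝ)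
    (hsymm : ∀ (i : Fin n → Fin n) (σ : Equiv.Perm (Fin n)), a (i ∘ σ) = a i)
    (hpoly : ∀ l : Fin n → ℝ, (∀ i, 0 ≤ l i) →
      volume.real (∑ i, l i • K i) = ∑ i : Fin n → Fin n, (∏ k, l (i k)) * a i) :
    mixedVolume K = a id := by
  classical
  have h1 : ∀ S : Finset (Fin n), volume.real (∑ i ∈ S, K i)
      = ∑ i : Fin n → Fin n, (if ∀ k, i k ∈ S then a i else 0) := by
    intro S
    have h := hpoly (fun i => if i ∈ S then 1 else 0) (fun i => by split_ifs <;> norm_num)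
    have h2 : (∑ i, (if i ∈ S then (1 : ℝ) else 0) • K i) = ∑ i ∈ S, K i := by
      rw [← Finset.sum_filter_add_sum_filter_not Finset.univ (fun i => i ∈ S)]
      rw [Finset.sum_congr rfl (g := fun i => K i), Finset.sum_congr (s₁ := Finset.univ.filter
        (fun i => ¬ i ∈ S)) rfl (g := fun _ => (0 : Set (EuclideanSpace ℝ (Fin n))))]
      · simp
      · intro i hi
        rw [if_neg (Finset.mem_filter.1 hi).2, Set.zero_smul_set (hne i)]
      · intro i hi
        rw [if_pos (Finset.mem_filter.1 hi).2, one_smul]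
    rw [h2] at h
    rw [h]
    refine Finset.sum_congr rfl fun i _ => ?_
    by_cases hi : ∀ k, i k ∈ S
    · simp [hi]
    · rw [if_neg hi]
      push Not at hi
      obtain ⟨k, hk⟩ := hi
      rw [Finset.prod_eq_zero (Finset.mem_univ k) (by simp [hk]), zero_mul]
  have h3 : ∀ i : Fin n → Fin n,
      (∑ S : Finset (Fin n), if ∀ k, i k ∈ S then (-1 : ℝ) ^ (n - S.card) else 0)
        = if Function.Surjective i then 1 else 0 := by
    intro i
    have hc : (∑ S : Finset (Fin n), if ∀ k, i k ∈ S then (-1 : ℝ) ^ (n - S.card) else 0)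
        = ∑ T ∈ (Finset.univ \ Finset.univ.image i).powerset, (-1 : ℝ) ^ T.card := by
      rw [← Finset.sum_filter]
      refine Finset.sum_bij' (fun S _ => Sᶜ) (fun T _ => Tᶜ) ?_ ?_ ?_ ?_ ?_
      · intro S hS
        simp only [Finset.mem_filter, Finset.mem_univ, true_and] at hS
        rw [Finset.mem_powerset]
        intro x hx
        simp only [Finset.mem_sdiff, Finset.mem_univ, true_and, Finset.mem_image, not_exists]
        intro k hk
        exact (Finset.mem_compl.1 hx) (hk ▸ hS k)
      · intro T hT
        rw [Finset.mem_powerset] at hT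
        simp only [Finset.mem_filter, Finset.mem_univ, true_and, Finset.mem_compl]
        intro k hk
        have := hT hk
        simp at this
      · intro S _; simp
      · intro T _; simp
      · intro S _
        rw [Finset.card_compl, Fintype.card_fin]
    rw [hc]
    have := Finset.sum_powerset_neg_one_pow_card (x := Finset.univ \ Finset.univ.image i)
    have h4 : (∑ T ∈ (Finset.univ \ Finset.univ.image i).powerset, (-1 : ℝ) ^ T.card)
        = if (Finset.univ \ Finset.univ.image i) = ∅ then 1 else 0 := by
      exact_mod_cast this
    rw [h4]
    refine if_congr ?_ rfl rfl
    simp [Finset.ext_iff, Function.Surjective]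
  have h5 : (∑ S : Finset (Fin n), (-1 : ℝ) ^ (n - S.card) * volume.real (∑ i ∈ S, K i))
      = ∑ i : Fin n → Fin n, if Function.Surjective i then a i else 0 := by
    simp_rw [h1, Finset.mul_sum]
    rw [Finset.sum_comm]
    refine Finset.sum_congr rfl fun i _ => ?_
    have := congrArg (fun x => x * a i) (h3 i)
    simp only [Finset.sum_mul, ite_mul, one_mul, zero_mul] at this
    rw [← this]
    refine Finset.sum_congr rfl fun S _ => ?_
    split_ifs <;> simp
  have h6 : (∑ i : Fin n → Fin n, if Function.Surjective i then a i else 0)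
      = ∑ _σ : Equiv.Perm (Fin n), a id := by
    rw [← Finset.sum_filter]
    symm
    refine Finset.sum_bij (fun σ _ => (σ : Fin n → Fin n)) ?_ ?_ ?_ ?_
    · intro σ _; simp [σ.surjective]
    · intro σ _ τ _ h; exact DFunLike.coe_injective h
    · intro i hi
      have hs := (Finset.mem_filter.1 hi).2
      exact ⟨Equiv.ofBijective i (Finite.injective_iff_bijective.1
        (Finite.injective_iff_surjective.2 hs)), Finset.mem_univ _, rfl⟩
    · intro σ _; exact (hsymm id σ).symm
  rw [mixedVolume, h5, h6]
  have : (n.factorial : ℝ) ≠ 0 := by positivity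
  simp [Fintype.card_perm, this]

/-- With `n = d + 1`: the support function `θ ↦ n V(K₁, …, K_{n-1}, [0, θ])` of the mixed
projection body `Π(K₁, …, K_{n-1})` of `n - 1` compact convex sets in `ℝⁿ`. -/
def mixedProjSupport {d : ℕ} (K : Fin d → Set (EuclideanSpace ℝ (Fin (d + 1))))
    (θ : EuclideanSpace ℝ (Fin (d + 1))) : ℝ :=
  ((d + 1 : ℕ) : ℝ) *
    mixedVolume (Fin.snoc (α := fun _ => Set (EuclideanSpace ℝ (Fin (d + 1)))) K (segment ℝ 0 θ))

/-- The polar `Π°(K₁, …, K_{n-1}) = {θ : h_Π(θ) ≤ 1}` of the mixed projection body. -/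
def polarMixedProj {d : ℕ} (K : Fin d → Set (EuclideanSpace ℝ (Fin (d + 1)))) :
    Set (EuclideanSpace ℝ (Fin (d + 1))) :=
  {θ | mixedProjSupport K θ ≤ 1}

/-- The image `[x₁ … x_m] C = {∑ₖ cₖ xₖ : c ∈ C}` of `C ⊆ ℝᵐ` under the matrix with columns `xₖ`. -/
def matImage {n : ℕ} {κ : Type*} [Fintype κ] (x : κ → EuclideanSpace ℝ (Fin n))
    (C : Set (κ → ℝ)) : Set (EuclideanSpace ℝ (Fin n)) :=
  (fun c : κ → ℝ => ∑ k, c k • x k) '' C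

/-- The symmetric rearrangement `A*` of a set `A` of finite volume: the open Euclidean ball centred
at the origin with the volume of `A`. -/
def setRearrangement {n : ℕ} (A : Set (EuclideanSpace ℝ (Fin n))) :
    Set (EuclideanSpace ℝ (Fin n)) :=
  Metric.ball 0 ((volume.real A /
    volume.real (Metric.ball (0 : EuclideanSpace ℝ (Fin n)) 1)) ^ (1 / (n : ℝ)))

theorem volume_setRearrangement {n : ℕ} (hn : n ≠ 0) (A : Set (EuclideanSpace ℝ (Fin n)))
    (hA : volume A ≠ ∞) : volume (setRearrangement A) = volume A := by
  have : Nonempty (Fin n) := ⟨⟨0, Nat.pos_of_ne_zero hn⟩⟩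
  have hb : volume (Metric.ball (0 : EuclideanSpace ℝ (Fin n)) 1) ≠ ∞ :=
    measure_ball_lt_top.ne
  have hb0 : volume.real (Metric.ball (0 : EuclideanSpace ℝ (Fin n)) 1) ≠ 0 :=
    (ENNReal.toReal_pos (Metric.measure_ball_pos _ _ one_pos).ne' hb).ne'
  have hq : 0 ≤ volume.real A / volume.real (Metric.ball (0 : EuclideanSpace ℝ (Fin n)) 1) := by
    positivity
  rw [setRearrangement, Measure.addHaar_ball _ _ (by positivity), finrank_euclideanSpace_fin,
    ← Real.rpow_natCast, ← Real.rpow_mul hq, one_div, inv_mul_cancel₀ (by exact_mod_cast hn),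
    Real.rpow_one, ← ENNReal.ofReal_toReal hb, ← ENNReal.ofReal_mul hq]
  change ENNReal.ofReal (_ * volume.real _) = _
  rw [div_mul_cancel₀ _ hb0, Measure.real, ENNReal.ofReal_toReal hA]

/-- The symmetric decreasing rearrangement `f*(x) = ∫₀^∞ 1[x ∈ {f > t}*] dt` of a density. -/
def symmDecrRearrangement {n : ℕ} (f : EuclideanSpace ℝ (Fin n) → ℝ≥0∞)
    (x : EuclideanSpace ℝ (Fin n)) : ℝ≥0∞ :=
  ∫⁻ t in Set.Ioi (0 : ℝ),
    (setRearrangement {y | ENNReal.ofReal t < f y}).indicator (fun _ => (1 : ℝ≥0∞)) x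

/-- The radial measure on `ℝⁿ` with density `x ↦ ρ(‖x‖)` with respect to Lebesgue measure. -/
def radialMeasure (n : ℕ) (ρ : ℝ≥0 → ℝ≥0∞) : Measure (EuclideanSpace ℝ (Fin n)) :=
  volume.withDensity fun x => ρ ‖x‖₊

end Petty

end

set_option linter.unusedSectionVars false

/-! ### Layer-cake formulas -/

namespace Petty

/-! Treat `θ` as one more column. By Tonelli each side of the inequality is the integral of `ρ(‖θ‖)`
times the product of the densities over one and the same set `G` of families `(θ, xₖ)`, cut out by
`n V(xC₁, …, xC_{n-1}, [0, θ]) ≤ 1`. Since `[0, θ]` is the image of a coordinate segment under the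
enlarged matrix, `G` is a sublevel set of the mixed volume of linear images of fixed convex bodies.
What remains is a Rogers-Brascamp-Lieb-Luttinger inequality: rearranging the densities does not
decrease the integral over `G`. It needs two properties of `G`, recorded in `IsSteinerConvex`:
invariance under linear isometries, and convexity in the displacements when all columns move
parallel to one axis.

Rearrangement. With the components orthogonal to the axis fixed, `G` cuts out a symmetric convex set
of displacements. Sliding a box towards the origin enlarges its intersection with such a set
(`volume_inter_box_le`, from Prékopa-Leindler); sliding unions of intervals and merging those that
touch gives `volume_inter_pi_le_symmetric`. Hence simultaneous Steiner symmetrization of sets `Aₖ`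
does not decrease the volume of `G ∩ ∏ Aₖ`. A direction chosen by averaging brings the `Aₖ`
quantitatively closer to balls (`IsSteinerConvex.exists_gain`), and an infimum argument makes the
distance arbitrarily small. Layer-cake integration passes from sets to densities; the weight `ρ` is
already radially decreasing and stays as it is.

Convexity. Images under columns that move along parallel lines are shadows of fixed bodies in one
more dimension (`mixedVolume_line_le`). The mixed volume of shadows is a mixed volume upstairs with
a segment in the kernel direction (`polarVol_cons_segment`), so convexity amounts to subadditivity
in the end point of that segment (`polarVol_update_segment_le`). For polytopes, mixed volumes are
integrals of mixed discriminants of Hessians of log-sum-exp potentials (`polarVol_eq_integral`).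
These discriminants are additive in each Hessian and nonnegative, and potentials of the
parallelogram `[0, u] + [0, v]` degenerate to one of its diagonal, so Fatou's lemma gives the
inequality. General bodies are exhausted by polytopes. -/

theorem volume_Ioi_inter_ofReal_lt (a : ℝ≥0∞) :
    volume ({t : ℝ | ENNReal.ofReal t < a} ∩ Set.Ioi 0) = a := by
  induction a with
  | top =>
    have : ({t : ℝ | ENNReal.ofReal t < ∞} ∩ Set.Ioi 0) = Set.Ioi 0 := by
      ext t; simp
    rw [this, Real.volume_Ioi]
  | coe a =>
    have : ({t : ℝ | ENNReal.ofReal t < a} ∩ Set.Ioi 0) = Set.Ioo 0 (a : ℝ) := by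
      ext t
      simp only [Set.mem_inter_iff, Set.mem_ofPred_eq, Set.mem_Ioi, Set.mem_Ioo]
      constructor
      · rintro ⟨h1, h2⟩
        refine ⟨h2, ?_⟩
        rw [← ENNReal.ofReal_coe_nnreal] at h1
        exact (ENNReal.ofReal_lt_ofReal_iff_of_nonneg h2.le).1 h1
      · rintro ⟨h1, h2⟩
        refine ⟨?_, h1⟩
        rw [← ENNReal.ofReal_coe_nnreal]
        exact (ENNReal.ofReal_lt_ofReal_iff_of_nonneg h1.le).2 h2
    rw [this, Real.volume_Ioo, sub_zero, ENNReal.ofReal_coe_nnreal]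

theorem eq_lintegral_indicator_superlevel {α : Type*} (f : α → ℝ≥0∞) (x : α) :
    f x = ∫⁻ t in Set.Ioi (0 : ℝ), {y | ENNReal.ofReal t < f y}.indicator (fun _ => 1) x := by
  have h : ∀ t : ℝ, {y | ENNReal.ofReal t < f y}.indicator (fun _ => (1 : ℝ≥0∞)) x
      = {t : ℝ | ENNReal.ofReal t < f x}.indicator (fun _ => 1) t := fun t => by
    simp [Set.indicator_apply]
  simp_rw [h]
  have hm : MeasurableSet {t : ℝ | ENNReal.ofReal t < f x} :=
    measurableSet_lt (by fun_prop) measurable_const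
  rw [lintegral_indicator hm, lintegral_one, Measure.restrict_apply MeasurableSet.univ,
    Set.univ_inter, Measure.restrict_apply hm, volume_Ioi_inter_ofReal_lt]

theorem lintegral_eq_lintegral_superlevel {α : Type*} [MeasurableSpace α] (μ : Measure α)
    [SFinite μ] {f : α → ℝ≥0∞} (hf : Measurable f) :
    ∫⁻ x, f x ∂μ = ∫⁻ t in Set.Ioi (0 : ℝ), μ {x | ENNReal.ofReal t < f x} := by
  have hm : MeasurableSet {p : α × ℝ | ENNReal.ofReal p.2 < f p.1} :=
    measurableSet_lt (by fun_prop) (by fun_prop)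
  calc ∫⁻ x, f x ∂μ = ∫⁻ x, (∫⁻ t in Set.Ioi (0 : ℝ),
        {p : α × ℝ | ENNReal.ofReal p.2 < f p.1}.indicator (fun _ => 1) (x, t)) ∂μ := by
        refine lintegral_congr fun x => ?_
        rw [eq_lintegral_indicator_superlevel f x]
        rfl
    _ = ∫⁻ t in Set.Ioi (0 : ℝ), (∫⁻ x,
        {p : α × ℝ | ENNReal.ofReal p.2 < f p.1}.indicator (fun _ => 1) (x, t) ∂μ) :=
        lintegral_lintegral_swap ((measurable_const.indicator hm).aemeasurable)
    _ = _ := by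
        refine lintegral_congr fun t => ?_
        have : (fun x => {p : α × ℝ | ENNReal.ofReal p.2 < f p.1}.indicator
            (fun _ => (1 : ℝ≥0∞)) (x, t)) = {x | ENNReal.ofReal t < f x}.indicator 1 := by
          ext x; simp [Set.indicator_apply]
        rw [this, lintegral_indicator_one (measurableSet_lt measurable_const hf)]

/-! ### The Brunn-Minkowski inequality on the line -/

/-- The translates `A + min B` and `max A + B` both lie in `C` and meet only in the point `max A +
min B`. -/
theorem volume_add_le_of_isCompact {A B C : Set ℝ} (hA : IsCompact A) (hB : IsCompact B)
    (hAn : A.Nonempty) (hBn : B.Nonempty) (h : ∀ a ∈ A, ∀ b ∈ B, a + b ∈ C) :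
    volume A + volume B ≤ volume C := by
  obtain ⟨a, haA, ha⟩ := hA.exists_isGreatest hAn
  obtain ⟨b, hbB, hb⟩ := hB.exists_isLeast hBn
  have h1 : volume ((fun x => x + b) '' A) = volume A := by
    rw [Set.image_add_right, measure_preimage_add_right]
  have h2 : volume (((fun x => a + x) '' B) \ {a + b}) = volume B := by
    rw [measure_sdiff_null (by simp), Set.image_add_left, measure_preimage_add]
  rw [← h1, ← h2, ← measure_union]
  · refine measure_mono ?_
    rintro _ (⟨x, hx, rfl⟩ | ⟨⟨x, hx, rfl⟩, _⟩)
    · exact h x hx b hbB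
    · exact h a haA x hx
  · rw [Set.disjoint_left]
    rintro _ ⟨x, hx, rfl⟩ ⟨⟨y, hy, hxy⟩, hne⟩
    apply hne
    have := ha hx
    have := hb hy
    simp only [Set.mem_singleton_iff] at *
    linarith
  · exact (hB.image (continuous_const_add a)).measurableSet.diff (measurableSet_singleton _)

/-- Inner regularity reduces this to compact sets; adjoining the points `a` and `b` keeps the
compact subsets nonempty. The set `C` need not be measurable. -/
theorem volume_add_le {A B C : Set ℝ} (hA : MeasurableSet A) (hB : MeasurableSet B)
    (hAn : A.Nonempty) (hBn : B.Nonempty) (h : ∀ a ∈ A, ∀ b ∈ B, a + b ∈ C) :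
    volume A + volume B ≤ volume C := by
  obtain ⟨a, ha⟩ := hAn
  obtain ⟨b, hb⟩ := hBn
  have hAC : volume A ≤ volume C := by
    have h1 : volume ((fun x => x + b) '' A) = volume A := by
      rw [Set.image_add_right, measure_preimage_add_right]
    rw [← h1]
    refine measure_mono ?_
    rintro _ ⟨x, hx, rfl⟩
    exact h x hx b hb
  rcases eq_or_ne (volume A) ∞ with hAi | hAi
  · rw [hAi] at hAC ⊢
    rw [top_le_iff.1 hAC]; exact le_top
  have key : ∀ K ⊆ B, IsCompact K → volume A + volume K ≤ volume C := by
    intro K hKB hK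
    have hKb : volume K ≤ volume (K ∪ {b}) := measure_mono Set.subset_union_left
    have hK' := hK.union (isCompact_singleton (x := b))
    have hfin : volume (K ∪ {b}) ≠ ∞ := hK'.measure_ne_top
    have hle : ∀ L ⊆ A, IsCompact L → volume L + volume (K ∪ {b}) ≤ volume C := by
      intro L hLA hL
      refine le_trans ?_ (volume_add_le_of_isCompact (hL.union (isCompact_singleton (x := a))) hK'
        ⟨a, by simp⟩ ⟨b, by simp⟩ (C := C) ?_)
      · gcongr; exact Set.subset_union_left
      · rintro x hx y hy
        refine h x ?_ y ?_
        · rcases hx with hx | rfl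
          exacts [hLA hx, ha]
        · rcases hy with hy | rfl
          exacts [hKB hy, hb]
    have : volume A ≤ volume C - volume (K ∪ {b}) := by
      rw [hA.measure_eq_iSup_isCompact]
      exact iSup_le fun L => iSup_le fun hLA => iSup_le fun hL =>
        ENNReal.le_sub_of_add_le_right hfin (hle L hLA hL)
    have h0 := hle ∅ (Set.empty_subset _) isCompact_empty
    rw [measure_empty, zero_add] at h0
    calc volume A + volume K ≤ (volume C - volume (K ∪ {b})) + volume (K ∪ {b}) := by gcongr
      _ = volume C := tsub_add_cancel_of_le h0
  have : volume B ≤ volume C - volume A := by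
    rw [hB.measure_eq_iSup_isCompact]
    exact iSup_le fun L => iSup_le fun hLA => iSup_le fun hL =>
      ENNReal.le_sub_of_add_le_left hAi (key L hLA hL)
  calc volume A + volume B ≤ volume A + (volume C - volume A) := by gcongr
    _ = volume C := add_tsub_cancel_of_le hAC

theorem mul_volume_add_le {A B C : Set ℝ} (hA : MeasurableSet A) (hB : MeasurableSet B)
    (hAn : A.Nonempty) (hBn : B.Nonempty) {r s : ℝ} (hr : 0 < r) (hs : 0 < s)
    (h : ∀ a ∈ A, ∀ b ∈ B, r * a + s * b ∈ C) :
    ENNReal.ofReal r * volume A + ENNReal.ofReal s * volume B ≤ volume C := by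
  have e : ∀ (r : ℝ) (_ : 0 < r) (A : Set ℝ), ENNReal.ofReal r * volume A = volume (r • A) := by
    intro r hr A
    rw [Measure.addHaar_smul, Module.finrank_self, pow_one, abs_of_pos hr]
  rw [e r hr, e s hs]
  refine volume_add_le (hA.const_smul_of_ne_zero hr.ne') (hB.const_smul_of_ne_zero hs.ne')
    (hAn.smul_set) (hBn.smul_set) ?_
  rintro _ ⟨x, hx, rfl⟩ _ ⟨y, hy, rfl⟩
  exact h x hx y hy

/-! ### The Prékopa-Leindler inequality -/

/-- The Prékopa-Leindler inequality for the measure `μ`. -/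
def PrekopaLeindler {E : Type*} [MeasurableSpace E] [AddCommGroup E] [Module ℝ E]
    (μ : Measure E) : Prop :=
  ∀ r s : ℝ, 0 < r → 0 < s → r + s = 1 → ∀ f g h : E → ℝ≥0∞,
    Measurable f → Measurable g → Measurable h →
    (∀ x y, f x ^ r * g y ^ s ≤ h (r • x + s • y)) →
    (∫⁻ x, f x ∂μ) ^ r * (∫⁻ x, g x ∂μ) ^ s ≤ ∫⁻ x, h x ∂μ

theorem ENNReal_geom_mean_le {r s : ℝ} (hr : 0 < r) (hs : 0 < s) (hrs : r + s = 1)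
    (a b : ℝ≥0∞) : a ^ r * b ^ s ≤ ENNReal.ofReal r * a + ENNReal.ofReal s * b := by
  rcases eq_or_ne a ∞ with rfl | ha
  · rw [ENNReal.mul_top (by simpa using hr)]; simp
  rcases eq_or_ne b ∞ with rfl | hb
  · rw [ENNReal.mul_top (by simpa using hs)]; simp
  lift a to ℝ≥0 using ha
  lift b to ℝ≥0 using hb
  lift r to ℝ≥0 using hr.le
  lift s to ℝ≥0 using hs.le
  have := NNReal.geom_mean_le_arith_mean2_weighted r s a b (by exact_mod_cast hrs)
  rw [ENNReal.ofReal_coe_nnreal, ENNReal.ofReal_coe_nnreal,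
    ← ENNReal.coe_rpow_of_nonneg _ r.coe_nonneg, ← ENNReal.coe_rpow_of_nonneg _ s.coe_nonneg]
  exact_mod_cast this

/-- With both suprema equal to `1`, the level sets `{f > t}` and `{g > t}` are nonempty for the same
`t`, namely `t < 1`. There Brunn-Minkowski applies, because `r{f > t} + s{g > t} ⊆ {h > t}`.
Integration over `t` bounds the arithmetic mean of the two integrals, which dominates the geometric
mean. -/
theorem prekopaLeindler_real_of_iSup_eq_one {r s : ℝ} (hr : 0 < r) (hs : 0 < s) (hrs : r + s = 1)
    {f g h : ℝ → ℝ≥0∞} (hf : Measurable f) (hg : Measurable g) (hh : Measurable h)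
    (hf1 : ⨆ x, f x = 1) (hg1 : ⨆ x, g x = 1)
    (hfg : ∀ x y, f x ^ r * g y ^ s ≤ h (r • x + s • y)) :
    (∫⁻ x, f x) ^ r * (∫⁻ x, g x) ^ s ≤ ∫⁻ x, h x := by
  refine (ENNReal_geom_mean_le hr hs hrs _ _).trans ?_
  rw [lintegral_eq_lintegral_superlevel volume hf, lintegral_eq_lintegral_superlevel volume hg,
    lintegral_eq_lintegral_superlevel volume hh]
  have hmeas : ∀ f : ℝ → ℝ≥0∞, Measurable fun t : ℝ => volume {x | ENNReal.ofReal t < f x} := by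
    intro f
    refine Antitone.measurable fun t t' htt' => measure_mono fun x hx => ?_
    exact lt_of_le_of_lt (ENNReal.ofReal_le_ofReal htt') hx
  rw [← lintegral_const_mul _ (hmeas f), ← lintegral_const_mul _ (hmeas g),
    ← lintegral_add_left ((hmeas f).const_mul _)]
  refine lintegral_mono fun t => ?_
  by_cases ht : ENNReal.ofReal t < 1
  · obtain ⟨x, hx⟩ := lt_iSup_iff.1 (hf1 ▸ ht)
    obtain ⟨y, hy⟩ := lt_iSup_iff.1 (hg1 ▸ ht)
    refine mul_volume_add_le (measurableSet_lt measurable_const hf)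
      (measurableSet_lt measurable_const hg) ⟨x, hx⟩ ⟨y, hy⟩ hr hs fun a ha b hb => ?_
    refine lt_of_lt_of_le ?_ (hfg a b)
    calc ENNReal.ofReal t = ENNReal.ofReal t ^ r * ENNReal.ofReal t ^ s := by
          rw [← ENNReal.rpow_add_of_nonneg _ _ hr.le hs.le, hrs, ENNReal.rpow_one]
      _ < f a ^ r * g b ^ s :=
          ENNReal.mul_lt_mul (ENNReal.rpow_lt_rpow ha hr) (ENNReal.rpow_lt_rpow hb hs)
  · have hempty : ∀ f : ℝ → ℝ≥0∞, ⨆ x, f x = 1 → {x | ENNReal.ofReal t < f x} = ∅ := by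
      intro f hf
      ext x
      simp only [Set.mem_ofPred_eq, Set.mem_empty_iff_false, iff_false, not_lt]
      exact (le_iSup f x).trans (hf.le.trans (not_lt.1 ht))
    simp [hempty f hf1, hempty g hg1]

theorem prekopaLeindler_real_of_bounded {r s : ℝ} (hr : 0 < r) (hs : 0 < s) (hrs : r + s = 1)
    {f g h : ℝ → ℝ≥0∞} (hf : Measurable f) (hg : Measurable g) (hh : Measurable h)
    (hf1 : ⨆ x, f x ≠ ∞) (hg1 : ⨆ x, g x ≠ ∞)
    (hfg : ∀ x y, f x ^ r * g y ^ s ≤ h (r • x + s • y)) :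
    (∫⁻ x, f x) ^ r * (∫⁻ x, g x) ^ s ≤ ∫⁻ x, h x := by
  set a := ⨆ x, f x with ha
  set b := ⨆ x, g x with hb
  rcases eq_or_ne a 0 with ha0 | ha0
  · have : f = 0 := by
      ext x; exact le_antisymm ((le_iSup f x).trans ha0.le) bot_le
    simp [this, hr]
  rcases eq_or_ne b 0 with hb0 | hb0
  · have : g = 0 := by
      ext x; exact le_antisymm ((le_iSup g x).trans hb0.le) bot_le
    simp [this, hs]
  have hc0 : a⁻¹ ^ r * b⁻¹ ^ s ≠ 0 := by simp [hr.le, hs.le, hf1, hg1]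
  have hcI : a⁻¹ ^ r * b⁻¹ ^ s ≠ ∞ := by
    refine ENNReal.mul_ne_top ?_ ?_ <;> refine ENNReal.rpow_ne_top_of_nonneg ?_ ?_ <;>
      simp [hr.le, hs.le, ha0, hb0]
  have key := prekopaLeindler_real_of_iSup_eq_one hr hs hrs (hf.const_mul a⁻¹) (hg.const_mul b⁻¹)
    (hh.const_mul (a⁻¹ ^ r * b⁻¹ ^ s))
    (by rw [← ENNReal.mul_iSup, ENNReal.inv_mul_cancel ha0 hf1])
    (by rw [← ENNReal.mul_iSup, ENNReal.inv_mul_cancel hb0 hg1]) (fun x y => by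
      rw [ENNReal.mul_rpow_of_nonneg _ _ hr.le, ENNReal.mul_rpow_of_nonneg _ _ hs.le,
        mul_mul_mul_comm]
      gcongr
      exact hfg x y)
  rw [lintegral_const_mul _ hf, lintegral_const_mul _ hg, lintegral_const_mul _ hh,
    ENNReal.mul_rpow_of_nonneg _ _ hr.le, ENNReal.mul_rpow_of_nonneg _ _ hs.le,
    mul_mul_mul_comm] at key
  exact (ENNReal.mul_le_mul_iff_right hc0 hcI).1 key

theorem tendsto_lintegral_min_natCast {α : Type*} [MeasurableSpace α] (μ : Measure α)
    {f : α → ℝ≥0∞} (hf : Measurable f) :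
    Filter.Tendsto (fun n : ℕ => ∫⁻ x, min (f x) n ∂μ) Filter.atTop (nhds (∫⁻ x, f x ∂μ)) := by
  refine lintegral_tendsto_of_tendsto_of_monotone (fun n => (hf.min measurable_const).aemeasurable)
    (Filter.Eventually.of_forall fun x => ?_) (Filter.Eventually.of_forall fun x => ?_)
  · intro n m hnm
    exact min_le_min le_rfl (by exact_mod_cast hnm)
  · have := (tendsto_const_nhds (x := f x)).min ENNReal.tendsto_nat_nhds_top
    simpa using this

/-- Truncation at height `n` reduces this to bounded functions, which can be normalized by their
suprema. Vanishing integrals are treated apart because the limit of the product is not controlled at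
`0 · ∞`. -/
theorem prekopaLeindler_real : PrekopaLeindler (volume : Measure ℝ) := by
  intro r s hr hs hrs f g h hf hg hh hfg
  rcases eq_or_ne (∫⁻ x, f x) 0 with hf0 | hf0
  · simp [hf0, hr]
  rcases eq_or_ne (∫⁻ x, g x) 0 with hg0 | hg0
  · simp [hg0, hs]
  have t1 := ((ENNReal.continuous_rpow_const (y := r)).tendsto _).comp
    (tendsto_lintegral_min_natCast volume hf)
  have t2 := ((ENNReal.continuous_rpow_const (y := s)).tendsto _).comp
    (tendsto_lintegral_min_natCast volume hg)
  have h1 : (∫⁻ x, f x) ^ r ≠ 0 := by simp [hf0, hr.le]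
  have h2 : (∫⁻ x, g x) ^ s ≠ 0 := by simp [hg0, hs.le]
  refine le_of_tendsto (ENNReal.Tendsto.mul t1 (Or.inl h1) t2 (Or.inl h2))
    (Filter.Eventually.of_forall fun n => ?_)
  have hb : ∀ f : ℝ → ℝ≥0∞, ⨆ x, min (f x) n ≠ ∞ := fun f =>
    ((iSup_le fun x => min_le_right _ _).trans_lt (ENNReal.natCast_lt_top n)).ne
  refine prekopaLeindler_real_of_bounded hr hs hrs (hf.min measurable_const)
    (hg.min measurable_const) hh (hb f) (hb g) fun x y => ?_
  refine le_trans ?_ (hfg x y)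
  gcongr <;> exact min_le_left _ _

/-- The inequality for `ν` on the fibres says that the partial integrals satisfy the hypothesis of
the inequality for `μ`. -/
theorem PrekopaLeindler.prod {E F : Type*} [MeasurableSpace E] [AddCommGroup E] [Module ℝ E]
    [MeasurableSpace F] [AddCommGroup F] [Module ℝ F] {μ : Measure E} {ν : Measure F}
    [SFinite μ] [SFinite ν] (hμ : PrekopaLeindler μ) (hν : PrekopaLeindler ν) :
    PrekopaLeindler (μ.prod ν) := by
  intro r s hr hs hrs f g h hf hg hh hfg
  rw [lintegral_prod _ hf.aemeasurable, lintegral_prod _ hg.aemeasurable,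
    lintegral_prod _ hh.aemeasurable]
  refine hμ r s hr hs hrs _ _ _ hf.lintegral_prod_right' hg.lintegral_prod_right'
    hh.lintegral_prod_right' fun x y => ?_
  exact hν r s hr hs hrs _ _ _ (hf.comp measurable_prodMk_left) (hg.comp measurable_prodMk_left)
    (hh.comp measurable_prodMk_left) fun x' y' => hfg (x, x') (y, y')

theorem PrekopaLeindler.of_measurePreserving {E F : Type*} [MeasurableSpace E] [AddCommGroup E]
    [Module ℝ E] [MeasurableSpace F] [AddCommGroup F] [Module ℝ F] {μ : Measure E}
    {ν : Measure F} (hμ : PrekopaLeindler μ) (e : E ≃ᵐ F) (he : MeasurePreserving e μ ν)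
    (hlin : ∀ (r s : ℝ) x y, e (r • x + s • y) = r • e x + s • e y) :
    PrekopaLeindler ν := by
  intro r s hr hs hrs f g h hf hg hh hfg
  rw [← he.lintegral_comp hf, ← he.lintegral_comp hg, ← he.lintegral_comp hh]
  refine hμ r s hr hs hrs _ _ _ (hf.comp e.measurable) (hg.comp e.measurable)
    (hh.comp e.measurable) fun x y => ?_
  simpa [hlin] using hfg (e x) (e y)

theorem prekopaLeindler_fin (n : ℕ) : PrekopaLeindler (volume : Measure (Fin n → ℝ)) := by
  induction n with
  | zero =>
    intro r s hr hs hrs f g h hf hg hh hfg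
    rw [volume_pi, Measure.pi_of_empty (x := 0), lintegral_dirac, lintegral_dirac, lintegral_dirac]
    simpa using hfg 0 0
  | succ n ih =>
    have := (prekopaLeindler_real.prod ih)
    exact this.of_measurePreserving (MeasurableEquiv.piFinSuccAbove (fun _ => ℝ) 0).symm
      (volume_preserving_piFinSuccAbove (fun _ => ℝ) 0).symm (fun r s x y => by
        apply (MeasurableEquiv.piFinSuccAbove (fun _ => ℝ) 0).injective
        rw [MeasurableEquiv.apply_symm_apply]
        ext i
        · simp [MeasurableEquiv.piFinSuccAbove]
        · simp [MeasurableEquiv.piFinSuccAbove, Fin.tail])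

theorem prekopaLeindler_pi (κ : Type*) [Fintype κ] :
    PrekopaLeindler (volume : Measure (κ → ℝ)) :=
  (prekopaLeindler_fin (Fintype.card κ)).of_measurePreserving
    (MeasurableEquiv.piCongrLeft (fun _ => ℝ) (Fintype.equivFin κ).symm)
    (volume_measurePreserving_piCongrLeft _ _) (fun r s x y => by
      ext i
      obtain ⟨j, rfl⟩ := (Fintype.equivFin κ).symm.surjective i
      simp [MeasurableEquiv.piCongrLeft, Equiv.piCongrLeft_apply_apply])

/-- The multiplicative Brunn-Minkowski inequality. -/
theorem volume_rpow_mul_le {κ : Type*} [Fintype κ] {A B C : Set (κ → ℝ)} (hA : MeasurableSet A)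
    (hB : MeasurableSet B) (hC : MeasurableSet C) {r s : ℝ} (hr : 0 < r) (hs : 0 < s)
    (hrs : r + s = 1) (h : ∀ a ∈ A, ∀ b ∈ B, r • a + s • b ∈ C) :
    volume A ^ r * volume B ^ s ≤ volume C := by
  have := prekopaLeindler_pi κ r s hr hs hrs (A.indicator 1) (B.indicator 1) (C.indicator 1)
    (measurable_one.indicator hA) (measurable_one.indicator hB) (measurable_one.indicator hC)
    fun x y => by
      by_cases hx : x ∈ A
      · by_cases hy : y ∈ B
        · simp [hx, hy, h x hx y hy]
        · simp [hy, hs]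
      · simp [hx, hr]
  simpa [lintegral_indicator_one, hA, hB, hC] using this

/-- The box with centre `c` and half side lengths `r`. -/
def box {κ : Type*} (c r : κ → ℝ) : Set (κ → ℝ) :=
  Set.univ.pi fun k => Set.Ioo (c k - r k) (c k + r k)

theorem measurableSet_box {κ : Type*} [Countable κ] (c r : κ → ℝ) : MeasurableSet (box c r) :=
  MeasurableSet.univ_pi fun _ => measurableSet_Ioo

/-- Moving a box towards the centre increases the volume of its intersection with a symmetric
convex set. -/
theorem volume_inter_box_le {κ : Type*} [Fintype κ] {K : Set (κ → ℝ)} (hK : MeasurableSet K)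
    (hconv : Convex ℝ K) (hsymm : ∀ x ∈ K, -x ∈ K) (c r : κ → ℝ) {q : ℝ} (hq0 : 0 ≤ q)
    (hq1 : q ≤ 1) : volume (K ∩ box c r) ≤ volume (K ∩ box (q • c) r) := by
  rcases hq1.eq_or_lt with rfl | hq1
  · rw [one_smul]
  have hA : MeasurableSet (K ∩ box c r) := hK.inter (measurableSet_box c r)
  -- By symmetry of `K`, the reflected set `-(K ∩ box c r)` lies in `K`, and it has the same volume
  -- and centre `-c`. The weights are those with `(1 + q)/2 · c - (1 - q)/2 · c = q c`; half side
  -- lengths are unchanged.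
  have key := volume_rpow_mul_le (r := (1 + q) / 2) (s := (1 - q) / 2)
    (C := K ∩ box (q • c) r) hA hA.neg
    (hK.inter (measurableSet_box _ r)) (by linarith) (by linarith) (by ring) ?_
  · rwa [Measure.measure_neg, ← ENNReal.rpow_add_of_nonneg _ _ (by linarith) (by linarith),
      show (1 + q) / 2 + (1 - q) / 2 = 1 by ring, ENNReal.rpow_one] at key
  · rintro a ⟨haK, ha⟩ b ⟨hbK, hb⟩
    refine ⟨hconv haK (by simpa using hsymm _ hbK) (by linarith) (by linarith) (by ring), ?_⟩
    intro k _
    have h1 := ha k trivial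
    have h2 := hb k trivial
    simp only [Pi.neg_apply, Set.mem_Ioo, Pi.add_apply, Pi.smul_apply, smul_eq_mul] at *
    constructor <;> nlinarith

end Petty

/-! ### Sliding intervals: the rearrangement inequality on the line -/

namespace Petty

theorem measure_pi_sdiff_le {κ : Type*} [Fintype κ] [DecidableEq κ] {α : κ → Type*}
    [∀ k, MeasurableSpace (α k)] (μ : ∀ k, Measure (α k)) [∀ k, SigmaFinite (μ k)]
    (A B : ∀ k, Set (α k)) :
    Measure.pi μ (Set.univ.pi A \ Set.univ.pi B)
      ≤ ∑ k, μ k (A k \ B k) * ∏ j ∈ Finset.univ.erase k, μ j (A j) := by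
  have h1 : Set.univ.pi A \ Set.univ.pi B
      ⊆ ⋃ k, Set.univ.pi (Function.update A k (A k \ B k)) := by
    rintro x ⟨hA, hB⟩
    simp only [Set.mem_pi, Set.mem_univ, true_imp_iff, not_forall] at hA hB
    obtain ⟨k, hk⟩ := hB
    refine Set.mem_iUnion.2 ⟨k, fun j _ => ?_⟩
    rcases eq_or_ne j k with rfl | hj
    · simpa using ⟨hA j, hk⟩
    · simpa [hj] using hA j
  refine (measure_mono h1).trans ((measure_iUnion_fintype_le _ _).trans ?_)
  refine Finset.sum_le_sum fun k _ => ?_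
  rw [Measure.pi_pi, ← Finset.mul_prod_erase _ _ (Finset.mem_univ k)]
  rw [Function.update_self]
  gcongr with j hj
  rw [Function.update_of_ne (Finset.ne_of_mem_erase hj)]

/-- The union of the intervals with centres `q * p.1` and radii `p.2`, for `p ∈ J`. -/
def intervals (q : ℝ) (J : Finset (ℝ × ℝ)) : Set ℝ :=
  ⋃ p ∈ J, Set.Ioo (q * p.1 - p.2) (q * p.1 + p.2)

/-- The intervals with centres `q * p.1` and radii `p.2`, for `p ∈ J`, are nonempty and disjoint. -/
def Separated (q : ℝ) (J : Finset (ℝ × ℝ)) : Prop :=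
  (∀ p ∈ J, 0 < p.2) ∧ ∀ p ∈ J, ∀ p' ∈ J, p ≠ p' → p.2 + p'.2 ≤ q * |p.1 - p'.1|

theorem Separated.disjoint {q : ℝ} (hq : 0 ≤ q) {J : Finset (ℝ × ℝ)} (h : Separated q J)
    {p p' : ℝ × ℝ} (hp : p ∈ J) (hp' : p' ∈ J) (hne : p ≠ p') :
    Disjoint (Set.Ioo (q * p.1 - p.2) (q * p.1 + p.2))
      (Set.Ioo (q * p'.1 - p'.2) (q * p'.1 + p'.2)) := by
  rw [Set.disjoint_left]
  rintro x ⟨h1, h2⟩ ⟨h3, h4⟩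
  have := h.2 p hp p' hp' hne
  rw [show q * |p.1 - p'.1| = |q * p.1 - q * p'.1| by
    rw [← mul_sub, abs_mul, abs_of_nonneg hq]] at this
  have : |q * p.1 - q * p'.1| < p.2 + p'.2 := by
    rw [abs_lt]; constructor <;> linarith
  linarith

theorem Separated.mono {q q' : ℝ} (hqq : q ≤ q') {J : Finset (ℝ × ℝ)} (h : Separated q J) :
    Separated q' J :=
  ⟨h.1, fun p hp p' hp' hne => (h.2 p hp p' hp' hne).trans
    (mul_le_mul_of_nonneg_right hqq (abs_nonneg _))⟩

theorem volume_intervals {J : Finset (ℝ × ℝ)} (h : Separated 1 J) :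
    volume (intervals 1 J) = ENNReal.ofReal (2 * ∑ p ∈ J, p.2) := by
  rw [intervals, measure_biUnion_finset (fun p hp p' hp' hne => h.disjoint zero_le_one hp hp' hne)
    (fun _ _ => measurableSet_Ioo), Finset.mul_sum, ENNReal.ofReal_sum_of_nonneg
    (fun p hp => by linarith [h.1 p hp])]
  refine Finset.sum_congr rfl fun p _ => ?_
  rw [Real.volume_Ioo]; congr 1; ring

variable {κ : Type*} [Fintype κ]

theorem volume_inter_pi_intervals [DecidableEq κ] {K : Set (κ → ℝ)} (hK : MeasurableSet K) {q : ℝ}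
    (hq : 0 ≤ q) (J : κ → Finset (ℝ × ℝ)) (hJ : ∀ k, Separated q (J k)) :
    volume (K ∩ Set.univ.pi fun k => intervals q (J k))
      = ∑ p ∈ Fintype.piFinset J,
        volume (K ∩ box (q • fun k => (p k).1) (fun k => (p k).2)) := by
  rw [← measure_biUnion_finset]
  · congr 1
    ext x
    simp only [Set.mem_inter_iff, Set.mem_pi, Set.mem_univ, true_imp_iff, intervals, Set.mem_iUnion,
      Fintype.mem_piFinset, box, exists_prop, Pi.smul_apply, smul_eq_mul]
    constructor
    · rintro ⟨hx, h⟩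
      choose p hp using h
      exact ⟨p, fun k => (hp k).1, hx, fun k => (hp k).2⟩
    · rintro ⟨p, hp, hx, h⟩
      exact ⟨hx, fun k => ⟨p k, hp k, h k⟩⟩
  · intro p hp p' hp' hne
    obtain ⟨k, hk⟩ := Function.ne_iff.1 hne
    rw [Finset.mem_coe, Fintype.mem_piFinset] at hp hp'
    refine Set.disjoint_left.2 fun x hx hx' => ?_
    exact Set.disjoint_left.1 ((hJ k).disjoint hq (hp k) (hp' k) hk) (hx.2 k trivial)
      (hx'.2 k trivial)
  · intro p _
    exact hK.inter (measurableSet_box _ _)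

/-- Products of unions of intervals split into disjoint boxes. Separation at `q` keeps the boxes
disjoint after sliding, so `volume_inter_box_le` can be summed over them. -/
theorem volume_inter_pi_intervals_le {K : Set (κ → ℝ)} (hK : MeasurableSet K)
    (hconv : Convex ℝ K) (hsymm : ∀ x ∈ K, -x ∈ K) {q : ℝ} (hq0 : 0 ≤ q) (hq1 : q ≤ 1)
    (J : κ → Finset (ℝ × ℝ)) (hJ : ∀ k, Separated q (J k)) :
    volume (K ∩ Set.univ.pi fun k => intervals 1 (J k))
      ≤ volume (K ∩ Set.univ.pi fun k => intervals q (J k)) := by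
  classical
  rw [volume_inter_pi_intervals hK zero_le_one J fun k => (hJ k).mono hq1,
    volume_inter_pi_intervals hK hq0 J hJ]
  refine Finset.sum_le_sum fun p _ => ?_
  rw [one_smul]
  exact volume_inter_box_le hK hconv hsymm _ _ hq0 hq1

/-- Absorbs the factor `q` into the centres, so that an induction can restart at `q = 1`. -/
theorem Separated.exists_rescale {q : ℝ} (hq : 0 < q) {J : Finset (ℝ × ℝ)} (h : Separated q J) :
    Separated 1 (J.image fun p => (q * p.1, p.2)) ∧
      (J.image fun p => (q * p.1, p.2)).card = J.card ∧
      intervals 1 (J.image fun p => (q * p.1, p.2)) = intervals q J ∧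
      ∑ p ∈ J.image (fun p => (q * p.1, p.2)), p.2 = ∑ p ∈ J, p.2 := by
  have hinj : Function.Injective fun p : ℝ × ℝ => (q * p.1, p.2) := by
    rintro ⟨a, b⟩ ⟨c, d⟩ h
    simp only [Prod.mk.injEq] at h
    simp [mul_left_cancel₀ hq.ne' h.1, h.2]
  refine ⟨⟨?_, ?_⟩, Finset.card_image_of_injective _ hinj, ?_,
    Finset.sum_image hinj.injOn⟩
  · intro p hp
    obtain ⟨p0, hp0, rfl⟩ := Finset.mem_image.1 hp
    exact h.1 p0 hp0
  · intro p hp p' hp' hne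
    obtain ⟨p0, hp0, rfl⟩ := Finset.mem_image.1 hp
    obtain ⟨p1, hp1, rfl⟩ := Finset.mem_image.1 hp'
    have := h.2 p0 hp0 p1 hp1 (fun h => hne (by rw [h]))
    simpa [← mul_sub, abs_mul, abs_of_pos hq] using this
  · simp only [intervals, Finset.set_biUnion_finset_image, one_mul]

/-- Two touching intervals become one interval of the same total length. Only an inclusion holds
between the unions, since the open intervals miss their common end point. -/
theorem Separated.exists_merge {J : Finset (ℝ × ℝ)} (h : Separated 1 J) {p p' : ℝ × ℝ}
    (hp : p ∈ J) (hp' : p' ∈ J) (hlt : p.1 < p'.1) (htouch : p.2 + p'.2 = p'.1 - p.1) :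
    ∃ J', Separated 1 J' ∧ J'.card < J.card ∧ intervals 1 J ⊆ intervals 1 J' ∧
      ∑ p ∈ J', p.2 = ∑ p ∈ J, p.2 := by
  have hne : p' ≠ p := fun h => by simp [h] at hlt
  have hp'e : p' ∈ J.erase p := Finset.mem_erase.2 ⟨hne, hp'⟩
  have h1 := h.1 p hp
  have h2 := h.1 p' hp'
  -- By `htouch` this is the midpoint and half length of the interval from `p.1 - p.2` to `p'.1 +
  -- p'.2`.
  set m : ℝ × ℝ := (p.1 + p'.2, p.2 + p'.2) with hm
  set J0 := (J.erase p).erase p' with hJ0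
  have hJ0m : ∀ x, x ∈ J0 ↔ x ≠ p' ∧ x ≠ p ∧ x ∈ J := by simp [hJ0]
  have hsep : ∀ x ∈ J0, m.2 + x.2 ≤ |m.1 - x.1| := by
    intro x hx
    obtain ⟨hx1, hx2, hx⟩ := (hJ0m x).1 hx
    have a1 := h.2 x hx p hp hx2
    have a2 := h.2 x hx p' hp' hx1
    have a3 := h.1 x hx
    rw [one_mul, le_abs] at a1 a2
    simp only [hm]
    rw [le_abs]
    rcases a1 with a1 | a1
    · rcases a2 with a2 | a2
      · right; linarith
      · linarith
    · left; linarith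
  have hmJ : m ∉ J0 := fun hmem => by
    have := hsep m hmem
    simp only [sub_self, abs_zero, hm] at this
    linarith
  refine ⟨insert m J0, ⟨?_, ?_⟩, ?_, ?_, ?_⟩
  · intro x hx
    rcases Finset.mem_insert.1 hx with rfl | hx
    · simp only [hm]; linarith
    · exact h.1 x ((hJ0m x).1 hx).2.2
  · intro x hx y hy hxy
    rw [one_mul]
    rcases Finset.mem_insert.1 hx with rfl | hx
    · rcases Finset.mem_insert.1 hy with rfl | hy
      · exact absurd rfl hxy
      · exact hsep y hy
    · rcases Finset.mem_insert.1 hy with rfl | hy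
      · rw [add_comm, abs_sub_comm]; exact hsep x hx
      · have := h.2 x ((hJ0m x).1 hx).2.2 y ((hJ0m y).1 hy).2.2 hxy
        rwa [one_mul] at this
  · rw [Finset.card_insert_of_notMem hmJ, Finset.card_erase_of_mem hp'e,
      Finset.card_erase_of_mem hp]
    have : 1 < J.card := Finset.one_lt_card.2 ⟨p, hp, p', hp', hne.symm⟩
    omega
  · intro y hy
    simp only [intervals, Set.mem_iUnion, one_mul] at hy ⊢
    obtain ⟨x, hx, hxy⟩ := hy
    rcases eq_or_ne x p with rfl | hxp
    · refine ⟨m, Finset.mem_insert_self _ _, ?_, ?_⟩ <;> simp only [hm] <;> linarith [hxy.1, hxy.2]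
    rcases eq_or_ne x p' with rfl | hxp'
    · refine ⟨m, Finset.mem_insert_self _ _, ?_, ?_⟩ <;> simp only [hm] <;> linarith [hxy.1, hxy.2]
    exact ⟨x, Finset.mem_insert_of_mem ((hJ0m x).2 ⟨hxp', hxp, hx⟩), hxy⟩
  · rw [Finset.sum_insert hmJ, ← Finset.add_sum_erase J _ hp, ← Finset.add_sum_erase _ _ hp'e]
    simp only [hm]; ring

/-- Induction on the total number of intervals. All of them slide towards the origin at proportional
speed until two in the same factor touch; merging these lowers the count and preserves the total
lengths. Once each factor is a single interval, everything slides to `q = 0`. -/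
theorem volume_inter_pi_intervals_le_symmetric {K : Set (κ → ℝ)} (hK : MeasurableSet K)
    (hconv : Convex ℝ K) (hsymm : ∀ x ∈ K, -x ∈ K) (J : κ → Finset (ℝ × ℝ))
    (hJ : ∀ k, Separated 1 (J k)) :
    volume (K ∩ Set.univ.pi fun k => intervals 1 (J k))
      ≤ volume (K ∩ Set.univ.pi fun k => Set.Ioo (-∑ p ∈ J k, p.2) (∑ p ∈ J k, p.2)) := by
  classical
  induction hN : ∑ k, (J k).card using Nat.strong_induction_on generalizing J with
  | _ N ih =>
  subst hN
  set P : Finset (Σ _ : κ, (ℝ × ℝ) × (ℝ × ℝ)) := Finset.univ.sigma fun k => (J k).offDiag with hP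
  rcases P.eq_empty_or_nonempty with hPe | hPn
  · by_cases hne : ∃ k, J k = ∅
    · obtain ⟨k, hk⟩ := hne
      have : (Set.univ.pi fun k => intervals 1 (J k)) = ∅ :=
        Set.univ_pi_eq_empty (i := k) (by simp [intervals, hk])
      simp [this]
    · push Not at hne
      have : ∀ k, ∃ p, J k = {p} := by
        intro k
        obtain ⟨p, hp⟩ := hne k
        refine ⟨p, Finset.eq_singleton_iff_unique_mem.2 ⟨hp, fun p' hp' => ?_⟩⟩
        by_contra hpp
        have : (⟨k, p', p⟩ : Σ _ : κ, (ℝ × ℝ) × (ℝ × ℝ)) ∈ P := by simp [hP, hp, hp', hpp]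
        simp [hPe] at this
      choose p hp using this
      have h0 := volume_inter_box_le hK hconv hsymm (fun k => (p k).1) (fun k => (p k).2) le_rfl
        zero_le_one
      simpa [hp, intervals, box] using h0
  -- A pair with centres scaled by `q` touches when `q` equals the sum of its radii over the
  -- distance of its centres. As `q` decreases from `1`, the pair with the largest ratio touches
  -- first.
  · obtain ⟨⟨k, p, p'⟩, hmem, hmax⟩ :=
      P.exists_max_image (fun s => (s.2.1.2 + s.2.2.2) / |s.2.1.1 - s.2.2.1|) hPn
    simp only [hP, Finset.mem_sigma, Finset.mem_univ, true_and, Finset.mem_offDiag] at hmem hmax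
    set q := (p.2 + p'.2) / |p.1 - p'.1| with hq
    have hpos : ∀ k, ∀ p ∈ J k, ∀ p' ∈ J k, p ≠ p' → 0 < |p.1 - p'.1| := by
      intro k p hp p' hp' hne
      have := (hJ k).2 p hp p' hp' hne
      have := (hJ k).1 p hp
      have := (hJ k).1 p' hp'
      linarith
    have hd := hpos k p hmem.1 p' hmem.2.1 hmem.2.2
    have h1 := (hJ k).1 p hmem.1
    have h2 := (hJ k).1 p' hmem.2.1
    have hq0 : 0 < q := by positivity
    have hq1 : q ≤ 1 := by
      rw [hq, div_le_one hd]
      simpa using (hJ k).2 p hmem.1 p' hmem.2.1 hmem.2.2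
    have hsep : ∀ k, Separated q (J k) := by
      refine fun k => ⟨(hJ k).1, fun x hx y hy hxy => ?_⟩
      have := hmax ⟨k, x, y⟩ ⟨hx, hy, hxy⟩
      rwa [div_le_iff₀ (hpos k x hx y hy hxy)] at this
    have htouch : p.2 + p'.2 = q * |p.1 - p'.1| := by
      rw [hq, div_mul_cancel₀ _ hd.ne']
    have hstep : ∃ J', Separated 1 J' ∧ J'.card < (J k).card ∧ intervals q (J k) ⊆ intervals 1 J' ∧
        ∑ p ∈ J', p.2 = ∑ p ∈ J k, p.2 := by
      obtain ⟨a1, a2, a3, a4⟩ := (hsep k).exists_rescale hq0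
      rw [← a2, ← a3, ← a4]
      have m1 := Finset.mem_image_of_mem (fun p : ℝ × ℝ => (q * p.1, p.2)) hmem.1
      have m2 := Finset.mem_image_of_mem (fun p : ℝ × ℝ => (q * p.1, p.2)) hmem.2.1
      rcases lt_trichotomy p.1 p'.1 with hlt | heq | hlt
      · refine a1.exists_merge m1 m2 (mul_lt_mul_of_pos_left hlt hq0) ?_
        rw [htouch, abs_of_neg (by linarith)]; ring
      · simp [heq] at hd
      · refine a1.exists_merge m2 m1 (mul_lt_mul_of_pos_left hlt hq0) ?_
        rw [add_comm, htouch, abs_of_pos (by linarith)]; ring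
    obtain ⟨J', b1, b2, b3, b4⟩ := hstep
    set J1 : κ → Finset (ℝ × ℝ) :=
      Function.update (fun k => (J k).image fun p => (q * p.1, p.2)) k J' with hJ1
    have hJ1k : J1 k = J' := by simp [hJ1]
    have hJ1j : ∀ j ≠ k, J1 j = (J j).image fun p => (q * p.1, p.2) := fun j hj => by
      simp [hJ1, hj]
    have c1 : ∀ j, Separated 1 (J1 j) := by
      intro j
      rcases eq_or_ne j k with rfl | hj
      · rwa [hJ1k]
      · rw [hJ1j j hj]; exact ((hsep j).exists_rescale hq0).1
    have c2 : ∀ j, intervals q (J j) ⊆ intervals 1 (J1 j) := by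
      intro j
      rcases eq_or_ne j k with rfl | hj
      · rwa [hJ1k]
      · rw [hJ1j j hj]; exact ((hsep j).exists_rescale hq0).2.2.1.ge
    have c3 : ∀ j, ∑ p ∈ J1 j, p.2 = ∑ p ∈ J j, p.2 := by
      intro j
      rcases eq_or_ne j k with rfl | hj
      · rwa [hJ1k]
      · rw [hJ1j j hj]; exact ((hsep j).exists_rescale hq0).2.2.2
    have c4 : ∑ j, (J1 j).card < ∑ j, (J j).card := by
      refine Finset.sum_lt_sum (fun j _ => ?_) ⟨k, Finset.mem_univ k, by rwa [hJ1k]⟩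
      rcases eq_or_ne j k with rfl | hj
      · rw [hJ1k]; exact b2.le
      · rw [hJ1j j hj]; exact Finset.card_image_le
    have := ih _ c4 J1 c1 rfl
    simp_rw [c3] at this
    refine (volume_inter_pi_intervals_le hK hconv hsymm hq0.le hq1 J hsep).trans
      (le_trans (measure_mono ?_) this)
    exact Set.inter_subset_inter_right _ (Set.pi_mono fun j _ => c2 j)

/-- Squeeze a compact `K ⊆ E` inside an open `O` of nearly the same measure and take the open cells
of a grid of mesh `δ` that meet `K`. They lie in the `δ`-neighbourhood of `K`, hence in `O`, and
miss only grid points of `K`, a null set. -/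
theorem exists_intervals_approx {E : Set ℝ} (hE : MeasurableSet E) (hfin : volume E ≠ ∞)
    {ε : ℝ≥0∞} (hε : ε ≠ 0) :
    ∃ J, Separated 1 J ∧ volume (E \ intervals 1 J) ≤ ε ∧
      volume (intervals 1 J) ≤ volume E + ε := by
  classical
  obtain ⟨K, hKE, hK, hEK⟩ := hE.exists_isCompact_sdiff_lt hfin hε
  obtain ⟨O, hKO, hO, hOv⟩ := K.exists_isOpen_lt_add (μ := volume) hK.measure_ne_top hε
  obtain ⟨δ, hδ, hδO⟩ := hK.exists_thickening_subset_open hO hKO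
  obtain ⟨R, hR⟩ := hK.isBounded.exists_norm_le
  set M : ℤ := ⌈R / δ⌉ + 1
  set S : Finset ℤ := (Finset.Icc (-M) M).filter
    fun j => ∃ x ∈ K, x ∈ Set.Ioo (j * δ) ((j + 1) * δ) with hS
  set c : ℤ → ℝ × ℝ := fun j => ((j + 1 / 2) * δ, δ / 2) with hc
  have hIoo : ∀ j : ℤ, Set.Ioo (1 * (c j).1 - (c j).2) (1 * (c j).1 + (c j).2)
      = Set.Ioo (j * δ) ((j + 1) * δ) := by
    intro j; simp only [hc]; congr 1 <;> ring
  have hint : intervals 1 (S.image c) = ⋃ j ∈ S, Set.Ioo (j * δ) ((j + 1) * δ) := by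
    rw [intervals, Finset.set_biUnion_finset_image]
    simp_rw [hIoo]
  refine ⟨S.image c, ⟨?_, ?_⟩, ?_, ?_⟩
  · intro p hp
    obtain ⟨j, _, rfl⟩ := Finset.mem_image.1 hp
    simp only [hc]; positivity
  · intro p hp p' hp' hne
    obtain ⟨j, _, rfl⟩ := Finset.mem_image.1 hp
    obtain ⟨j', _, rfl⟩ := Finset.mem_image.1 hp'
    have hjj : j ≠ j' := fun h => hne (by rw [h])
    have : (1 : ℝ) ≤ |(j : ℝ) - j'| := by
      exact_mod_cast Int.one_le_abs (sub_ne_zero.2 hjj)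
    simp only [hc]
    rw [← sub_mul, abs_mul, abs_of_pos hδ, one_mul,
      show (j : ℝ) + 1 / 2 - (j' + 1 / 2) = j - j' by ring]
    nlinarith
  · refine le_trans (measure_mono (t := (E \ K) ∪ Set.range fun j : ℤ => (j * δ : ℝ)) ?_) ?_
    · rintro x ⟨hxE, hx⟩
      by_cases hxK : x ∈ K
      swap
      · exact Or.inl ⟨hxE, hxK⟩
      refine Or.inr ⟨⌊x / δ⌋, ?_⟩
      by_contra hne
      apply hx
      rw [hint]
      have f1 : (⌊x / δ⌋ : ℝ) * δ ≤ x := by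
        have := Int.floor_le (x / δ)
        rwa [le_div_iff₀ hδ] at this
      have f2 : x < (⌊x / δ⌋ + 1 : ℝ) * δ := by
        have := Int.lt_floor_add_one (x / δ)
        rwa [div_lt_iff₀ hδ] at this
      have hmem : x ∈ Set.Ioo ((⌊x / δ⌋ : ℝ) * δ) ((⌊x / δ⌋ + 1) * δ) :=
        ⟨lt_of_le_of_ne f1 hne, f2⟩
      refine Set.mem_iUnion₂.2 ⟨⌊x / δ⌋, ?_, hmem⟩
      have hxR := abs_le.1 (hR x hxK)
      have g1 : x / δ ≤ R / δ := by gcongr; exact hxR.2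
      have g2 : -(R / δ) ≤ x / δ := by
        rw [← neg_div]; gcongr; exact hxR.1
      have g3 := Int.le_ceil (R / δ)
      simp only [hS, Finset.mem_filter, Finset.mem_Icc, M]
      refine ⟨⟨?_, ?_⟩, x, hxK, hmem⟩
      · rw [Int.le_floor]; push_cast; linarith
      · have : ⌊x / δ⌋ ≤ ⌈R / δ⌉ := by
          have : (⌊x / δ⌋ : ℝ) ≤ ⌈R / δ⌉ := (Int.floor_le _).trans (g1.trans g3)
          exact_mod_cast this
        linarith
    · refine (measure_union_le _ _).trans ?_
      rw [(Set.countable_range _).measure_zero, add_zero]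
      exact hEK.le
  · rw [hint]
    calc volume (⋃ j ∈ S, Set.Ioo (j * δ : ℝ) ((j + 1) * δ)) ≤ volume O := by
          refine measure_mono (Set.iUnion₂_subset fun j hj y hy => hδO ?_)
          simp only [hS, Finset.mem_filter] at hj
          obtain ⟨_, x, hxK, hx⟩ := hj
          rw [Metric.mem_thickening_iff]
          refine ⟨x, hxK, ?_⟩
          rw [Real.dist_eq, abs_lt]
          constructor <;> nlinarith [hx.1, hx.2, hy.1, hy.2]
      _ ≤ volume K + ε := hOv.le
      _ ≤ volume E + ε := by gcongr

/-- The Rogers-Brascamp-Lieb-Luttinger inequality on the line for a symmetric convex set. -/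
theorem volume_inter_pi_le_symmetric {K : Set (κ → ℝ)} (hK : MeasurableSet K)
    (hconv : Convex ℝ K) (hsymm : ∀ x ∈ K, -x ∈ K) (E : κ → Set ℝ)
    (hE : ∀ k, MeasurableSet (E k)) (hfin : ∀ k, volume (E k) ≠ ∞) :
    volume (K ∩ Set.univ.pi E)
      ≤ volume (K ∩ Set.univ.pi fun k =>
          Set.Ioo (-(volume.real (E k) / 2)) (volume.real (E k) / 2)) := by
  classical
  set v : κ → ℝ := fun k => volume.real (E k) with hv
  -- The extra `1` leaves room for approximating sets whose measure exceeds that of `E k` by at most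
  -- `ε ≤ 1`.
  set M : ℝ≥0∞ := ∑ k, volume (E k) + 1 with hM
  have hMle : ∀ k, volume (E k) + 1 ≤ M := fun k => by
    rw [hM]; gcongr
    exact Finset.single_le_sum (f := fun k => volume (E k)) (fun _ _ => zero_le)
      (Finset.mem_univ k)
  have hMfin : M ≠ ∞ := by
    simp [hM, ENNReal.sum_eq_top, hfin]
  set c : ℝ≥0∞ := ∑ k : κ, ∏ j ∈ Finset.univ.erase k, M with hc
  have hcfin : c ≠ ∞ := by
    refine ENNReal.sum_ne_top.2 fun k _ => ENNReal.prod_ne_top fun _ _ => hMfin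
  set S := Set.univ.pi fun k => Set.Ioo (-(v k / 2)) (v k / 2) with hS
  -- One error `c * ε` comes from replacing `E` by finite unions of intervals, the other from
  -- replacing the resulting symmetric intervals by those of the exact lengths.
  have key : ∀ ε : ℝ≥0∞, ε ≠ 0 → ε ≤ 1 →
      volume (K ∩ Set.univ.pi E) ≤ volume (K ∩ S) + (c * ε + c * ε) := by
    intro ε hε0 hε1
    choose J h1 h2 h3 using fun k => exists_intervals_approx (hE k) (hfin k) hε0
    have hdiff : ∀ A B : κ → Set ℝ, (∀ k, volume (A k) ≤ M) → (∀ k, volume (A k \ B k) ≤ ε) →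
        volume (Set.univ.pi A \ Set.univ.pi B) ≤ c * ε := by
      intro A B hA hAB
      refine (measure_pi_sdiff_le (fun _ => volume) A B).trans ?_
      rw [hc, Finset.sum_mul]
      refine Finset.sum_le_sum fun k _ => ?_
      rw [mul_comm]
      exact mul_le_mul' (Finset.prod_le_prod' fun j _ => hA j) (hAB k)
    have hsub : ∀ A B : Set (κ → ℝ), volume (K ∩ A) ≤ volume (K ∩ B) + volume (A \ B) := by
      intro A B
      refine (measure_mono ?_).trans (measure_union_le _ _)
      rintro x ⟨hx, hxA⟩
      by_cases hxB : x ∈ B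
      exacts [Or.inl ⟨hx, hxB⟩, Or.inr ⟨hxA, hxB⟩]
    set l : κ → ℝ := fun k => ∑ p ∈ J k, p.2 with hl
    have hlv : ∀ k, ENNReal.ofReal (2 * l k) ≤ volume (E k) + ε := fun k => by
      rw [← volume_intervals (h1 k)]; exact h3 k
    have hIoo : ∀ k, volume (Set.Ioo (-l k) (l k)) = ENNReal.ofReal (2 * l k) := fun k => by
      rw [Real.volume_Ioo]; congr 1; ring
    calc volume (K ∩ Set.univ.pi E)
        ≤ volume (K ∩ Set.univ.pi fun k => intervals 1 (J k)) + c * ε := by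
          refine (hsub _ (Set.univ.pi fun k => intervals 1 (J k))).trans ?_
          gcongr
          exact hdiff _ _ (fun k => le_self_add.trans (hMle k)) h2
      _ ≤ volume (K ∩ Set.univ.pi fun k => Set.Ioo (-l k) (l k)) + c * ε := by
          exact add_le_add_left (volume_inter_pi_intervals_le_symmetric hK hconv hsymm J h1) _
      _ ≤ (volume (K ∩ S) + c * ε) + c * ε := by
          gcongr
          refine (hsub _ S).trans ?_
          gcongr
          refine hdiff _ _ (fun k => ?_) fun k => ?_
          · rw [hIoo]
            exact (hlv k).trans (le_trans (by gcongr) (hMle k))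
          · rcases le_total (l k) (v k / 2) with hle | hle
            · rw [Set.sdiff_eq_empty.2 (Set.Ioo_subset_Ioo (by linarith) hle)]
              simp
            · rw [measure_sdiff (Set.Ioo_subset_Ioo (by linarith) hle)
                measurableSet_Ioo.nullMeasurableSet (by simp), hIoo, Real.volume_Ioo,
                show v k / 2 - -(v k / 2) = v k by ring]
              have : ENNReal.ofReal (v k) = volume (E k) := ENNReal.ofReal_toReal (hfin k)
              rw [this]
              exact tsub_le_iff_left.2 (hlv k)
      _ = _ := by rw [add_assoc]
  have hlim : Filter.Tendsto (fun n : ℕ => volume (K ∩ S) +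
      (c * ((n + 1 : ℕ) : ℝ≥0∞)⁻¹ + c * ((n + 1 : ℕ) : ℝ≥0∞)⁻¹)) Filter.atTop
      (nhds (volume (K ∩ S) + (c * 0 + c * 0))) := by
    have h0 := (ENNReal.tendsto_inv_nat_nhds_zero.comp (Filter.tendsto_add_atTop_nat 1))
    have h1 := ENNReal.Tendsto.const_mul h0 (Or.inr hcfin)
    exact tendsto_const_nhds.add (h1.add h1)
  rw [mul_zero, add_zero, add_zero] at hlim
  refine ge_of_tendsto' hlim fun n => key _ (by simp) ?_
  rw [ENNReal.inv_le_one]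
  exact_mod_cast Nat.succ_pos n

end Petty

/-! ### Steiner symmetrization and convergence to balls -/

namespace Petty

/-- Splitting off the first coordinate of `ℝ^{d+1}`. -/
noncomputable def split (d : ℕ) : EuclideanSpace ℝ (Fin (d + 1)) ≃ᵐ ℝ × (Fin d → ℝ) :=
  (MeasurableEquiv.toLp 2 (Fin (d + 1) → ℝ)).symm.trans
    (MeasurableEquiv.piFinSuccAbove (fun _ => ℝ) 0)

variable {d : ℕ}

theorem split_apply (x : EuclideanSpace ℝ (Fin (d + 1))) :
    split d x = (x 0, fun i => x i.succ) := by
  ext i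
  · simp [split, MeasurableEquiv.piFinSuccAbove]
  · simp [split, MeasurableEquiv.piFinSuccAbove, Fin.tail]

theorem split_symm_zero (t : ℝ) (y : Fin d → ℝ) : (split d).symm (t, y) 0 = t := by
  have := split_apply ((split d).symm (t, y))
  rw [MeasurableEquiv.apply_symm_apply] at this
  exact (congrArg Prod.fst this).symm

theorem split_symm_succ (t : ℝ) (y : Fin d → ℝ) (i : Fin d) :
    (split d).symm (t, y) i.succ = y i := by
  have := split_apply ((split d).symm (t, y))
  rw [MeasurableEquiv.apply_symm_apply] at this
  exact (congrFun (congrArg Prod.snd this) i).symm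

theorem measurePreserving_split (d : ℕ) : MeasurePreserving (split d) :=
  (volume_preserving_piFinSuccAbove (fun _ => ℝ) 0).comp
    (EuclideanSpace.volume_preserving_symm_measurableEquiv_toLp _)

theorem split_symm_add (s t : ℝ) (y : Fin d → ℝ) :
    (split d).symm (s + t, y) = (split d).symm (s, y) + t • EuclideanSpace.single 0 1 := by
  ext i
  refine Fin.cases ?_ (fun i => ?_) i
  · simp [split_symm_zero]
  · simp [split_symm_succ]

theorem norm_split_symm_sq (s : ℝ) (y : Fin d → ℝ) :
    ‖(split d).symm (s, y)‖ ^ 2 = s ^ 2 + ∑ i, y i ^ 2 := by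
  rw [EuclideanSpace.norm_sq_eq, Fin.sum_univ_succ]
  simp [split_symm_zero, split_symm_succ]

/-- The section of `A` by the line in the direction of the first axis over `y`. -/
def lineSection (A : Set (EuclideanSpace ℝ (Fin (d + 1)))) (y : Fin d → ℝ) : Set ℝ :=
  {s | (split d).symm (s, y) ∈ A}

theorem measurableSet_lineSection {A : Set (EuclideanSpace ℝ (Fin (d + 1)))}
    (hA : MeasurableSet A) (y : Fin d → ℝ) : MeasurableSet (lineSection A y) :=
  ((split d).symm.measurable.comp measurable_prodMk_right) hA

theorem measurable_volume_lineSection {A : Set (EuclideanSpace ℝ (Fin (d + 1)))}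
    (hA : MeasurableSet A) : Measurable fun y => volume (lineSection A y) :=
  measurable_measure_prodMk_right ((split d).symm.measurable hA)

theorem volume_eq_lintegral_lineSection {A : Set (EuclideanSpace ℝ (Fin (d + 1)))}
    (hA : MeasurableSet A) : volume A = ∫⁻ y, volume (lineSection A y) := by
  rw [← (measurePreserving_split d).symm.measure_preimage_equiv, Measure.volume_eq_prod,
    Measure.prod_apply_symm ((split d).symm.measurable hA)]
  rfl

theorem lineSection_ball {r : ℝ} (hr : 0 ≤ r) (y : Fin d → ℝ) :
    lineSection (Metric.ball (0 : EuclideanSpace ℝ (Fin (d + 1))) r) y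
      = Set.Ioo (-√(r ^ 2 - ∑ i, y i ^ 2)) (√(r ^ 2 - ∑ i, y i ^ 2)) := by
  ext s
  rw [lineSection, Set.mem_ofPred_eq, mem_ball_zero_iff, ← abs_of_nonneg (norm_nonneg _),
    ← abs_of_nonneg hr, ← sq_lt_sq, norm_split_symm_sq, abs_of_nonneg hr, Set.mem_Ioo, ← abs_lt,
    Real.lt_sqrt (abs_nonneg s), sq_abs, lt_sub_iff_add_lt]

/-- The Steiner symmetral of `A` in the direction of the first axis. -/
def steiner (A : Set (EuclideanSpace ℝ (Fin (d + 1)))) : Set (EuclideanSpace ℝ (Fin (d + 1))) :=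
  split d ⁻¹' {p | p.1 ∈ Set.Ioo (-(volume.real (lineSection A p.2) / 2))
    (volume.real (lineSection A p.2) / 2)}

theorem lineSection_steiner (A : Set (EuclideanSpace ℝ (Fin (d + 1)))) (y : Fin d → ℝ) :
    lineSection (steiner A) y = Set.Ioo (-(volume.real (lineSection A y) / 2))
      (volume.real (lineSection A y) / 2) := by
  ext s
  simp [lineSection, steiner]

theorem measurableSet_steiner {A : Set (EuclideanSpace ℝ (Fin (d + 1)))} (hA : MeasurableSet A) :
    MeasurableSet (steiner A) := by
  have h : Measurable fun y => volume.real (lineSection A y) :=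
    (measurable_volume_lineSection hA).ennreal_toReal
  refine (split d).measurable ?_
  have h2 : Measurable fun p : ℝ × (Fin d → ℝ) => volume.real (lineSection A p.2) :=
    h.comp measurable_snd
  exact (measurableSet_lt ((h2.div_const 2).neg) measurable_fst).inter
    (measurableSet_lt measurable_fst (h2.div_const 2))

theorem volume_lineSection_ne_top {A : Set (EuclideanSpace ℝ (Fin (d + 1)))} {R : ℝ} (hR : 0 ≤ R)
    (hA : A ⊆ Metric.ball 0 R) (y : Fin d → ℝ) : volume (lineSection A y) ≠ ∞ := by
  have : lineSection A y ⊆ lineSection (Metric.ball 0 R) y := fun s hs => hA hs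
  refine ((measure_mono this).trans_lt ?_).ne
  rw [lineSection_ball hR]
  simp

theorem volume_lineSection_steiner {A : Set (EuclideanSpace ℝ (Fin (d + 1)))} {y : Fin d → ℝ}
    (h : volume (lineSection A y) ≠ ∞) :
    volume (lineSection (steiner A) y) = volume (lineSection A y) := by
  rw [lineSection_steiner, Real.volume_Ioo, sub_neg_eq_add, add_halves, Measure.real,
    ENNReal.ofReal_toReal h]

theorem volume_steiner {A : Set (EuclideanSpace ℝ (Fin (d + 1)))} (hA : MeasurableSet A)
    {R : ℝ} (hR : 0 ≤ R) (hAR : A ⊆ Metric.ball 0 R) : volume (steiner A) = volume A := by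
  rw [volume_eq_lintegral_lineSection hA, volume_eq_lintegral_lineSection (measurableSet_steiner hA)]
  exact lintegral_congr fun y => volume_lineSection_steiner (volume_lineSection_ne_top hR hAR y)

theorem steiner_subset_ball {A : Set (EuclideanSpace ℝ (Fin (d + 1)))} {R : ℝ} (hR : 0 ≤ R)
    (hAR : A ⊆ Metric.ball 0 R) : steiner A ⊆ Metric.ball 0 R := by
  intro x hx
  rw [← (split d).symm_apply_apply x] at hx ⊢
  generalize split d x = p at hx ⊢
  obtain ⟨s, y⟩ := p
  change s ∈ lineSection (steiner A) y at hx
  change s ∈ lineSection (Metric.ball 0 R) y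
  rw [lineSection_steiner] at hx
  rw [lineSection_ball hR]
  set b := √(R ^ 2 - ∑ i, y i ^ 2)
  have h : volume.real (lineSection A y) ≤ 2 * b := by
    have h1 : lineSection A y ⊆ lineSection (Metric.ball 0 R) y := fun s hs => hAR hs
    have h2 := measureReal_mono h1 (volume_lineSection_ne_top hR subset_rfl y)
    rw [lineSection_ball hR, Real.volume_real_Ioo, max_eq_left (by simp)] at h2
    linarith
  exact Set.Ioo_subset_Ioo (by linarith) (by linarith) hx

/-- Let `P*` be the centred interval of length `|P|` and `Q = (-b, b)`. If `P* ⊆ Q`, the first term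
vanishes. Otherwise `Q ⊆ P*`, so `|P* \ Q| = |P| - |Q| = |P \ Q| - |Q \ P|`, while the second term
is at most `|Q \ P|` by translation invariance. -/
theorem volume_Ioo_sdiff_add_le {P : Set ℝ} (hP : MeasurableSet P) (hfin : volume P ≠ ∞) (b a : ℝ) :
    volume (Set.Ioo (-(volume.real P / 2)) (volume.real P / 2) \ Set.Ioo (-b) b)
      + volume ((P \ Set.Ioo (-b) b) ∩ {s | s + a ∈ Set.Ioo (-b) b \ P})
      ≤ volume (P \ Set.Ioo (-b) b) := by
  set Q := Set.Ioo (-b) b with hQ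
  have hQm : MeasurableSet Q := measurableSet_Ioo
  rcases le_total (volume.real P / 2) b with h | h
  · rw [Set.sdiff_eq_empty.2 (Set.Ioo_subset_Ioo (by linarith) h), measure_empty, zero_add]
    exact measure_mono Set.inter_subset_left
  · have h1 : volume ((P \ Q) ∩ {s | s + a ∈ Q \ P}) ≤ volume (Q \ P) := by
      refine (measure_mono Set.inter_subset_right).trans ?_
      exact (measure_preimage_add_right volume a (Q \ P)).le
    have hIoo : volume (Set.Ioo (-(volume.real P / 2)) (volume.real P / 2)) = volume P := by
      rw [Real.volume_Ioo, sub_neg_eq_add, add_halves, Measure.real, ENNReal.ofReal_toReal hfin]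
    have hQfin : volume Q ≠ ∞ := by simp [hQ]
    have hsub : Q ⊆ Set.Ioo (-(volume.real P / 2)) (volume.real P / 2) :=
      Set.Ioo_subset_Ioo (by linarith) h
    have h2 : volume (Set.Ioo (-(volume.real P / 2)) (volume.real P / 2) \ Q) + volume Q
        = volume P := by
      have := measure_sdiff_add_inter (μ := volume)
        (Set.Ioo (-(volume.real P / 2)) (volume.real P / 2)) hQm
      rwa [Set.inter_eq_right.2 hsub, hIoo] at this
    have h3 : volume P + volume (Q \ P) = volume (P \ Q) + volume Q := by
      rw [← measure_sdiff_add_inter P hQm, ← measure_sdiff_add_inter Q hP, Set.inter_comm Q P]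
      ring
    rw [← ENNReal.add_le_add_iff_right hQfin]
    calc _ = volume P + volume ((P \ Q) ∩ {s | s + a ∈ Q \ P}) := by rw [← h2]; ring
      _ ≤ volume P + volume (Q \ P) := by gcongr
      _ = _ := h3

/-- The one-dimensional estimate integrated over all lines parallel to the first axis.
Symmetrization reduces the part of `A` outside the ball by at least the amount that the shift by `a`
carries into the part of the ball not covered by `A`. -/
theorem volume_steiner_sdiff_ball_add_le {A : Set (EuclideanSpace ℝ (Fin (d + 1)))}
    (hA : MeasurableSet A) {R : ℝ} (hR : 0 ≤ R) (hAR : A ⊆ Metric.ball 0 R) {r : ℝ} (hr : 0 ≤ r)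
    (a : ℝ) :
    volume (steiner A \ Metric.ball 0 r) + volume ((A \ Metric.ball 0 r) ∩
      {x | x + a • EuclideanSpace.single 0 1 ∈ Metric.ball 0 r \ A})
      ≤ volume (A \ Metric.ball 0 r) := by
  have hB : MeasurableSet (Metric.ball (0 : EuclideanSpace ℝ (Fin (d + 1))) r) :=
    measurableSet_ball
  have hm1 := (measurableSet_steiner hA).diff hB
  have hm2 : MeasurableSet ((A \ Metric.ball 0 r) ∩
      {x | x + a • EuclideanSpace.single 0 1 ∈ Metric.ball 0 r \ A}) :=
    (hA.diff hB).inter ((measurable_add_const _) (hB.diff hA))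
  rw [volume_eq_lintegral_lineSection hm1, volume_eq_lintegral_lineSection hm2,
    volume_eq_lintegral_lineSection (hA.diff hB),
    ← lintegral_add_left (measurable_volume_lineSection hm1)]
  refine lintegral_mono fun y => ?_
  have := volume_Ioo_sdiff_add_le (measurableSet_lineSection hA y)
    (volume_lineSection_ne_top hR hAR y) (√(r ^ 2 - ∑ i, y i ^ 2)) a
  rw [← lineSection_steiner, ← lineSection_ball hr] at this
  have e : lineSection ((A \ Metric.ball 0 r) ∩
      {x | x + a • EuclideanSpace.single 0 1 ∈ Metric.ball 0 r \ A}) y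
      = (lineSection A y \ lineSection (Metric.ball 0 r) y) ∩
        {s | s + a ∈ lineSection (Metric.ball 0 r) y \ lineSection A y} := by
    ext s
    simp only [lineSection, Set.mem_inter_iff, Set.mem_sdiff, Set.mem_ofPred_eq, split_symm_add]
  rw [e]
  exact this

/-! ### Sets of families of points -/

variable {κ : Type*} [Fintype κ]

theorem volume_eq_lintegral_lines {S : Set (κ → EuclideanSpace ℝ (Fin (d + 1)))}
    (hS : MeasurableSet S) :
    volume S = ∫⁻ y : κ → Fin d → ℝ,
      volume {t : κ → ℝ | (fun k => (split d).symm (t k, y k)) ∈ S} := by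
  set e := (MeasurableEquiv.piCongrRight (fun _ : κ => split d)).trans
    (MeasurableEquiv.arrowProdEquivProdArrow ℝ (Fin d → ℝ) κ) with he
  have hp : MeasurePreserving e :=
    (volume_measurePreserving_arrowProdEquivProdArrow ℝ (Fin d → ℝ) κ).comp
      (measurePreserving_pi (fun _ => volume) (fun _ => volume)
        fun _ : κ => measurePreserving_split d)
  rw [← hp.symm.measure_preimage_equiv, Measure.volume_eq_prod,
    Measure.prod_apply_symm (e.symm.measurable hS)]
  rfl

/-- A measurable set of families of points that is invariant under linear isometries and whose
sections by families of lines in the direction of the first axis are convex. -/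
structure IsSteinerConvex (G : Set (κ → EuclideanSpace ℝ (Fin (d + 1)))) : Prop where
  measurableSet : MeasurableSet G
  isometry_mem : ∀ g : EuclideanSpace ℝ (Fin (d + 1)) ≃ₗᵢ[ℝ] EuclideanSpace ℝ (Fin (d + 1)),
    ∀ X ∈ G, (fun k => g (X k)) ∈ G
  convex : ∀ Y : κ → EuclideanSpace ℝ (Fin (d + 1)),
    Convex ℝ {t : κ → ℝ | (fun k => Y k + t k • EuclideanSpace.single 0 1) ∈ G}

/-- The reflection changing the sign of the first coordinate. -/
noncomputable def flip (d : ℕ) :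
    EuclideanSpace ℝ (Fin (d + 1)) ≃ₗᵢ[ℝ] EuclideanSpace ℝ (Fin (d + 1)) :=
  LinearIsometryEquiv.piLpCongrRight 2
    fun i => if i = 0 then LinearIsometryEquiv.neg ℝ else LinearIsometryEquiv.refl ℝ ℝ

theorem flip_split_symm (s : ℝ) (y : Fin d → ℝ) :
    flip d ((split d).symm (s, y)) = (split d).symm (-s, y) := by
  ext i
  refine Fin.cases ?_ (fun i => ?_) i
  · simp [flip, split_symm_zero]
  · simp [flip, split_symm_succ]

variable {G : Set (κ → EuclideanSpace ℝ (Fin (d + 1)))}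

/-- Over fixed orthogonal components the section of `G` is convex by assumption and symmetric
because `G` is invariant under `flip d`. The inequality on the line applies there, and Tonelli
integrates it. -/
theorem IsSteinerConvex.volume_inter_pi_le_steiner (hG : IsSteinerConvex G)
    {A : κ → Set (EuclideanSpace ℝ (Fin (d + 1)))} (hA : ∀ k, MeasurableSet (A k))
    {R : ℝ} (hR : 0 ≤ R) (hAR : ∀ k, A k ⊆ Metric.ball 0 R) :
    volume (G ∩ Set.univ.pi A) ≤ volume (G ∩ Set.univ.pi fun k => steiner (A k)) := by
  rw [volume_eq_lintegral_lines (hG.measurableSet.inter (MeasurableSet.univ_pi hA)),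
    volume_eq_lintegral_lines (hG.measurableSet.inter
      (MeasurableSet.univ_pi fun k => measurableSet_steiner (hA k)))]
  refine lintegral_mono fun y => ?_
  set K : Set (κ → ℝ) := {t | (fun k => (split d).symm (t k, y k)) ∈ G} with hK
  have hKm : MeasurableSet K := by
    have : Measurable fun t : κ → ℝ => fun k => (split d).symm (t k, y k) :=
      measurable_pi_lambda _ fun k => (split d).symm.measurable.comp
        ((measurable_pi_apply k).prodMk measurable_const)
    exact this hG.measurableSet
  have hKc : Convex ℝ K := by
    have := hG.convex fun k => (split d).symm (0, y k)
    simp_rw [← split_symm_add, zero_add] at this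
    exact this
  have hKs : ∀ t ∈ K, -t ∈ K := by
    intro t ht
    have := hG.isometry_mem (flip d) _ ht
    simp only [flip_split_symm] at this
    exact this
  have := volume_inter_pi_le_symmetric hKm hKc hKs (fun k => lineSection (A k) (y k))
    (fun k => measurableSet_lineSection (hA k) (y k))
    (fun k => volume_lineSection_ne_top hR (hAR k) (y k))
  simp_rw [← lineSection_steiner] at this
  have e : ∀ B : κ → Set (EuclideanSpace ℝ (Fin (d + 1))),
      {t : κ → ℝ | (fun k => (split d).symm (t k, y k)) ∈ G ∩ Set.univ.pi B}
        = K ∩ Set.univ.pi fun k => lineSection (B k) (y k) := by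
    intro B; ext t; simp [hK, lineSection, Set.mem_pi]
  simp only [e]
  exact this

theorem exists_isometry_eq_smul_single (z : EuclideanSpace ℝ (Fin (d + 1))) :
    ∃ (g : EuclideanSpace ℝ (Fin (d + 1)) ≃ₗᵢ[ℝ] EuclideanSpace ℝ (Fin (d + 1))) (a : ℝ),
      g z = a • EuclideanSpace.single 0 1 := by
  have h : ‖z‖ = ‖‖z‖ • (EuclideanSpace.single 0 1 : EuclideanSpace ℝ (Fin (d + 1)))‖ := by
    simp [norm_smul]
  exact ⟨_, _, Submodule.reflection_sub h⟩

theorem IsSteinerConvex.volume_inter_pi_preimage (hG : IsSteinerConvex G)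
    (A : κ → Set (EuclideanSpace ℝ (Fin (d + 1))))
    (g : EuclideanSpace ℝ (Fin (d + 1)) ≃ₗᵢ[ℝ] EuclideanSpace ℝ (Fin (d + 1))) :
    volume (G ∩ Set.univ.pi A) = volume (G ∩ Set.univ.pi fun k => g ⁻¹' A k) := by
  have hp : MeasurePreserving (MeasurableEquiv.piCongrRight fun _ : κ => g.toMeasurableEquiv) :=
    measurePreserving_pi (fun _ => volume) (fun _ => volume) fun _ : κ => g.measurePreserving
  rw [← hp.measure_preimage_equiv]
  congr 1
  ext X
  have : X ∈ G ↔ (fun k => g (X k)) ∈ G := by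
    refine ⟨hG.isometry_mem g X, fun h => ?_⟩
    simpa using hG.isometry_mem g.symm _ h
  simp only [Set.mem_inter_iff, this, Set.mem_preimage, Set.mem_pi]
  rfl

/-- Tonelli. It makes the average overlap of translates computable, so that some shift `z` attains
at least the average. -/
theorem lintegral_volume_inter_translate {E : Type*} [AddGroup E] [MeasureSpace E]
    [MeasurableAdd₂ E] [SFinite (volume : Measure E)] [(volume : Measure E).IsAddLeftInvariant]
    {P Q : Set E} (hP : MeasurableSet P) (hQ : MeasurableSet Q) :
    ∫⁻ z, volume (P ∩ {x | x + z ∈ Q}) = volume P * volume Q := by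
  have hS : MeasurableSet {p : E × E | p.1 ∈ P ∧ p.1 + p.2 ∈ Q} :=
    (measurable_fst hP).inter (measurable_add hQ)
  have h1 := Measure.prod_apply_symm (μ := (volume : Measure E)) (ν := (volume : Measure E)) hS
  rw [Measure.prod_apply hS] at h1
  refine Eq.trans ?_ (h1.symm.trans ?_)
  · rfl
  · rw [mul_comm, ← lintegral_indicator_const hP]
    refine lintegral_congr fun x => ?_
    by_cases hx : x ∈ P
    · rw [Set.indicator_of_mem hx, ← measure_preimage_add volume x Q]
      congr 1
      ext z; simp [hx]
    · rw [Set.indicator_of_notMem hx]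
      convert measure_empty (μ := (volume : Measure E))
      ext z; simp [hx]

/-- Some rotation followed by Steiner symmetrization moves a given family of bounded sets
quantitatively closer to the balls of the same volumes. -/
theorem IsSteinerConvex.exists_gain (hG : IsSteinerConvex G)
    {A : κ → Set (EuclideanSpace ℝ (Fin (d + 1)))} (hA : ∀ k, MeasurableSet (A k))
    {R : ℝ} (hR : 0 < R) (hAR : ∀ k, A k ⊆ Metric.ball 0 R) {r : κ → ℝ} (hr : ∀ k, 0 ≤ r k)
    (hrR : ∀ k, r k ≤ R) (hvol : ∀ k, volume (A k) = volume (Metric.ball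
      (0 : EuclideanSpace ℝ (Fin (d + 1))) (r k))) :
    ∃ A' : κ → Set (EuclideanSpace ℝ (Fin (d + 1))), (∀ k, MeasurableSet (A' k)) ∧
      (∀ k, A' k ⊆ Metric.ball 0 R) ∧ (∀ k, volume (A' k) = volume (A k)) ∧
      volume (G ∩ Set.univ.pi A) ≤ volume (G ∩ Set.univ.pi A') ∧
      ∑ k, volume (A' k \ Metric.ball 0 (r k)) + (∑ k, volume (A k \ Metric.ball 0 (r k)) ^ 2) /
        volume (Metric.ball (0 : EuclideanSpace ℝ (Fin (d + 1))) (2 * R))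
        ≤ ∑ k, volume (A k \ Metric.ball 0 (r k)) := by
  set B : κ → Set (EuclideanSpace ℝ (Fin (d + 1))) := fun k => Metric.ball 0 (r k) with hB
  have hBm : ∀ k, MeasurableSet (B k) := fun k => measurableSet_ball
  have hBfin : ∀ k, volume (B k) ≠ ∞ := fun k => measure_ball_lt_top.ne
  have hAfin : ∀ k, volume (A k) ≠ ∞ := fun k => by rw [hvol]; exact hBfin k
  set V := volume (Metric.ball (0 : EuclideanSpace ℝ (Fin (d + 1))) (2 * R)) with hV
  have hsymm : ∀ k, volume (B k \ A k) = volume (A k \ B k) := by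
    intro k
    have h1 := measure_sdiff_add_inter (μ := volume) (A k) (hBm k)
    have h2 := measure_sdiff_add_inter (μ := volume) (B k) (hA k)
    rw [hvol k, ← h2, Set.inter_comm] at h1
    exact ((ENNReal.add_left_inj (measure_ne_top_of_subset Set.inter_subset_left (hBfin k))).1
      h1).symm
  set X : κ → EuclideanSpace ℝ (Fin (d + 1)) → ℝ≥0∞ :=
    fun k z => volume ((A k \ B k) ∩ {x | x + z ∈ B k \ A k}) with hX
  have hXint : ∀ k, ∫⁻ z in Metric.ball 0 (2 * R), X k z = volume (A k \ B k) ^ 2 := by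
    intro k
    rw [← lintegral_indicator measurableSet_ball, Set.indicator_eq_self.2, hX,
      lintegral_volume_inter_translate ((hA k).diff (hBm k)) ((hBm k).diff (hA k)), hsymm, sq]
    intro z hz
    rw [Function.mem_support] at hz
    obtain ⟨x, hx, hxz⟩ := nonempty_of_measure_ne_zero hz
    have h1 : ‖x‖ < R := by simpa using hAR k hx.1
    have h2 : ‖x + z‖ < R := by
      have := hxz.1
      simp only [hB, mem_ball_zero_iff] at this
      exact this.trans_le (hrR k)
    rw [mem_ball_zero_iff]
    calc ‖z‖ = ‖(x + z) - x‖ := by simp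
      _ ≤ ‖x + z‖ + ‖x‖ := norm_sub_le _ _
      _ < 2 * R := by linarith
  have hXm : ∀ k, Measurable (X k) := by
    intro k
    have hS : MeasurableSet {p : EuclideanSpace ℝ (Fin (d + 1)) × EuclideanSpace ℝ (Fin (d + 1)) |
        p.1 ∈ A k \ B k ∧ p.1 + p.2 ∈ B k \ A k} :=
      (measurable_fst ((hA k).diff (hBm k))).inter (measurable_add ((hBm k).diff (hA k)))
    exact measurable_measure_prodMk_right hS
  have hsumint : ∫⁻ z in Metric.ball 0 (2 * R), ∑ k, X k z = ∑ k, volume (A k \ B k) ^ 2 := by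
    rw [lintegral_finsetSum _ fun k _ => hXm k]
    exact Finset.sum_congr rfl fun k _ => hXint k
  -- Only shifts of length below `2 * R` contribute, since `x` and `x + z` both lie in the ball of
  -- radius `R`. The average over that ball is the gain in the statement, because `|B k \ A k| = |A
  -- k \ B k|`. A single `z` serves all `k` at once.
  obtain ⟨z, -, hz⟩ := exists_setLAverage_le (μ := volume) (f := fun z => ∑ k, X k z)
    (s := Metric.ball (0 : EuclideanSpace ℝ (Fin (d + 1))) (2 * R))
    (Metric.measure_ball_pos _ _ (by linarith)).ne' measurableSet_ball.nullMeasurableSet (by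
      rw [hsumint]
      exact ENNReal.sum_ne_top.2 fun k _ => ENNReal.pow_ne_top
        (measure_ne_top_of_subset Set.sdiff_subset (hAfin k)))
  rw [setLAverage_eq, hsumint] at hz
  -- An isometry turns the good direction `z` into the first axis, where symmetrization takes place;
  -- it affects neither `G` nor the centred balls.
  obtain ⟨g, a, hga⟩ := exists_isometry_eq_smul_single z
  have hgm : ∀ k, MeasurableSet (g.symm ⁻¹' A k) := fun k => g.symm.continuous.measurable (hA k)
  have hgR : ∀ k, g.symm ⁻¹' A k ⊆ Metric.ball 0 R := by
    intro k x hx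
    have := hAR k hx
    simpa using this
  have hgvol : ∀ S : Set (EuclideanSpace ℝ (Fin (d + 1))), volume (g.symm ⁻¹' S) = volume S :=
    fun S => g.symm.measurePreserving.measure_preimage_equiv (f := g.symm.toMeasurableEquiv) S
  refine ⟨fun k => steiner (g.symm ⁻¹' A k), fun k => measurableSet_steiner (hgm k),
    fun k => steiner_subset_ball hR.le (hgR k), fun k => ?_, ?_, ?_⟩
  · rw [volume_steiner (hgm k) hR.le (hgR k), hgvol]
  · rw [hG.volume_inter_pi_preimage A g.symm]
    exact hG.volume_inter_pi_le_steiner hgm hR.le hgR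
  · refine (add_le_add_right hz _).trans ?_
    rw [← Finset.sum_add_distrib]
    refine Finset.sum_le_sum fun k _ => ?_
    have := volume_steiner_sdiff_ball_add_le (hgm k) hR.le (hgR k) (hr k) a
    have hBg : ∀ x, g.symm x ∈ B k ↔ x ∈ B k := by
      intro x; simp [hB]
    have e1 : g.symm ⁻¹' A k \ Metric.ball 0 (r k) = g.symm ⁻¹' (A k \ B k) := by
      ext x
      simp only [Set.mem_sdiff, Set.mem_preimage, hBg]
      rfl
    have e2 : (g.symm ⁻¹' A k \ Metric.ball 0 (r k)) ∩
        {x | x + a • EuclideanSpace.single 0 1 ∈ Metric.ball 0 (r k) \ g.symm ⁻¹' A k}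
        = g.symm ⁻¹' ((A k \ B k) ∩ {x | x + z ∈ B k \ A k}) := by
      rw [e1]
      ext x
      have : g.symm (x + a • EuclideanSpace.single 0 1) = g.symm x + z := by
        rw [← hga, map_add, LinearIsometryEquiv.symm_apply_apply]
      simp only [Set.mem_inter_iff, Set.mem_preimage, Set.mem_sdiff, Set.mem_ofPred_eq, ← this, hBg]
      rfl
    rw [e2, e1, hgvol, hgvol] at this
    exact this

/-- In place of a convergent sequence of symmetrizations, consider the infimum `s` of the total
excess `D` over all families reachable without decreasing the volume. If `s > 0`, a family with `D <
s + c s²` has a successor with excess at most `D - c D² < s`, a contradiction. -/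
theorem IsSteinerConvex.exists_sum_volume_sdiff_lt (hG : IsSteinerConvex G)
    {A : κ → Set (EuclideanSpace ℝ (Fin (d + 1)))} (hA : ∀ k, MeasurableSet (A k))
    {R : ℝ} (hR : 0 < R) (hAR : ∀ k, A k ⊆ Metric.ball 0 R) {r : κ → ℝ} (hr : ∀ k, 0 ≤ r k)
    (hrR : ∀ k, r k ≤ R) (hvol : ∀ k, volume (A k) = volume (Metric.ball
      (0 : EuclideanSpace ℝ (Fin (d + 1))) (r k))) {ε : ℝ} (hε : 0 < ε) :
    ∃ A' : κ → Set (EuclideanSpace ℝ (Fin (d + 1))),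
      (∀ k, volume (A' k) = volume (A k)) ∧
      volume (G ∩ Set.univ.pi A) ≤ volume (G ∩ Set.univ.pi A') ∧
      ∑ k, volume.real (A' k \ Metric.ball 0 (r k)) < ε := by
  set D : (κ → Set (EuclideanSpace ℝ (Fin (d + 1)))) → ℝ :=
    fun A => ∑ k, volume.real (A k \ Metric.ball 0 (r k)) with hD
  set V := volume.real (Metric.ball (0 : EuclideanSpace ℝ (Fin (d + 1))) (2 * R)) with hV
  set 𝒜 : Set (κ → Set (EuclideanSpace ℝ (Fin (d + 1)))) := {A' |
    (∀ k, MeasurableSet (A' k)) ∧ (∀ k, A' k ⊆ Metric.ball 0 R) ∧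
    (∀ k, volume (A' k) = volume (A k)) ∧
    volume (G ∩ Set.univ.pi A) ≤ volume (G ∩ Set.univ.pi A')} with h𝒜
  have hVpos : 0 < V := ENNReal.toReal_pos (Metric.measure_ball_pos _ _ (by linarith)).ne'
    measure_ball_lt_top.ne
  -- Cauchy-Schwarz bounds the sum of squares in `exists_gain` below by `D²` over the number of
  -- sets; the `+ 1` keeps the denominator positive when `κ` is empty.
  set c : ℝ := ((Fintype.card κ + 1) * V)⁻¹ with hc
  have hcpos : 0 < c := by positivity
  have hA0 : A ∈ 𝒜 := ⟨hA, hAR, fun _ => rfl, le_rfl⟩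
  have hstep : ∀ A' ∈ 𝒜, ∃ A'' ∈ 𝒜, D A'' + c * D A' ^ 2 ≤ D A' := by
    rintro A' ⟨h1, h2, h3, h4⟩
    obtain ⟨A'', g1, g2, g3, g4, g5⟩ := hG.exists_gain h1 hR h2 hr hrR
      (fun k => (h3 k).trans (hvol k))
    refine ⟨A'', ⟨g1, g2, fun k => (g3 k).trans (h3 k), h4.trans g4⟩, ?_⟩
    have hfin : ∀ A : κ → Set (EuclideanSpace ℝ (Fin (d + 1))), (∀ k, A k ⊆ Metric.ball 0 R) →
        ∀ k, volume (A k \ Metric.ball 0 (r k)) ≠ ∞ := fun A hA k =>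
      measure_ne_top_of_subset (Set.sdiff_subset.trans (hA k)) measure_ball_lt_top.ne
    have hV0 : volume (Metric.ball (0 : EuclideanSpace ℝ (Fin (d + 1))) (2 * R)) ≠ 0 :=
      (Metric.measure_ball_pos _ _ (by linarith)).ne'
    have h5 := ENNReal.toReal_mono (ENNReal.sum_ne_top.2 fun k _ => hfin A' h2 k) g5
    rw [ENNReal.toReal_add (ENNReal.sum_ne_top.2 fun k _ => hfin A'' g2 k)
      (ENNReal.div_ne_top (ENNReal.sum_ne_top.2 fun k _ => ENNReal.pow_ne_top (hfin A' h2 k)) hV0),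
      ENNReal.toReal_div, ENNReal.toReal_sum (fun k _ => hfin A'' g2 k),
      ENNReal.toReal_sum (fun k _ => hfin A' h2 k),
      ENNReal.toReal_sum (fun k _ => ENNReal.pow_ne_top (hfin A' h2 k))] at h5
    simp_rw [ENNReal.toReal_pow] at h5
    refine le_trans ?_ h5
    refine add_le_add_right ?_ (D A'')
    have h6 := sq_sum_le_card_mul_sum_sq (s := Finset.univ)
      (f := fun k => volume.real (A' k \ Metric.ball 0 (r k)))
    rw [Finset.card_univ] at h6
    change c * D A' ^ 2 ≤ (∑ k, volume.real (A' k \ Metric.ball 0 (r k)) ^ 2) / V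
    have h7 : 0 ≤ ∑ k, volume.real (A' k \ Metric.ball 0 (r k)) ^ 2 := by positivity
    rw [hc, le_div_iff₀ hVpos, inv_mul_eq_div, div_mul_eq_mul_div, div_le_iff₀ (by positivity)]
    have h8 : D A' ^ 2 ≤ (Fintype.card κ + 1) *
        ∑ k, volume.real (A' k \ Metric.ball 0 (r k)) ^ 2 := by
      rw [add_mul, one_mul]; exact h6.trans (le_add_of_nonneg_right h7)
    nlinarith
  by_contra! hcon
  have hlow : ∀ A' ∈ 𝒜, ε ≤ D A' := fun A' h => hcon A' h.2.2.1 h.2.2.2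
  have hbdd : BddBelow (D '' 𝒜) := ⟨ε, by rintro _ ⟨A', h, rfl⟩; exact hlow A' h⟩
  have hne : (D '' 𝒜).Nonempty := ⟨_, A, hA0, rfl⟩
  set s := sInf (D '' 𝒜) with hs
  have hsε : ε ≤ s := le_csInf hne (by rintro _ ⟨A', h, rfl⟩; exact hlow A' h)
  obtain ⟨_, ⟨A', hA', rfl⟩, hlt⟩ := exists_lt_of_csInf_lt hne
    (show s < s + c * s ^ 2 by have : 0 < s := hε.trans_le hsε; nlinarith [pow_pos this 2])
  obtain ⟨A'', hA'', hle⟩ := hstep A' hA'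
  have h1 : s ≤ D A'' := csInf_le hbdd ⟨A'', hA'', rfl⟩
  have h2 : s ≤ D A' := csInf_le hbdd ⟨A', hA', rfl⟩
  have h3 : s ^ 2 ≤ D A' ^ 2 := pow_le_pow_left₀ (hε.le.trans hsε) h2 2
  nlinarith

/-- Simultaneous symmetric rearrangement of bounded sets. -/
theorem IsSteinerConvex.volume_inter_pi_le_setRearrangement (hG : IsSteinerConvex G)
    {A : κ → Set (EuclideanSpace ℝ (Fin (d + 1)))} (hA : ∀ k, MeasurableSet (A k))
    (hAb : ∀ k, Bornology.IsBounded (A k)) :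
    volume (G ∩ Set.univ.pi A) ≤ volume (G ∩ Set.univ.pi fun k => setRearrangement (A k)) := by
  classical
  have hex : ∀ k, ∃ r : ℝ, 0 ≤ r ∧ setRearrangement (A k) = Metric.ball 0 r := fun k =>
    ⟨_, by positivity, rfl⟩
  choose r hr hball using hex
  choose R' hR' using fun k => (hAb k).subset_ball 0
  set R : ℝ := ∑ k, |R' k| + ∑ k, r k + 1 with hRdef
  have hsum1 : 0 ≤ ∑ k, |R' k| := Finset.sum_nonneg fun k _ => abs_nonneg _
  have hsum2 : 0 ≤ ∑ k, r k := Finset.sum_nonneg fun k _ => hr k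
  have hR : 0 < R := by linarith
  have hAR : ∀ k, A k ⊆ Metric.ball 0 R := fun k => (hR' k).trans (Metric.ball_subset_ball (by
    have := Finset.single_le_sum (f := fun k => |R' k|) (fun k _ => abs_nonneg _)
      (Finset.mem_univ k)
    have := le_abs_self (R' k)
    linarith))
  have hrR : ∀ k, r k ≤ R := fun k => by
    have := Finset.single_le_sum (f := r) (fun k _ => hr k) (Finset.mem_univ k)
    linarith
  have hfin : ∀ k, volume (A k) ≠ ∞ := fun k =>
    measure_ne_top_of_subset (hAR k) measure_ball_lt_top.ne
  have hvol : ∀ k, volume (A k) = volume (Metric.ball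
      (0 : EuclideanSpace ℝ (Fin (d + 1))) (r k)) := fun k => by
    rw [← hball, volume_setRearrangement (Nat.succ_ne_zero d) _ (hfin k)]
  simp_rw [hball]
  set M : ℝ≥0∞ := ∑ k, ∏ j ∈ Finset.univ.erase k, volume (A j) with hM
  have hMfin : M ≠ ∞ := ENNReal.sum_ne_top.2 fun k _ => ENNReal.prod_ne_top fun j _ => hfin j
  have key : ∀ ε : ℝ, 0 < ε → volume (G ∩ Set.univ.pi A)
      ≤ volume (G ∩ Set.univ.pi fun k => Metric.ball 0 (r k)) + M * ENNReal.ofReal ε := by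
    intro ε hε
    obtain ⟨A', h1, h2, h3⟩ := hG.exists_sum_volume_sdiff_lt hA hR hAR hr hrR hvol hε
    refine h2.trans ?_
    calc volume (G ∩ Set.univ.pi A') ≤ volume (G ∩ Set.univ.pi fun k => Metric.ball 0 (r k))
          + volume (Set.univ.pi A' \ Set.univ.pi fun k => Metric.ball 0 (r k)) := by
          refine (measure_mono ?_).trans (measure_union_le _ _)
          rintro x ⟨hx, hxA⟩
          by_cases hxB : x ∈ Set.univ.pi fun k => Metric.ball 0 (r k)
          exacts [Or.inl ⟨hx, hxB⟩, Or.inr ⟨hxA, hxB⟩]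
      _ ≤ _ := by
          refine add_le_add_right ((measure_pi_sdiff_le (fun _ => volume) _ _).trans ?_) _
          rw [hM, Finset.sum_mul]
          refine Finset.sum_le_sum fun k _ => ?_
          rw [mul_comm]
          refine mul_le_mul' (Finset.prod_le_prod' fun j _ => (h1 j).le) ?_
          rw [← ENNReal.ofReal_toReal (a := volume (A' k \ Metric.ball 0 (r k)))
            (measure_ne_top_of_subset Set.sdiff_subset (by rw [h1]; exact hfin k))]
          refine ENNReal.ofReal_le_ofReal (le_trans ?_ h3.le)
          exact Finset.single_le_sum (f := fun k => volume.real (A' k \ Metric.ball 0 (r k)))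
            (fun _ _ => measureReal_nonneg) (Finset.mem_univ k)
  have hlim : Filter.Tendsto (fun ε : ℝ =>
      volume (G ∩ Set.univ.pi fun k => Metric.ball 0 (r k)) + M * ENNReal.ofReal ε)
      (nhdsWithin 0 (Set.Ioi 0))
      (nhds (volume (G ∩ Set.univ.pi fun k => Metric.ball 0 (r k)) + M * ENNReal.ofReal 0)) :=
    (tendsto_const_nhds.add (ENNReal.Tendsto.const_mul
      (ENNReal.continuous_ofReal.tendsto 0) (Or.inr hMfin))).mono_left nhdsWithin_le_nhds
  rw [ENNReal.ofReal_zero, mul_zero, add_zero] at hlim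
  exact ge_of_tendsto hlim (by filter_upwards [self_mem_nhdsWithin] with ε hε using key ε hε)

end Petty

/-! ### From sets to densities and radial weights -/

namespace Petty

variable {d : ℕ} {κ : Type*} [Fintype κ] {G : Set (κ → EuclideanSpace ℝ (Fin (d + 1)))}

/-- Exhaust each `E k` by its bounded parts. Asking only for rearrangements of bounded subsets
admits level sets of infinite volume, as those of `ρ` may be; on such a set `setRearrangement`
degenerates to the empty ball. -/
theorem IsSteinerConvex.volume_inter_pi_le (hG : IsSteinerConvex G)
    {E E' : κ → Set (EuclideanSpace ℝ (Fin (d + 1)))} (hE : ∀ k, MeasurableSet (E k))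
    (h : ∀ k, ∀ A ⊆ E k, MeasurableSet A → Bornology.IsBounded A → setRearrangement A ⊆ E' k) :
    volume (G ∩ Set.univ.pi E) ≤ volume (G ∩ Set.univ.pi E') := by
  set T : ℕ → Set (κ → EuclideanSpace ℝ (Fin (d + 1))) :=
    fun n => G ∩ Set.univ.pi fun k => E k ∩ Metric.ball 0 n with hT
  have hTmono : Monotone T := by
    intro n m hnm
    refine Set.inter_subset_inter_right _ (Set.pi_mono fun k _ => ?_)
    exact Set.inter_subset_inter_right _ (Metric.ball_subset_ball (by exact_mod_cast hnm))
  have hU : G ∩ Set.univ.pi E = ⋃ n, T n := by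
    refine Set.Subset.antisymm ?_ (Set.iUnion_subset fun n =>
      Set.inter_subset_inter_right _ (Set.pi_mono fun k _ => Set.inter_subset_left))
    rintro X ⟨hX, hXE⟩
    obtain ⟨n, hn⟩ := exists_nat_gt (∑ k, ‖X k‖)
    refine Set.mem_iUnion.2 ⟨n, hX, fun k _ => ⟨hXE k trivial, ?_⟩⟩
    rw [mem_ball_zero_iff]
    exact (Finset.single_le_sum (f := fun k => ‖X k‖) (fun _ _ => norm_nonneg _)
      (Finset.mem_univ k)).trans_lt hn
  rw [hU, hTmono.measure_iUnion]
  refine iSup_le fun n => ?_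
  refine (hG.volume_inter_pi_le_setRearrangement (fun k => (hE k).inter measurableSet_ball)
    fun k => Metric.isBounded_ball.subset Set.inter_subset_right).trans (measure_mono ?_)
  exact Set.inter_subset_inter_right _ (Set.pi_mono fun k _ =>
    h k _ Set.inter_subset_left ((hE k).inter measurableSet_ball)
      (Metric.isBounded_ball.subset Set.inter_subset_right))

/-- A product of lengths of level sets is the measure of a product set of levels, so Tonelli
exchanges points and levels. -/
theorem lintegral_prod_measure_levels {E : κ → ℝ → Set (EuclideanSpace ℝ (Fin (d + 1)))}
    (hE : ∀ k, MeasurableSet {p : ℝ × EuclideanSpace ℝ (Fin (d + 1)) | p.2 ∈ E k p.1}) :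
    ∫⁻ X in G, ∏ k, volume.restrict (Set.Ioi 0) {t | X k ∈ E k t}
      = ∫⁻ T in Set.univ.pi fun _ : κ => Set.Ioi (0 : ℝ),
          volume (G ∩ Set.univ.pi fun k => E k (T k)) := by
  set μ : Measure (κ → ℝ) := Measure.pi fun _ => (volume : Measure ℝ).restrict (Set.Ioi 0) with hμ
  set S : Set ((κ → EuclideanSpace ℝ (Fin (d + 1))) × (κ → ℝ)) :=
    {p | ∀ k, p.1 k ∈ E k (p.2 k)} with hS
  have hSm : MeasurableSet S := by
    rw [hS, show {p : (κ → EuclideanSpace ℝ (Fin (d + 1))) × (κ → ℝ) | ∀ k, p.1 k ∈ E k (p.2 k)}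
      = ⋂ k, {p | p.1 k ∈ E k (p.2 k)} by ext; simp]
    refine MeasurableSet.iInter fun k => ?_
    have : Measurable fun p : (κ → EuclideanSpace ℝ (Fin (d + 1))) × (κ → ℝ) => (p.2 k, p.1 k) := by
      fun_prop
    exact this (hE k)
  have h1 : ∀ X : κ → EuclideanSpace ℝ (Fin (d + 1)),
      ∏ k, volume.restrict (Set.Ioi 0) {t | X k ∈ E k t} = μ (Prod.mk X ⁻¹' S) := by
    intro X
    rw [hμ, ← Measure.pi_pi]
    congr 1
    ext T; simp [hS]
  simp_rw [h1]
  rw [← Measure.prod_apply hSm, Measure.prod_apply_symm hSm, hμ, ← Measure.restrict_pi_pi]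
  refine lintegral_congr fun T => ?_
  have hm : MeasurableSet ((fun X => (X, T)) ⁻¹' S) := measurable_prodMk_right hSm
  rw [Measure.restrict_apply hm, Set.inter_comm]
  congr 2
  ext X; simp [hS]

/-- The rearrangement inequality for functions given by layers. -/
theorem IsSteinerConvex.lintegral_prod_le (hG : IsSteinerConvex G)
    {E E' : κ → ℝ → Set (EuclideanSpace ℝ (Fin (d + 1)))}
    (hE : ∀ k, MeasurableSet {p : ℝ × EuclideanSpace ℝ (Fin (d + 1)) | p.2 ∈ E k p.1})
    (hE' : ∀ k, MeasurableSet {p : ℝ × EuclideanSpace ℝ (Fin (d + 1)) | p.2 ∈ E' k p.1})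
    (h : ∀ k t, 0 < t → ∀ A ⊆ E k t, MeasurableSet A → Bornology.IsBounded A →
      setRearrangement A ⊆ E' k t) :
    ∫⁻ X in G, ∏ k, volume.restrict (Set.Ioi 0) {t | X k ∈ E k t}
      ≤ ∫⁻ X in G, ∏ k, volume.restrict (Set.Ioi 0) {t | X k ∈ E' k t} := by
  rw [lintegral_prod_measure_levels hE,
    lintegral_prod_measure_levels hE']
  refine setLIntegral_mono' (MeasurableSet.univ_pi fun _ => measurableSet_Ioi) fun T hT => ?_
  exact hG.volume_inter_pi_le (fun k => measurable_prodMk_left (hE k))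
    fun k => h k (T k) (hT k trivial)

/-! ### Layers of densities -/

theorem eq_measure_superlevel {α : Type*} (f : α → ℝ≥0∞) (x : α) :
    f x = volume.restrict (Set.Ioi 0) {t : ℝ | x ∈ {y | ENNReal.ofReal t < f y}} := by
  have hm : MeasurableSet {t : ℝ | ENNReal.ofReal t < f x} :=
    measurableSet_lt (by fun_prop) measurable_const
  simp only [Set.mem_ofPred_eq]
  rw [Measure.restrict_apply hm, volume_Ioi_inter_ofReal_lt]

theorem measurableSet_superlevel {f : EuclideanSpace ℝ (Fin (d + 1)) → ℝ≥0∞} (hf : Measurable f) :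
    MeasurableSet {p : ℝ × EuclideanSpace ℝ (Fin (d + 1)) |
      p.2 ∈ {y | ENNReal.ofReal p.1 < f y}} :=
  measurableSet_lt (by fun_prop) (hf.comp measurable_snd)

theorem measurableSet_setRearrangement_superlevel (f : EuclideanSpace ℝ (Fin (d + 1)) → ℝ≥0∞) :
    MeasurableSet {p : ℝ × EuclideanSpace ℝ (Fin (d + 1)) |
      p.2 ∈ setRearrangement {y | ENNReal.ofReal p.1 < f y}} := by
  have hmeas : Measurable fun t : ℝ => volume {x | ENNReal.ofReal t < f x} := by
    refine Antitone.measurable fun t t' htt' => measure_mono fun x hx => ?_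
    exact lt_of_le_of_lt (ENNReal.ofReal_le_ofReal htt') hx
  have h2 : Measurable fun p : ℝ × EuclideanSpace ℝ (Fin (d + 1)) =>
      volume.real {x | ENNReal.ofReal p.1 < f x} := hmeas.ennreal_toReal.comp measurable_fst
  simp only [setRearrangement, mem_ball_zero_iff]
  exact measurableSet_lt (by fun_prop) (by fun_prop)

theorem symmDecrRearrangement_eq_measure (f : EuclideanSpace ℝ (Fin (d + 1)) → ℝ≥0∞)
    (x : EuclideanSpace ℝ (Fin (d + 1))) :
    symmDecrRearrangement f x = volume.restrict (Set.Ioi 0)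
      {t : ℝ | x ∈ setRearrangement {y | ENNReal.ofReal t < f y}} := by
  have hm : MeasurableSet {t : ℝ | x ∈ setRearrangement {y | ENNReal.ofReal t < f y}} :=
    measurable_prodMk_right (y := x) (measurableSet_setRearrangement_superlevel f)
  rw [← lintegral_indicator_one hm, symmDecrRearrangement]
  refine lintegral_congr fun t => ?_
  by_cases hx : x ∈ setRearrangement {y | ENNReal.ofReal t < f y} <;> simp [hx]

theorem measurable_symmDecrRearrangement (f : EuclideanSpace ℝ (Fin (d + 1)) → ℝ≥0∞) :
    Measurable (symmDecrRearrangement f) := by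
  have h : symmDecrRearrangement f = fun x => volume.restrict (Set.Ioi 0)
      {t : ℝ | x ∈ setRearrangement {y | ENNReal.ofReal t < f y}} :=
    funext (symmDecrRearrangement_eq_measure f)
  rw [h]
  exact measurable_measure_prodMk_right (measurableSet_setRearrangement_superlevel f)

theorem setRearrangement_mono {n : ℕ} {A B : Set (EuclideanSpace ℝ (Fin n))} (h : A ⊆ B)
    (hB : volume B ≠ ∞) : setRearrangement A ⊆ setRearrangement B := by
  refine Metric.ball_subset_ball (Real.rpow_le_rpow (by positivity) ?_ (by positivity))
  gcongr

theorem volume_superlevel_ne_top {α : Type*} [MeasurableSpace α] {μ : Measure α} {f : α → ℝ≥0∞}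
    (hf : Measurable f) (hfin : ∫⁻ x, f x ∂μ ≠ ∞) {t : ℝ} (ht : 0 < t) :
    μ {x | ENNReal.ofReal t < f x} ≠ ∞ := by
  have ht' : ENNReal.ofReal t ≠ 0 := by simpa using ht
  refine (lt_of_le_of_lt (measure_mono fun x (hx : ENNReal.ofReal t < f x) => hx.le)
    ((meas_ge_le_lintegral_div hf.aemeasurable ht' ENNReal.ofReal_ne_top).trans_lt ?_)).ne
  exact ENNReal.div_lt_top hfin ht'

/-- If a point `x` of the ball `A*` were outside `E`, then every point of `A ⊆ E` would be shorter
than `x`. So `A` would fit in a ball strictly smaller than `A*`, against equality of volumes. -/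
theorem setRearrangement_subset_of_radial {n : ℕ} (hn : n ≠ 0) {E : Set (EuclideanSpace ℝ (Fin n))}
    (hE : ∀ x ∈ E, ∀ y, ‖y‖ ≤ ‖x‖ → y ∈ E) {A : Set (EuclideanSpace ℝ (Fin n))} (hAE : A ⊆ E)
    (hA : Bornology.IsBounded A) : setRearrangement A ⊆ E := by
  have : Nonempty (Fin n) := ⟨⟨0, Nat.pos_of_ne_zero hn⟩⟩
  have hv := volume_setRearrangement hn A hA.measure_lt_top.ne
  have : ∃ r, setRearrangement A = Metric.ball 0 r := ⟨_, rfl⟩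
  obtain ⟨r, hr⟩ := this
  rw [hr] at hv ⊢
  intro x hx
  rw [mem_ball_zero_iff] at hx
  by_contra hxE
  have h1 : A ⊆ Metric.ball 0 ‖x‖ := by
    intro y hy
    rw [mem_ball_zero_iff]
    by_contra hle
    exact hxE (hE y (hAE hy) x (not_lt.1 hle))
  have h2 := measure_mono (μ := volume) h1
  rw [← hv, Measure.addHaar_ball _ _ (norm_nonneg x),
    Measure.addHaar_ball _ _ ((norm_nonneg x).trans hx.le)] at h2
  have hb : volume (Metric.ball (0 : EuclideanSpace ℝ (Fin n)) 1) ≠ ∞ := measure_ball_lt_top.ne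
  rw [ENNReal.mul_le_mul_iff_left (Metric.measure_ball_pos _ _ one_pos).ne' hb,
    ENNReal.ofReal_le_ofReal_iff (by positivity), finrank_euclideanSpace_fin] at h2
  exact absurd h2 (not_le.2 (pow_lt_pow_left₀ hx (norm_nonneg x) hn))

/-- The rearrangement inequality for densities and a radially decreasing weight. -/
theorem IsSteinerConvex.lintegral_prod_mul_le {ι : Type*} [Fintype ι]
    {G : Set (Option ι → EuclideanSpace ℝ (Fin (d + 1)))} (hG : IsSteinerConvex G)
    {f : ι → EuclideanSpace ℝ (Fin (d + 1)) → ℝ≥0∞} (hf : ∀ i, Measurable (f i))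
    (hfin : ∀ i, ∫⁻ x, f i x ≠ ∞) {ρ : ℝ≥0 → ℝ≥0∞} (hρ : Antitone ρ) :
    ∫⁻ X in G, ρ ‖X none‖₊ * ∏ i, f i (X (some i))
      ≤ ∫⁻ X in G, ρ ‖X none‖₊ * ∏ i, symmDecrRearrangement (f i) (X (some i)) := by
  have hρm : Measurable fun x : EuclideanSpace ℝ (Fin (d + 1)) => ρ ‖x‖₊ :=
    hρ.measurable.comp measurable_nnnorm
  set Eρ : ℝ → Set (EuclideanSpace ℝ (Fin (d + 1))) := fun t => {y | ENNReal.ofReal t < ρ ‖y‖₊}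
  set E : Option ι → ℝ → Set (EuclideanSpace ℝ (Fin (d + 1))) :=
    fun k => k.elim Eρ fun i t => {y | ENNReal.ofReal t < f i y} with hE
  -- The weight keeps its own level sets on both sides: they are radial, hence contain the
  -- rearrangements of their bounded subsets.
  set E' : Option ι → ℝ → Set (EuclideanSpace ℝ (Fin (d + 1))) :=
    fun k => k.elim Eρ fun i t => setRearrangement {y | ENNReal.ofReal t < f i y} with hE'
  have key := hG.lintegral_prod_le (E := E) (E' := E') ?_ ?_ ?_
  · simp_rw [Fintype.prod_option] at key
    simp only [hE, hE', Option.elim_none, Option.elim_some, ← symmDecrRearrangement_eq_measure,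
      ← eq_measure_superlevel (f _)] at key
    simp only [Eρ, ← eq_measure_superlevel (fun y : EuclideanSpace ℝ (Fin (d + 1)) => ρ ‖y‖₊)]
      at key
    exact key
  · rintro (_ | i)
    exacts [measurableSet_superlevel hρm, measurableSet_superlevel (hf i)]
  · rintro (_ | i)
    exacts [measurableSet_superlevel hρm, measurableSet_setRearrangement_superlevel (f i)]
  · rintro (_ | i) t ht A hA hAm hAb
    · refine setRearrangement_subset_of_radial (Nat.succ_ne_zero d) (fun x hx y hyx => ?_) hA hAb
      exact lt_of_lt_of_le hx (hρ hyx)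
    · exact setRearrangement_mono hA (volume_superlevel_ne_top (hf i) (hfin i) ht)

end Petty

/-! ### Convex potentials and the Monge-Ampère mass -/

namespace Petty

variable {ι : Type*} [Fintype ι]

/-- The linear form `h ↦ ∑ gᵢ hᵢ`. -/
noncomputable def dotCLM (g : ι → ℝ) : (ι → ℝ) →L[ℝ] ℝ :=
  ∑ i, g i • ContinuousLinearMap.proj i

@[simp]
theorem dotCLM_apply (g h : ι → ℝ) : dotCLM g h = g ⬝ᵥ h := by
  simp [dotCLM, dotProduct]

variable [DecidableEq ι]

/-- A matrix as a continuous linear map. -/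
noncomputable def matCLM (A : Matrix ι ι ℝ) : (ι → ℝ) →L[ℝ] (ι → ℝ) :=
  (Matrix.toLin' A).toContinuousLinearMap

@[simp]
theorem matCLM_apply (A : Matrix ι ι ℝ) (h : ι → ℝ) : matCLM A h = A.mulVec h := rfl

@[simp]
theorem det_matCLM (A : Matrix ι ι ℝ) : (matCLM A).det = A.det := by
  rw [matCLM, ContinuousLinearMap.det]
  simp

/-- `φ` is a convex function with gradient `G` and Hessian `A` at bounded distance from the
support function of `K`. -/
structure IsPotential (K : Set (ι → ℝ)) (φ : (ι → ℝ) → ℝ) (G : (ι → ℝ) → ι → ℝ)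
    (A : (ι → ℝ) → Matrix ι ι ℝ) : Prop where
  hasFDerivAt : ∀ x, HasFDerivAt φ (dotCLM (G x)) x
  hasFDerivAt_grad : ∀ x, HasFDerivAt G (matCLM (A x)) x
  continuous_hess : Continuous A
  posSemidef : ∀ x, (A x).PosSemidef
  lower : ∃ C, ∀ x, ∀ y ∈ K, x ⬝ᵥ y ≤ φ x + C
  upper : ∃ C, ∀ x, ∃ y ∈ K, φ x ≤ x ⬝ᵥ y + C

namespace IsPotential

variable {K : Set (ι → ℝ)} {φ : (ι → ℝ) → ℝ} {G : (ι → ℝ) → ι → ℝ}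
  {A : (ι → ℝ) → Matrix ι ι ℝ}

theorem hasDerivAt_line (hP : IsPotential K φ G A) (x h : ι → ℝ) (t : ℝ) :
    HasDerivAt (fun s : ℝ => φ (x + s • h)) (G (x + t • h) ⬝ᵥ h) t := by
  have h1 : HasDerivAt (fun s : ℝ => x + s • h) h t := by
    simpa using ((hasDerivAt_id t).smul_const h).const_add x
  exact ((hP.hasFDerivAt (x + t • h)).comp_hasDerivAt t h1).congr_deriv (by simp)

theorem hasDerivAt_grad_line (hP : IsPotential K φ G A) (x h : ι → ℝ) (t : ℝ) :
    HasDerivAt (fun s : ℝ => G (x + s • h) ⬝ᵥ h) ((A (x + t • h)).mulVec h ⬝ᵥ h) t := by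
  have h1 : HasDerivAt (fun s : ℝ => x + s • h) h t := by
    simpa using ((hasDerivAt_id t).smul_const h).const_add x
  have h2 := (hP.hasFDerivAt_grad (x + t • h)).comp_hasDerivAt t h1
  have h3 := (dotCLM h).hasFDerivAt.comp_hasDerivAt t h2
  simpa [dotProduct_comm h, Function.comp_def] using h3

theorem monotone_grad_line (hP : IsPotential K φ G A) (x h : ι → ℝ) :
    Monotone fun s : ℝ => G (x + s • h) ⬝ᵥ h := by
  refine monotone_of_deriv_nonneg (fun t => (hP.hasDerivAt_grad_line x h t).differentiableAt)
    fun t => ?_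
  rw [(hP.hasDerivAt_grad_line x h t).deriv, dotProduct_comm]
  simpa using (hP.posSemidef (x + t • h)).dotProduct_mulVec_nonneg h

theorem add_mul_le (hP : IsPotential K φ G A) (x h : ι → ℝ) {t : ℝ} (ht : 0 < t) :
    φ x + t * (G x ⬝ᵥ h) ≤ φ (x + t • h) := by
  obtain ⟨c, hc, hslope⟩ := exists_hasDerivAt_eq_slope (fun s : ℝ => φ (x + s • h)) _ ht
    (fun s _ => (hP.hasDerivAt_line x h s).continuousAt.continuousWithinAt)
    (fun s _ => hP.hasDerivAt_line x h s)
  have hm := hP.monotone_grad_line x h hc.1.le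
  simp only [zero_smul, add_zero, sub_zero] at hm hslope
  rw [hslope, le_div_iff₀ ht] at hm
  linarith

/-- If `G x` were outside `K`, separate it in a direction `h`. By convexity `φ` grows along `h` at
least at rate `⟨G x, h⟩`, while the upper bound by the support function allows only the strictly
smaller rate `u`. -/
theorem grad_mem (hP : IsPotential K φ G A) (hK : IsCompact K) (hc : Convex ℝ K) (x : ι → ℝ) :
    G x ∈ K := by
  by_contra hx
  obtain ⟨f, u, hu, hfx⟩ := geometric_hahn_banach_closed_point hc hK.isClosed hx
  set h : ι → ℝ := fun i => f (Pi.single i 1) with hh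
  have hf : ∀ y, f y = y ⬝ᵥ h := by
    intro y
    have : y = ∑ i, y i • (Pi.single i 1 : ι → ℝ) := by
      ext j; simp [Finset.sum_apply, Pi.single_apply]
    conv_lhs => rw [this]
    simp [dotProduct, hh]
  obtain ⟨C, hC⟩ := hP.upper
  obtain ⟨M, hM⟩ := (hK.image (dotCLM x).continuous).bddAbove
  have key : ∀ t : ℝ, 0 < t → t * (G x ⬝ᵥ h - u) ≤ M + C - φ x := by
    intro t ht
    obtain ⟨y, hy, hle⟩ := hC (x + t • h)
    have h1 := hP.add_mul_le x h ht
    have h2 := hM ⟨y, hy, rfl⟩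
    have h3 := hu y hy
    rw [dotCLM_apply] at h2
    rw [hf, dotProduct_comm] at h3
    rw [add_dotProduct, smul_dotProduct, smul_eq_mul] at hle
    nlinarith
  rw [hf] at hfx
  have hpos : 0 < G x ⬝ᵥ h - u := by linarith
  have := key ((|M + C - φ x| + 1) / (G x ⬝ᵥ h - u)) (by positivity)
  rw [div_mul_cancel₀ _ hpos.ne'] at this
  linarith [le_abs_self (M + C - φ x)]

/-- For `y` in the interior of `K` the function `φ x - ⟨x, y⟩` tends to infinity; at its minimum the
gradient of `φ` is `y`. -/
theorem interior_subset_range (hP : IsPotential K φ G A) : interior K ⊆ Set.range G := by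
  intro y hy
  obtain ⟨ε, hε, hball⟩ := Metric.isOpen_iff.1 isOpen_interior y hy
  obtain ⟨C, hC⟩ := hP.lower
  have hbound : ∀ x : ι → ℝ, ε / 2 * ‖x‖ - C ≤ φ x - x ⬝ᵥ y := by
    intro x
    -- The sign vector of `x` has sup norm at most `1`, and its pairing with `x` is the `ℓ¹` norm,
    -- which dominates the sup norm.
    set e : ι → ℝ := fun i => if 0 ≤ x i then 1 else -1 with he
    have hmem : y + (ε / 2) • e ∈ K := by
      refine interior_subset (hball ?_)
      rw [mem_ball_iff_norm, add_sub_cancel_left, norm_smul, Real.norm_of_nonneg (by positivity)]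
      have : ‖e‖ ≤ 1 := (pi_norm_le_iff_of_nonneg zero_le_one).2 fun i => by
        simp only [he]; split_ifs <;> simp
      nlinarith
    have h1 := hC x _ hmem
    have h2 : ‖x‖ ≤ x ⬝ᵥ e := by
      have : x ⬝ᵥ e = ∑ i, |x i| := by
        refine Finset.sum_congr rfl fun i _ => ?_
        simp only [he]
        split_ifs with h
        · rw [abs_of_nonneg h, mul_one]
        · rw [abs_of_neg (not_le.1 h), mul_neg_one]
      rw [this]
      refine (pi_norm_le_iff_of_nonneg (Finset.sum_nonneg fun i _ => abs_nonneg _)).2 fun i => ?_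
      exact Finset.single_le_sum (f := fun i => |x i|) (fun i _ => abs_nonneg _) (Finset.mem_univ i)
    rw [dotProduct_add, dotProduct_smul, smul_eq_mul] at h1
    nlinarith
  have hcont : Continuous fun x => φ x - x ⬝ᵥ y := by
    have h1 : Continuous φ := continuous_iff_continuousAt.2 fun x => (hP.hasFDerivAt x).continuousAt
    have h2 : Continuous fun x : ι → ℝ => x ⬝ᵥ y := by
      simp_rw [dotProduct_comm _ y, ← dotCLM_apply]
      exact (dotCLM y).continuous
    exact h1.sub h2
  have hlim : Filter.Tendsto (fun x => φ x - x ⬝ᵥ y) (Filter.cocompact (ι → ℝ)) Filter.atTop := by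
    refine Filter.tendsto_atTop_mono hbound ?_
    have := Filter.Tendsto.const_mul_atTop (half_pos hε)
      (tendsto_norm_cocompact_atTop (E := ι → ℝ))
    simpa [sub_eq_add_neg] using Filter.tendsto_atTop_add_const_right _ (-C) this
  obtain ⟨x, hx⟩ := hcont.exists_forall_le hlim
  refine ⟨x, ?_⟩
  have hd : HasFDerivAt (fun x => φ x - x ⬝ᵥ y) (dotCLM (G x) - dotCLM y) x := by
    simp_rw [dotProduct_comm _ y, ← dotCLM_apply]
    exact (hP.hasFDerivAt x).sub (dotCLM y).hasFDerivAt
  have h0 := IsLocalMin.hasFDerivAt_eq_zero (Filter.Eventually.of_forall hx) hd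
  ext i
  have := congrArg (fun f => f (Pi.single i 1)) h0
  simpa [sub_eq_zero] using this

/-- If `G` agrees at `x` and `x + h`, the monotone function `⟨G (x + s h), h⟩` is constant on `[0,
1]`. Its derivative `⟨A h, h⟩` vanishes at `x`, so `A h = 0` by semidefiniteness, and `h = 0` by
invertibility. -/
theorem injOn_grad (hP : IsPotential K φ G A) : Set.InjOn G {x | (A x).det ≠ 0} := by
  intro x hx x' _ hxx
  set h := x' - x with hh
  have hmono := hP.monotone_grad_line x h
  have h01 : G (x + (1 : ℝ) • h) ⬝ᵥ h = G (x + (0 : ℝ) • h) ⬝ᵥ h := by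
    simp [hh, hxx]
  have hconst : ∀ s ∈ Set.Icc (0 : ℝ) 1, G (x + s • h) ⬝ᵥ h = G x ⬝ᵥ h := by
    intro s hs
    have a1 := hmono hs.1
    have a2 := hmono hs.2
    simp only at a1 a2
    rw [h01] at a2
    simp only [zero_smul, add_zero] at a1 a2
    exact le_antisymm a2 a1
  have hd := (hP.hasDerivAt_grad_line x h 0).hasDerivWithinAt (s := Set.Icc (0 : ℝ) 1)
  have hd' : HasDerivWithinAt (fun s : ℝ => G (x + s • h) ⬝ᵥ h) 0 (Set.Icc (0 : ℝ) 1) 0 :=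
    (hasDerivWithinAt_const (0 : ℝ) _ (G x ⬝ᵥ h)).congr hconst (hconst 0 (by simp))
  have h0 := (uniqueDiffOn_Icc zero_lt_one 0 (by simp)).eq_deriv _ hd hd'
  rw [zero_smul, add_zero, dotProduct_comm] at h0
  have h1 : (A x).mulVec h = 0 := by
    refine ((hP.posSemidef x).dotProduct_mulVec_zero_iff h).1 ?_
    simpa using h0
  have h2 : h = 0 := Matrix.eq_zero_of_mulVec_eq_zero hx h1
  rw [hh, sub_eq_zero] at h2
  exact h2.symm

theorem det_nonneg (hP : IsPotential K φ G A) (x : ι → ℝ) : 0 ≤ (A x).det :=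
  (hP.posSemidef x).det_nonneg

theorem continuous_det (hP : IsPotential K φ G A) : Continuous fun x => (A x).det :=
  hP.continuous_hess.matrix_det

/-- The volume of a compact convex set is the total Monge-Ampère mass of a potential. -/
theorem volume_eq (hP : IsPotential K φ G A) (hK : IsCompact K) (hc : Convex ℝ K) :
    volume K = ∫⁻ x, ENNReal.ofReal (A x).det := by
  set U : Set (ι → ℝ) := {x | (A x).det ≠ 0} with hU
  have hUm : MeasurableSet U := (measurableSet_eq_fun hP.continuous_det.measurable
    measurable_const).compl
  have hint : ∫⁻ x, ENNReal.ofReal (A x).det = volume (G '' U) := by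
    rw [← lintegral_abs_det_fderiv_eq_addHaar_image volume hUm
      (fun x _ => (hP.hasFDerivAt_grad x).hasFDerivWithinAt) hP.injOn_grad,
      ← lintegral_indicator hUm]
    refine lintegral_congr fun x => ?_
    by_cases hx : x ∈ U
    · rw [Set.indicator_of_mem hx, det_matCLM, abs_of_nonneg (hP.det_nonneg x)]
    · rw [Set.indicator_of_notMem hx]
      have : (A x).det = 0 := by simpa [hU] using hx
      simp [this]
  -- Sard's lemma: critical values are negligible, so `G '' U` fills `K` up to this null set and the
  -- null frontier of `K`.
  have hnull : volume (G '' Uᶜ) = 0 := by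
    refine addHaar_image_eq_zero_of_det_fderivWithin_eq_zero volume
      (fun x _ => (hP.hasFDerivAt_grad x).hasFDerivWithinAt) fun x hx => ?_
    simpa [hU] using hx
  rw [hint]
  refine le_antisymm ?_ (measure_mono ?_)
  · calc volume K ≤ volume (interior K ∪ frontier K) := by
          refine measure_mono (subset_closure.trans ?_)
          rw [closure_eq_interior_union_frontier]
      _ ≤ volume (interior K) + volume (frontier K) := measure_union_le _ _
      _ = volume (interior K) := by rw [hc.addHaar_frontier volume, add_zero]
      _ ≤ volume (G '' U ∪ G '' Uᶜ) := by
          refine measure_mono (hP.interior_subset_range.trans ?_)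
          rw [← Set.image_union, Set.union_compl_self, Set.image_univ]
      _ ≤ volume (G '' U) + volume (G '' Uᶜ) := measure_union_le _ _
      _ = volume (G '' U) := by rw [hnull, add_zero]
  · rintro _ ⟨x, _, rfl⟩
    exact hP.grad_mem hK hc x

/-- Support functions add under Minkowski sums, hence so do potentials. This turns the volume of a
Minkowski sum into the integral of the determinant of a sum of Hessians. -/
theorem add (hP : IsPotential K φ G A) {K' : Set (ι → ℝ)} {φ' : (ι → ℝ) → ℝ}
    {G' : (ι → ℝ) → ι → ℝ} {A' : (ι → ℝ) → Matrix ι ι ℝ} (hP' : IsPotential K' φ' G' A') :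
    IsPotential (K + K') (φ + φ') (G + G') (A + A') where
  hasFDerivAt x := by
    exact ((hP.hasFDerivAt x).add (hP'.hasFDerivAt x)).congr_fderiv (by ext h; simp)
  hasFDerivAt_grad x := by
    exact ((hP.hasFDerivAt_grad x).add (hP'.hasFDerivAt_grad x)).congr_fderiv (by ext h; simp [Matrix.add_mulVec])
  continuous_hess := hP.continuous_hess.add hP'.continuous_hess
  posSemidef x := (hP.posSemidef x).add (hP'.posSemidef x)
  lower := by
    obtain ⟨C, hC⟩ := hP.lower
    obtain ⟨C', hC'⟩ := hP'.lower
    refine ⟨C + C', ?_⟩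
    rintro x _ ⟨y, hy, y', hy', rfl⟩
    have := hC x y hy
    have := hC' x y' hy'
    simp only [dotProduct_add, Pi.add_apply]
    linarith
  upper := by
    obtain ⟨C, hC⟩ := hP.upper
    obtain ⟨C', hC'⟩ := hP'.upper
    refine ⟨C + C', fun x => ?_⟩
    obtain ⟨y, hy, h⟩ := hC x
    obtain ⟨y', hy', h'⟩ := hC' x
    refine ⟨y + y', Set.add_mem_add hy hy', ?_⟩
    simp only [dotProduct_add, Pi.add_apply]
    linarith

theorem zero : IsPotential (0 : Set (ι → ℝ)) 0 0 0 where
  hasFDerivAt x := by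
    exact (hasFDerivAt_const (0 : ℝ) x).congr_fderiv (by ext h; simp)
  hasFDerivAt_grad x := by
    exact (hasFDerivAt_const (0 : ι → ℝ) x).congr_fderiv (by ext h; simp)
  continuous_hess := continuous_const
  posSemidef x := Matrix.PosSemidef.zero
  lower := ⟨0, by simp⟩
  upper := ⟨0, by simp⟩

theorem sum {α : Type*} (S : Finset α) {K : α → Set (ι → ℝ)} {φ : α → (ι → ℝ) → ℝ}
    {G : α → (ι → ℝ) → ι → ℝ} {A : α → (ι → ℝ) → Matrix ι ι ℝ}
    (h : ∀ a, IsPotential (K a) (φ a) (G a) (A a)) :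
    IsPotential (∑ a ∈ S, K a) (∑ a ∈ S, φ a) (∑ a ∈ S, G a) (∑ a ∈ S, A a) := by
  classical
  induction S using Finset.induction_on with
  | empty => simpa using zero
  | insert a S ha ih =>
    simp only [Finset.sum_insert ha]
    exact (h a).add ih

end IsPotential

end Petty

/-! ### Mixed discriminants and mixed volumes -/

namespace Petty

variable {ι : Type*} [Fintype ι] [DecidableEq ι]

section Update

variable {ι : Type*} [DecidableEq ι]

theorem update_apply_point (A : ι → (ι → ℝ) → Matrix ι ι ℝ) (i : ι)
    (B : (ι → ℝ) → Matrix ι ι ℝ) (x : ι → ℝ) :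
    (fun j => Function.update A i B j x) = Function.update (fun j => A j x) i (B x) := by
  ext j : 1
  rcases eq_or_ne j i with rfl | h <;> simp [*]

theorem forall_update_of (p : Set (ι → ℝ) → Prop) {K : ι → Set (ι → ℝ)} (hK : ∀ i, p (K i)) (i : ι) {L : Set (ι → ℝ)}
    (hL : p L) (j : ι) : p (Function.update K i L j) := by
  rcases eq_or_ne j i with rfl | h
  · simpa using hL
  · simpa [h] using hK j

end Update

/-- The polarized determinant, `n!` times the mixed discriminant. -/
noncomputable def polarDet (A : ι → Matrix ι ι ℝ) : ℝ :=
  ∑ σ : Equiv.Perm ι, Matrix.detRowAlternating fun r => A (σ r) r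

/-- The complements of the sets `S` that contain the range of `i` are all subsets of its complement;
their alternating count vanishes unless that complement is empty. -/
theorem sum_neg_one_pow_of_forall_mem (i : ι → ι) :
    (∑ S : Finset ι, if ∀ k, i k ∈ S then (-1 : ℝ) ^ (Fintype.card ι - S.card) else 0)
      = if Function.Surjective i then 1 else 0 := by
  have hc : (∑ S : Finset ι, if ∀ k, i k ∈ S then (-1 : ℝ) ^ (Fintype.card ι - S.card) else 0)
      = ∑ T ∈ (Finset.univ \ Finset.univ.image i).powerset, (-1 : ℝ) ^ T.card := by
    rw [← Finset.sum_filter]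
    refine Finset.sum_bij' (fun S _ => Sᶜ) (fun T _ => Tᶜ) ?_ ?_ ?_ ?_ ?_
    · intro S hS
      simp only [Finset.mem_filter, Finset.mem_univ, true_and] at hS
      rw [Finset.mem_powerset]
      intro x hx
      simp only [Finset.mem_sdiff, Finset.mem_univ, true_and, Finset.mem_image, not_exists]
      intro k hk
      exact (Finset.mem_compl.1 hx) (hk ▸ hS k)
    · intro T hT
      rw [Finset.mem_powerset] at hT
      simp only [Finset.mem_filter, Finset.mem_univ, true_and, Finset.mem_compl]
      intro k hk
      have := hT hk
      simp at this
    · intro S _; simp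
    · intro T _; simp
    · intro S _
      rw [Finset.card_compl]
  rw [hc]
  have h4 : (∑ T ∈ (Finset.univ \ Finset.univ.image i).powerset, (-1 : ℝ) ^ T.card)
      = if (Finset.univ \ Finset.univ.image i) = ∅ then 1 else 0 := by
    exact_mod_cast Finset.sum_powerset_neg_one_pow_card (x := Finset.univ \ Finset.univ.image i)
  rw [h4]
  refine if_congr ?_ rfl rfl
  simp [Finset.ext_iff, Function.Surjective]

/-- Expand the determinants multilinearly in the rows. Inclusion-exclusion keeps the surjective
assignments of matrices to rows, which are the permutations. The alternating sum is the one in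
`polarVol`. -/
theorem polarDet_eq_sum (A : ι → Matrix ι ι ℝ) :
    ∑ S : Finset ι, (-1 : ℝ) ^ (Fintype.card ι - S.card) * (∑ i ∈ S, A i).det = polarDet A := by
  have h1 : ∀ S : Finset ι, (∑ i ∈ S, A i).det
      = ∑ f : ι → ι, if ∀ k, f k ∈ S then Matrix.detRowAlternating (fun r => A (f r) r) else 0 := by
    intro S
    have h := (Matrix.detRowAlternating (n := ι) (R := ℝ)).toMultilinearMap.map_sum_finset
      (fun r i => A i r) (fun _ => S)
    have e : (fun r => ∑ i ∈ S, A i r) = ∑ i ∈ S, A i := by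
      ext r c; simp [Matrix.sum_apply, Finset.sum_apply]
    rw [e] at h
    refine Eq.trans h ?_
    rw [← Finset.sum_filter]
    refine Finset.sum_congr ?_ fun _ _ => rfl
    ext f; simp [Fintype.mem_piFinset]
  simp_rw [h1, Finset.mul_sum]
  rw [Finset.sum_comm]
  have h2 : ∀ f : ι → ι, ∑ S : Finset ι, (-1 : ℝ) ^ (Fintype.card ι - S.card) *
      (if ∀ k, f k ∈ S then Matrix.detRowAlternating (fun r => A (f r) r) else 0)
      = if Function.Surjective f then Matrix.detRowAlternating (fun r => A (f r) r) else 0 := by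
    intro f
    have := congrArg (fun x => x * Matrix.detRowAlternating (fun r => A (f r) r))
      (sum_neg_one_pow_of_forall_mem f)
    simp only [Finset.sum_mul, ite_mul, one_mul, zero_mul] at this
    rw [← this]
    exact Finset.sum_congr rfl fun S _ => by split_ifs <;> simp
  simp_rw [h2]
  rw [← Finset.sum_filter, polarDet]
  symm
  refine Finset.sum_bij (fun σ _ => (σ : ι → ι)) ?_ ?_ ?_ ?_
  · intro σ _; simp [σ.surjective]
  · intro σ _ τ _ h; exact DFunLike.coe_injective h
  · intro f hf
    have hs := (Finset.mem_filter.1 hf).2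
    exact ⟨Equiv.ofBijective f (Finite.injective_iff_bijective.1
      (Finite.injective_iff_surjective.2 hs)), Finset.mem_univ _, rfl⟩
  · intro σ _; rfl

theorem polarDet_update_add (A : ι → Matrix ι ι ℝ) (i : ι) (B B' : Matrix ι ι ℝ) :
    polarDet (Function.update A i (B + B'))
      = polarDet (Function.update A i B) + polarDet (Function.update A i B') := by
  have h : ∀ (X : Matrix ι ι ℝ) (σ : Equiv.Perm ι), (fun r => Function.update A i X (σ r) r)
      = Function.update (fun r => A (σ r) r) (σ.symm i) (X (σ.symm i)) := by
    intro X σ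
    ext r c
    rcases eq_or_ne r (σ.symm i) with rfl | hr
    · simp
    · have : σ r ≠ i := fun h => hr (by rw [← h]; simp)
      simp [hr, this]
  simp only [polarDet, h, ← Finset.sum_add_distrib]
  refine Finset.sum_congr rfl fun σ _ => ?_
  exact Matrix.detRowAlternating.map_update_add _ _ _ _

open scoped MatrixOrder Matrix.Norms.L2Operator in
theorem exists_eq_transpose_mul {A : Matrix ι ι ℝ} (hA : A.PosSemidef) :
    ∃ B : Matrix ι ι ℝ, A = B.transpose * B := by
  obtain ⟨B, hB⟩ := CStarAlgebra.nonneg_iff_eq_star_mul_self.mp hA.nonneg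
  refine ⟨B, ?_⟩
  rw [hB, Matrix.star_eq_conjTranspose, Matrix.conjTranspose_eq_transpose_of_trivial]

/-- Write `Aᵢ = Bᵢᵀ Bᵢ` and expand each row in the rows of `Bᵢ`. For each choice of one row from
every `Bᵢ`, the sum over permutations is the square of the determinant of the chosen rows. -/
theorem polarDet_nonneg {A : ι → Matrix ι ι ℝ} (hA : ∀ i, (A i).PosSemidef) : 0 ≤ polarDet A := by
  choose B hB using fun i => exists_eq_transpose_mul (hA i)
  have hrow : ∀ i r, A i r = ∑ k, B i k r • B i k := by
    intro i r
    ext c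
    simp [hB, Matrix.mul_apply, Finset.sum_apply]
  have hσ : ∀ σ : Equiv.Perm ι, Matrix.detRowAlternating (fun r => A (σ r) r)
      = ∑ g : ι → ι, (Equiv.Perm.sign σ * ∏ r, (Matrix.of fun i => B i (g i)) (σ r) r) *
          (Matrix.of fun i => B i (g i)).det := by
    intro σ
    simp_rw [hrow]
    have h := (Matrix.detRowAlternating (n := ι) (R := ℝ)).toMultilinearMap.map_sum
      (fun r k => B (σ r) k r • B (σ r) k)
    refine Eq.trans h ?_
    refine (Fintype.sum_equiv (Equiv.arrowCongr σ (Equiv.refl ι)).symm _ _ fun g => ?_).symm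
    have h2 := (Matrix.detRowAlternating (n := ι) (R := ℝ)).toMultilinearMap.map_smul_univ
      (fun r => B (σ r) (g (σ r)) r) (fun r => B (σ r) (g (σ r)))
    refine Eq.trans ?_ h2.symm
    have h3 := Matrix.det_permute σ (Matrix.of fun i => B i (g i))
    rw [mul_right_comm, smul_eq_mul, mul_comm]
    refine congrArg₂ _ rfl ?_
    exact h3.symm
  rw [polarDet]
  simp_rw [hσ]
  rw [Finset.sum_comm]
  refine Finset.sum_nonneg fun g _ => ?_
  rw [← Finset.sum_mul, ← Matrix.det_apply']
  exact mul_self_nonneg _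

theorem continuous_polarDet : Continuous (polarDet : (ι → Matrix ι ι ℝ) → ℝ) := by
  refine continuous_finsetSum _ fun σ _ => ?_
  exact Continuous.matrix_det (A := fun (A : ι → Matrix ι ι ℝ) r => A (σ r) r)
    (continuous_pi fun r => (continuous_apply r).comp (continuous_apply (σ r)))

/-- `n!` times the mixed volume, as an alternating sum. -/
noncomputable def polarVol (K : ι → Set (ι → ℝ)) : ℝ :=
  ∑ S : Finset ι, (-1 : ℝ) ^ (Fintype.card ι - S.card) * volume.real (∑ i ∈ S, K i)

theorem isCompact_finset_sum {α E : Type*} [AddCommMonoid E] [TopologicalSpace E] [ContinuousAdd E]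
    (S : Finset α) {K : α → Set E} (h : ∀ a, IsCompact (K a)) : IsCompact (∑ a ∈ S, K a) := by
  classical
  induction S using Finset.induction_on with
  | empty => simp
  | insert a S ha ih => rw [Finset.sum_insert ha]; exact (h a).add ih

theorem convex_finset_sum {α E : Type*} [AddCommGroup E] [Module ℝ E]
    (S : Finset α) {K : α → Set E} (h : ∀ a, Convex ℝ (K a)) : Convex ℝ (∑ a ∈ S, K a) := by
  classical
  induction S using Finset.induction_on with
  | empty => exact convex_singleton (0 : E)
  | insert a S ha ih => rw [Finset.sum_insert ha]; exact (h a).add ih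

section Potentials

variable {K : ι → Set (ι → ℝ)} {φ : ι → (ι → ℝ) → ℝ} {G : ι → (ι → ℝ) → ι → ℝ}
  {A : ι → (ι → ℝ) → Matrix ι ι ℝ}

/-- The Monge-Ampère formula for every partial Minkowski sum, combined by the polarization identity
for determinants. -/
theorem polarVol_eq_integral (hK : ∀ i, IsCompact (K i)) (hc : ∀ i, Convex ℝ (K i))
    (hP : ∀ i, IsPotential (K i) (φ i) (G i) (A i)) :
    Integrable (fun x => polarDet fun i => A i x) ∧
      polarVol K = ∫ x, polarDet fun i => A i x := by
  have hS : ∀ S : Finset ι, Integrable (fun x => (∑ i ∈ S, A i x).det) ∧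
      volume.real (∑ i ∈ S, K i) = ∫ x, (∑ i ∈ S, A i x).det := by
    intro S
    have hPS := IsPotential.sum S hP
    have hv := hPS.volume_eq (isCompact_finset_sum S hK) (convex_finset_sum S hc)
    have hcont := hPS.continuous_det
    have hnn := hPS.det_nonneg
    simp only [Finset.sum_apply] at hv hcont hnn
    have hm : AEStronglyMeasurable (fun x => (∑ i ∈ S, A i x).det) volume :=
      hcont.aestronglyMeasurable
    refine ⟨⟨hm, ?_⟩, ?_⟩
    · rw [hasFiniteIntegral_iff_ofReal (Filter.Eventually.of_forall hnn), ← hv]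
      exact (isCompact_finset_sum S hK).measure_lt_top
    · rw [integral_eq_lintegral_of_nonneg_ae (Filter.Eventually.of_forall hnn) hm, ← hv]
      rfl
  simp_rw [← polarDet_eq_sum]
  refine ⟨integrable_finsetSum _ fun S _ => (hS S).1.const_mul _, ?_⟩
  rw [integral_finsetSum _ fun S _ => (hS S).1.const_mul _, polarVol]
  refine Finset.sum_congr rfl fun S _ => ?_
  rw [integral_const_mul, (hS S).2]

theorem IsPotential.update (hP : ∀ i, IsPotential (K i) (φ i) (G i) (A i)) (i : ι)
    {L : Set (ι → ℝ)} {φ' : (ι → ℝ) → ℝ} {G' : (ι → ℝ) → ι → ℝ} {B : (ι → ℝ) → Matrix ι ι ℝ}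
    (hL : IsPotential L φ' G' B) (j : ι) :
    IsPotential (Function.update K i L j) (Function.update φ i φ' j) (Function.update G i G' j)
      (Function.update A i B j) := by
  rcases eq_or_ne j i with rfl | h
  · simpa using hL
  · simpa [h] using hP j

theorem polarVol_update_eq_integral (hK : ∀ i, IsCompact (K i)) (hc : ∀ i, Convex ℝ (K i))
    (hP : ∀ i, IsPotential (K i) (φ i) (G i) (A i)) (i : ι) {L : Set (ι → ℝ)} {φ' : (ι → ℝ) → ℝ}
    {G' : (ι → ℝ) → ι → ℝ} {B : (ι → ℝ) → Matrix ι ι ℝ} (hL : IsPotential L φ' G' B)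
    (hLK : IsCompact L) (hLc : Convex ℝ L) :
    Integrable (fun x => polarDet (Function.update (fun j => A j x) i (B x))) ∧
      polarVol (Function.update K i L)
        = ∫ x, polarDet (Function.update (fun j => A j x) i (B x)) := by
  have := polarVol_eq_integral (forall_update_of _ hK i hLK) (forall_update_of _ hc i hLc)
    (IsPotential.update hP i hL)
  simpa only [update_apply_point] using this

theorem polarVol_update_add (hK : ∀ i, IsCompact (K i)) (hc : ∀ i, Convex ℝ (K i))
    (hP : ∀ i, IsPotential (K i) (φ i) (G i) (A i)) (i : ι) {L L' : Set (ι → ℝ)}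
    {φ₁ φ₂ : (ι → ℝ) → ℝ} {G₁ G₂ : (ι → ℝ) → ι → ℝ} {B₁ B₂ : (ι → ℝ) → Matrix ι ι ℝ}
    (hL : IsPotential L φ₁ G₁ B₁) (hLK : IsCompact L) (hLc : Convex ℝ L)
    (hL' : IsPotential L' φ₂ G₂ B₂) (hLK' : IsCompact L') (hLc' : Convex ℝ L') :
    polarVol (Function.update K i (L + L'))
      = polarVol (Function.update K i L) + polarVol (Function.update K i L') := by
  obtain ⟨i1, e1⟩ := polarVol_update_eq_integral hK hc hP i hL hLK hLc
  obtain ⟨i2, e2⟩ := polarVol_update_eq_integral hK hc hP i hL' hLK' hLc'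
  obtain ⟨-, e3⟩ := polarVol_update_eq_integral hK hc hP i (hL.add hL') (hLK.add hLK')
    (hLc.add hLc')
  rw [e1, e2, e3, ← integral_add i1 i2]
  simp only [Pi.add_apply, polarDet_update_add]

/-- The integral of the mixed discriminant depends only on the body, not on its potential. Hence all
potentials of `L'` give the same value, and if their Hessians converge pointwise to those of a
potential of `L`, Fatou's lemma compares the two mixed volumes. Nonnegativity of the mixed
discriminant is essential here. -/
theorem polarVol_update_le (hK : ∀ i, IsCompact (K i)) (hc : ∀ i, Convex ℝ (K i))
    (hP : ∀ i, IsPotential (K i) (φ i) (G i) (A i)) (i : ι) {L L' : Set (ι → ℝ)}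
    {φ₁ : (ι → ℝ) → ℝ} {G₁ : (ι → ℝ) → ι → ℝ} {B₁ : (ι → ℝ) → Matrix ι ι ℝ}
    (hL : IsPotential L φ₁ G₁ B₁) (hLK : IsCompact L) (hLc : Convex ℝ L)
    {φ₂ : ℕ → (ι → ℝ) → ℝ} {G₂ : ℕ → (ι → ℝ) → ι → ℝ} {B₂ : ℕ → (ι → ℝ) → Matrix ι ι ℝ}
    (hL' : ∀ n, IsPotential L' (φ₂ n) (G₂ n) (B₂ n)) (hLK' : IsCompact L') (hLc' : Convex ℝ L')
    (hlim : ∀ x, Filter.Tendsto (fun n => B₂ n x) Filter.atTop (nhds (B₁ x))) :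
    polarVol (Function.update K i L) ≤ polarVol (Function.update K i L') := by
  have hnn : ∀ {L : Set (ι → ℝ)} {φ' : (ι → ℝ) → ℝ} {G' : (ι → ℝ) → ι → ℝ}
      {B : (ι → ℝ) → Matrix ι ι ℝ}, IsPotential L φ' G' B →
      ∀ x, 0 ≤ polarDet (Function.update (fun j => A j x) i (B x)) := by
    intro L φ' G' B h x
    rw [← update_apply_point]
    exact polarDet_nonneg fun j => (IsPotential.update hP i h j).posSemidef x
  have hof : ∀ {L : Set (ι → ℝ)} {φ' : (ι → ℝ) → ℝ} {G' : (ι → ℝ) → ι → ℝ}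
      {B : (ι → ℝ) → Matrix ι ι ℝ}, IsPotential L φ' G' B → IsCompact L → Convex ℝ L →
      0 ≤ polarVol (Function.update K i L) ∧ ENNReal.ofReal (polarVol (Function.update K i L))
        = ∫⁻ x, ENNReal.ofReal (polarDet (Function.update (fun j => A j x) i (B x))) := by
    intro L φ' G' B h hLK hLc
    obtain ⟨i1, e1⟩ := polarVol_update_eq_integral hK hc hP i h hLK hLc
    refine ⟨e1 ▸ integral_nonneg (hnn h), ?_⟩
    rw [e1, ofReal_integral_eq_lintegral_ofReal i1 (Filter.Eventually.of_forall (hnn h))]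
  rw [← ENNReal.ofReal_le_ofReal_iff (hof (hL' 0) hLK' hLc').1, (hof hL hLK hLc).2]
  have hpt : ∀ x, Filter.Tendsto
      (fun n => ENNReal.ofReal (polarDet (Function.update (fun j => A j x) i (B₂ n x))))
      Filter.atTop
      (nhds (ENNReal.ofReal (polarDet (Function.update (fun j => A j x) i (B₁ x))))) := by
    intro x
    have hcont : Continuous fun B => ENNReal.ofReal
        (polarDet (Function.update (fun j => A j x) i B)) :=
      ENNReal.continuous_ofReal.comp
        (continuous_polarDet.comp (continuous_const.update i continuous_id))
    exact (hcont.tendsto _).comp (hlim x)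
  calc _ = ∫⁻ x, Filter.liminf
        (fun n => ENNReal.ofReal (polarDet (Function.update (fun j => A j x) i (B₂ n x))))
        Filter.atTop := lintegral_congr fun x => (hpt x).liminf_eq.symm
    _ ≤ Filter.liminf (fun n => ∫⁻ x,
          ENNReal.ofReal (polarDet (Function.update (fun j => A j x) i (B₂ n x)))) Filter.atTop := by
        refine lintegral_liminf_le fun n => ?_
        refine (ENNReal.continuous_ofReal.comp (continuous_polarDet.comp ?_)).measurable
        exact (continuous_pi fun j => (hP j).continuous_hess).update i (hL' n).continuous_hess
    _ = _ := by
        simp_rw [← fun n => (hof (hL' n) hLK' hLc').2]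
        simp

end Potentials

end Petty

namespace Petty

variable {ι : Type*} [Fintype ι] {τ : Type*} [Fintype τ]

/-! ### Softmax potentials of polytopes -/

/-- The partition function `∑ wₖ exp ⟨pₖ, x⟩`. -/
noncomputable def softSum (w : τ → ℝ) (p : τ → ι → ℝ) (x : ι → ℝ) : ℝ :=
  ∑ k, w k * Real.exp (p k ⬝ᵥ x)

/-- The potential `log ∑ wₖ exp ⟨pₖ, x⟩`. -/
noncomputable def softPot (w : τ → ℝ) (p : τ → ι → ℝ) (x : ι → ℝ) : ℝ :=
  Real.log (softSum w p x)

/-- The weights of the points `pₖ` in the gradient of `softPot`. -/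
noncomputable def softWeight (w : τ → ℝ) (p : τ → ι → ℝ) (k : τ) (x : ι → ℝ) : ℝ :=
  w k * Real.exp (p k ⬝ᵥ x - softPot w p x)

/-- The gradient of `softPot`. -/
noncomputable def softGrad (w : τ → ℝ) (p : τ → ι → ℝ) (x : ι → ℝ) : ι → ℝ :=
  ∑ k, softWeight w p k x • p k

/-- The Hessian of `softPot`. -/
noncomputable def softHess (w : τ → ℝ) (p : τ → ι → ℝ) (x : ι → ℝ) : Matrix ι ι ℝ :=
  ∑ k, softWeight w p k x •
    Matrix.vecMulVec (p k - softGrad w p x) (p k - softGrad w p x)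

section Softmax

variable {w : τ → ℝ} (p : τ → ι → ℝ)

theorem softSum_pos (hw : ∀ k, 0 ≤ w k) (hw' : ∃ k, 0 < w k) (x : ι → ℝ) : 0 < softSum w p x := by
  obtain ⟨k, hk⟩ := hw'
  exact Finset.sum_pos' (fun k _ => mul_nonneg (hw k) (Real.exp_pos _).le)
    ⟨k, Finset.mem_univ k, mul_pos hk (Real.exp_pos _)⟩

theorem softWeight_eq (hw : ∀ k, 0 ≤ w k) (hw' : ∃ k, 0 < w k) (k : τ) (x : ι → ℝ) :
    softWeight w p k x = (softSum w p x)⁻¹ * (w k * Real.exp (p k ⬝ᵥ x)) := by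
  rw [softWeight, softPot, Real.exp_sub, Real.exp_log (softSum_pos p hw hw' x)]
  field_simp

theorem sum_softWeight (hw : ∀ k, 0 ≤ w k) (hw' : ∃ k, 0 < w k) (x : ι → ℝ) :
    ∑ k, softWeight w p k x = 1 := by
  simp_rw [softWeight_eq p hw hw']
  rw [← Finset.mul_sum]
  exact inv_mul_cancel₀ (softSum_pos p hw hw' x).ne'

variable [DecidableEq ι]

theorem hasFDerivAt_softPot (hw : ∀ k, 0 ≤ w k) (hw' : ∃ k, 0 < w k) (x : ι → ℝ) :
    HasFDerivAt (softPot w p) (dotCLM (softGrad w p x)) x := by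
  have h1 : ∀ k, HasFDerivAt (fun x => w k * Real.exp (p k ⬝ᵥ x))
      (w k • Real.exp (p k ⬝ᵥ x) • dotCLM (p k)) x := by
    intro k
    have : HasFDerivAt (fun x => p k ⬝ᵥ x) (dotCLM (p k)) x := by
      simp_rw [← dotCLM_apply]; exact (dotCLM (p k)).hasFDerivAt
    exact this.exp.const_mul _
  have h2 : HasFDerivAt (softSum w p) (∑ k, w k • Real.exp (p k ⬝ᵥ x) • dotCLM (p k)) x := by
    exact HasFDerivAt.fun_sum fun k _ => h1 k
  refine (h2.log (softSum_pos p hw hw' x).ne').congr_fderiv ?_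
  ext1 h
  simp only [softGrad, softWeight_eq p hw hw', dotCLM_apply, sum_dotProduct, smul_dotProduct,
    smul_apply, sum_apply, smul_eq_mul, Finset.mul_sum]
  exact Finset.sum_congr rfl fun k _ => by ring

theorem hasFDerivAt_softGrad (hw : ∀ k, 0 ≤ w k) (hw' : ∃ k, 0 < w k) (x : ι → ℝ) :
    HasFDerivAt (softGrad w p) (matCLM (softHess w p x)) x := by
  have h1 : ∀ k, HasFDerivAt (softWeight w p k)
      (softWeight w p k x • (dotCLM (p k) - dotCLM (softGrad w p x))) x := by
    intro k
    have h0 : HasFDerivAt (fun x => p k ⬝ᵥ x) (dotCLM (p k)) x := by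
      simp_rw [← dotCLM_apply]; exact (dotCLM (p k)).hasFDerivAt
    have := ((h0.sub (hasFDerivAt_softPot p hw hw' x)).exp.const_mul (w k))
    refine this.congr_fderiv ?_
    rw [smul_smul]; rfl
  have h2 : HasFDerivAt (softGrad w p) (∑ k, (softWeight w p k x •
      (dotCLM (p k) - dotCLM (softGrad w p x))).smulRight (p k)) x :=
    HasFDerivAt.fun_sum fun k _ => (h1 k).smul_const (p k)
  refine h2.congr_fderiv ?_
  ext1 h
  set g := softGrad w p x with hg
  -- `g` is the barycentre of the points, so `p k` may be replaced by `p k - g` in the derivative;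
  -- this gives the covariance form of the Hessian.
  have h3 : ∑ k, softWeight w p k x * ((p k - g) ⬝ᵥ h) = 0 := by
    simp only [sub_dotProduct, mul_sub, Finset.sum_sub_distrib, ← Finset.sum_mul]
    rw [sum_softWeight p hw hw', one_mul, hg, softGrad, sum_dotProduct]
    simp [smul_dotProduct]
  have h4 : (softHess w p x).mulVec h
      = ∑ k, (softWeight w p k x * ((p k - g) ⬝ᵥ h)) • (p k - g) := by
    rw [softHess, Matrix.sum_mulVec]
    refine Finset.sum_congr rfl fun k _ => ?_
    rw [Matrix.smul_mulVec, Matrix.vecMulVec_mulVec]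
    ext i; simp; ring
  rw [matCLM_apply, h4]
  simp only [smul_sub, Finset.sum_sub_distrib, ← Finset.sum_smul, h3, zero_smul, sub_zero]
  simp [sum_apply, sub_dotProduct, mul_sub]

/-- Continuity jointly in the weights, including at weights that vanish, is what lets one polytope
degenerate to a smaller one. -/
theorem continuousAt_softHess (hw : ∀ k, 0 ≤ w k) (hw' : ∃ k, 0 < w k) (x : ι → ℝ) :
    ContinuousAt (fun q : (τ → ℝ) × (ι → ℝ) => softHess q.1 p q.2) (w, x) := by
  have hd : ∀ k, Continuous fun q : (τ → ℝ) × (ι → ℝ) => p k ⬝ᵥ q.2 := by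
    intro k
    simp_rw [← dotCLM_apply]
    exact (dotCLM (p k)).continuous.comp continuous_snd
  have h1 : ContinuousAt (fun q : (τ → ℝ) × (ι → ℝ) => softPot q.1 p q.2) (w, x) := by
    have : Continuous fun q : (τ → ℝ) × (ι → ℝ) => softSum q.1 p q.2 := by
      refine continuous_finsetSum _ fun k _ => ?_
      exact ((continuous_apply k).comp continuous_fst).mul (Real.continuous_exp.comp (hd k))
    exact this.continuousAt.log (softSum_pos p hw hw' x).ne'
  have h2 : ∀ k, ContinuousAt (fun q : (τ → ℝ) × (ι → ℝ) => softWeight q.1 p k q.2) (w, x) :=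
    fun k => ((continuous_apply k).comp continuous_fst).continuousAt.mul
      (Real.continuous_exp.continuousAt.comp ((hd k).continuousAt.sub h1))
  have h3 : ContinuousAt (fun q : (τ → ℝ) × (ι → ℝ) => softGrad q.1 p q.2) (w, x) :=
    tendsto_finsetSum _ fun k _ => (h2 k).smul continuousAt_const
  have h4 : ∀ k, ContinuousAt (fun q : (τ → ℝ) × (ι → ℝ) => Matrix.vecMulVec
      (p k - softGrad q.1 p q.2) (p k - softGrad q.1 p q.2)) (w, x) := by
    intro k
    have h5 : ContinuousAt (fun q : (τ → ℝ) × (ι → ℝ) => p k - softGrad q.1 p q.2) (w, x) :=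
      continuousAt_const.sub h3
    have h6 : Continuous fun v : ι → ℝ => Matrix.vecMulVec v v :=
      continuous_id.matrix_vecMulVec continuous_id
    exact ContinuousAt.comp (f := fun q : (τ → ℝ) × (ι → ℝ) => p k - softGrad q.1 p q.2)
      h6.continuousAt h5
  exact tendsto_finsetSum _ fun k _ => (h2 k).smul (h4 k)

/-- Log-sum-exp differs by a bounded amount from the maximum of the linear forms with positive
weight, which is the support function of their hull. Its Hessian is a covariance matrix, hence
positive semidefinite. -/
theorem isPotential_softPot (hw : ∀ k, 0 ≤ w k) (hw' : ∃ k, 0 < w k) :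
    IsPotential (convexHull ℝ (p '' {k | 0 < w k})) (softPot w p) (softGrad w p)
      (softHess w p) where
  hasFDerivAt := hasFDerivAt_softPot p hw hw'
  hasFDerivAt_grad := hasFDerivAt_softGrad p hw hw'
  continuous_hess := continuous_iff_continuousAt.2 fun x =>
    (continuousAt_softHess p hw hw' x).comp (f := fun x : ι → ℝ => (w, x)) (by fun_prop)
  posSemidef x := by
    refine Matrix.posSemidef_sum _ fun k _ => ?_
    refine Matrix.PosSemidef.smul ?_ (mul_nonneg (hw k) (Real.exp_pos _).le)
    simpa using Matrix.posSemidef_vecMulVec_self_star (p k - softGrad w p x)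
  lower := by
    refine ⟨∑ k, |Real.log (w k)|, fun x => ?_⟩
    have hconv : Convex ℝ {y | dotCLM x y ≤ softPot w p x + ∑ k, |Real.log (w k)|} :=
      convex_halfSpace_le (dotCLM x).toLinearMap.isLinear _
    have hsub : p '' {k | 0 < w k} ⊆ {y | dotCLM x y ≤ softPot w p x + ∑ k, |Real.log (w k)|} := by
      rintro _ ⟨k, hk, rfl⟩
      have hk : 0 < w k := hk
      have h1 : w k * Real.exp (p k ⬝ᵥ x) ≤ softSum w p x :=
        Finset.single_le_sum (f := fun k => w k * Real.exp (p k ⬝ᵥ x))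
          (fun k _ => mul_nonneg (hw k) (Real.exp_pos _).le) (Finset.mem_univ k)
      have h2 := Real.log_le_log (mul_pos hk (Real.exp_pos _)) h1
      rw [Real.log_mul hk.ne' (Real.exp_pos _).ne', Real.log_exp] at h2
      have h3 : |Real.log (w k)| ≤ ∑ k, |Real.log (w k)| :=
        Finset.single_le_sum (f := fun k => |Real.log (w k)|) (fun _ _ => abs_nonneg _)
          (Finset.mem_univ k)
      have h4 := neg_abs_le (Real.log (w k))
      rw [Set.mem_ofPred_eq, dotCLM_apply, dotProduct_comm, softPot]
      linarith
    intro y hy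
    have := convexHull_min hsub hconv hy
    simpa using this
  upper := by
    refine ⟨Real.log (∑ k, w k), fun x => ?_⟩
    obtain ⟨k₀, hk₀⟩ := hw'
    obtain ⟨k, hk, hmax⟩ := (Finset.univ.filter fun k => 0 < w k).exists_max_image
      (fun k => p k ⬝ᵥ x) ⟨k₀, by simpa using hk₀⟩
    simp only [Finset.mem_filter, Finset.mem_univ, true_and] at hk hmax
    refine ⟨p k, subset_convexHull _ _ ⟨k, hk, rfl⟩, ?_⟩
    have hsum : 0 < ∑ k, w k := Finset.sum_pos' (fun k _ => hw k) ⟨k, Finset.mem_univ k, hk⟩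
    have h1 : softSum w p x ≤ (∑ k, w k) * Real.exp (p k ⬝ᵥ x) := by
      rw [softSum, Finset.sum_mul]
      refine Finset.sum_le_sum fun j _ => ?_
      rcases (hw j).eq_or_lt with hj | hj
      · simp [← hj]
      · exact mul_le_mul_of_nonneg_left (Real.exp_le_exp.2 (hmax j hj)) (hw j)
    have h2 := Real.log_le_log (softSum_pos p hw ⟨k, hk⟩ x) h1
    rw [Real.log_mul hsum.ne' (Real.exp_pos _).ne', Real.log_exp] at h2
    rw [softPot, dotProduct_comm]
    linarith

end Softmax

variable [DecidableEq ι]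

theorem exists_isPotential_convexHull_range [Nonempty τ] (p : τ → ι → ℝ) :
    ∃ φ G A, IsPotential (convexHull ℝ (Set.range p)) φ G A := by
  have h := isPotential_softPot (w := fun _ : τ => (1 : ℝ)) p (fun _ => zero_le_one)
    ⟨Classical.arbitrary τ, one_pos⟩
  have e : p '' {_k : τ | (0 : ℝ) < 1} = Set.range p := by
    ext y; simp
  rw [e] at h
  exact ⟨_, _, _, h⟩

theorem exists_isPotential_convexHull {s : Set (ι → ℝ)} (hs : s.Finite) (hne : s.Nonempty) :
    ∃ φ G A, IsPotential (convexHull ℝ s) φ G A := by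
  obtain ⟨n, p, hp⟩ : ∃ (n : ℕ) (p : Fin n → ι → ℝ), Set.range p = s := by
    obtain ⟨l, hl⟩ := hs.exists_finset_coe
    exact ⟨_, fun j => l.equivFin.symm j, by
      rw [← hl]; ext y; exact ⟨by rintro ⟨j, rfl⟩; exact (l.equivFin.symm j).2,
        fun hy => ⟨l.equivFin ⟨y, hy⟩, by simp⟩⟩⟩
  obtain ⟨y, hy⟩ := hne
  rw [← hp] at hy
  have : Nonempty (Fin n) := ⟨hy.choose⟩
  rw [← hp]
  exact exists_isPotential_convexHull_range p

theorem exists_isPotential_segment (v : ι → ℝ) : ∃ φ G A, IsPotential (segment ℝ 0 v) φ G A := by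
  rw [← convexHull_pair]
  exact exists_isPotential_convexHull (Set.toFinite _) ⟨0, by simp⟩

theorem isCompact_segment {E : Type*} [AddCommGroup E] [Module ℝ E] [TopologicalSpace E]
    [ContinuousAdd E] [ContinuousSMul ℝ E] (x y : E) : IsCompact (segment ℝ x y) := by
  rw [segment_eq_image]
  exact isCompact_Icc.image (by fun_prop)

/-- The vertices `0, u, v, u + v` of a parallelogram. -/
def parallelogramVertex (u v : ι → ℝ) (k : Bool × Bool) : ι → ℝ :=
  (if k.1 then u else 0) + (if k.2 then v else 0)

/-- Weights that concentrate on the diagonal `0, u + v` of a parallelogram. -/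
noncomputable def diagonalWeight (r : ℝ) (k : Bool × Bool) : ℝ := if k.1 = k.2 then 1 else r

theorem range_parallelogramVertex (u v : ι → ℝ) :
    Set.range (parallelogramVertex u v) = {0, u} + {0, v} := by
  ext y
  simp only [Set.mem_range, Prod.exists, Bool.exists_bool, parallelogramVertex, Set.mem_add,
    Set.mem_insert_iff, Set.mem_singleton_iff]
  constructor
  · rintro ((rfl | rfl) | (rfl | rfl)) <;> simp
  · rintro ⟨a, rfl | rfl, b, rfl | rfl, rfl⟩ <;> simp

theorem image_parallelogramVertex_diagonal (u v : ι → ℝ) :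
    parallelogramVertex u v '' {k | 0 < diagonalWeight 0 k} = {0, u + v} := by
  ext y
  simp only [Set.mem_image, Prod.exists, Bool.exists_bool, parallelogramVertex, diagonalWeight,
    Set.mem_ofPred_eq, Set.mem_insert_iff, Set.mem_singleton_iff]
  simp [eq_comm]

/-- For every positive off-diagonal weight the body is the whole parallelogram; at weight `0` it
collapses to the diagonal (`isPotential_segment_diagonal`). -/
theorem isPotential_segment_add (u v : ι → ℝ) {r : ℝ} (hr : 0 < r) :
    IsPotential (segment ℝ 0 u + segment ℝ 0 v)
      (softPot (diagonalWeight r) (parallelogramVertex u v))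
      (softGrad (diagonalWeight r) (parallelogramVertex u v))
      (softHess (diagonalWeight r) (parallelogramVertex u v)) := by
  have hpos : ∀ k, 0 < diagonalWeight r k := by
    intro k
    rw [diagonalWeight]
    split_ifs
    exacts [one_pos, hr]
  have h := isPotential_softPot (parallelogramVertex u v) (fun k => (hpos k).le)
      ⟨(true, true), hpos _⟩
  have e : {k | 0 < diagonalWeight r k} = Set.univ := Set.eq_univ_of_forall hpos
  rwa [e, Set.image_univ, range_parallelogramVertex, convexHull_add, convexHull_pair,
    convexHull_pair] at h

theorem diagonalWeight_zero_nonneg (k : Bool × Bool) : 0 ≤ diagonalWeight 0 k := by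
  rw [diagonalWeight]; split_ifs <;> simp

theorem exists_diagonalWeight_zero_pos : ∃ k, 0 < diagonalWeight 0 k :=
  ⟨(true, true), by simp [diagonalWeight]⟩

theorem isPotential_segment_diagonal (u v : ι → ℝ) :
    IsPotential (segment ℝ 0 (u + v))
      (softPot (diagonalWeight 0) (parallelogramVertex u v))
      (softGrad (diagonalWeight 0) (parallelogramVertex u v))
      (softHess (diagonalWeight 0) (parallelogramVertex u v)) := by
  have h := isPotential_softPot (parallelogramVertex u v) diagonalWeight_zero_nonneg
    exists_diagonalWeight_zero_pos
  rwa [image_parallelogramVertex_diagonal, convexHull_pair] at h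

theorem tendsto_diagonalWeight :
    Filter.Tendsto (fun n : ℕ => diagonalWeight ((n : ℝ) + 1)⁻¹) Filter.atTop
      (nhds (diagonalWeight 0)) := by
  rw [tendsto_pi_nhds]
  rintro ⟨a, b⟩
  by_cases h : a = b
  · have e : ∀ r, diagonalWeight r (a, b) = 1 := fun r => if_pos h
    simp_rw [e]
    exact tendsto_const_nhds
  · have e : ∀ r, diagonalWeight r (a, b) = r := fun r => if_neg h
    simp_rw [e, ← one_div]
    exact tendsto_one_div_add_atTop_nhds_zero_nat

theorem tendsto_softHess_diagonalWeight (u v x : ι → ℝ) :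
    Filter.Tendsto (fun n : ℕ => softHess (diagonalWeight ((n : ℝ) + 1)⁻¹)
      (parallelogramVertex u v) x) Filter.atTop
      (nhds (softHess (diagonalWeight 0) (parallelogramVertex u v) x)) := by
  have h := (continuousAt_softHess (parallelogramVertex u v) diagonalWeight_zero_nonneg
    exists_diagonalWeight_zero_pos x).tendsto
  exact Filter.Tendsto.comp (f := fun n : ℕ => (diagonalWeight ((n : ℝ) + 1)⁻¹, x)) h
    (tendsto_diagonalWeight.prodMk_nhds tendsto_const_nhds)

/-- Mixed volumes are subadditive in the end point of a segment. -/
theorem polarVol_update_segment_le {K : ι → Set (ι → ℝ)} {φ : ι → (ι → ℝ) → ℝ}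
    {G : ι → (ι → ℝ) → ι → ℝ} {A : ι → (ι → ℝ) → Matrix ι ι ℝ} (hK : ∀ i, IsCompact (K i))
    (hc : ∀ i, Convex ℝ (K i)) (hP : ∀ i, IsPotential (K i) (φ i) (G i) (A i)) (i : ι)
    (u v : ι → ℝ) :
    polarVol (Function.update K i (segment ℝ 0 (u + v)))
      ≤ polarVol (Function.update K i (segment ℝ 0 u))
        + polarVol (Function.update K i (segment ℝ 0 v)) := by
  obtain ⟨φ₁, G₁, A₁, h₁⟩ := exists_isPotential_segment u
  obtain ⟨φ₂, G₂, A₂, h₂⟩ := exists_isPotential_segment v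
  rw [← polarVol_update_add hK hc hP i h₁ (isCompact_segment 0 u) (convex_segment 0 u) h₂
    (isCompact_segment 0 v) (convex_segment 0 v)]
  -- By additivity the right side is the mixed volume with the parallelogram, whose Hessians
  -- converge to those of its diagonal as the off-diagonal weight `1 / (n + 1)` tends to `0`.
  exact polarVol_update_le hK hc hP i (isPotential_segment_diagonal u v) (isCompact_segment _ _)
    (convex_segment _ _) (fun n => isPotential_segment_add u v (by positivity))
    ((isCompact_segment _ _).add (isCompact_segment _ _))
    ((convex_segment _ _).add (convex_segment _ _)) (tendsto_softHess_diagonalWeight u v)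

end Petty

namespace Petty

/-! ### Shadows -/

variable {n : ℕ}

/-- The projection of `ℝⁿ⁺¹` onto the last `n` coordinates that sends `(1, 0)` to `w`. -/
noncomputable def shadow (w : Fin n → ℝ) : (Fin (n + 1) → ℝ) →L[ℝ] (Fin n → ℝ) :=
  ContinuousLinearMap.pi fun i =>
    ContinuousLinearMap.proj i.succ + w i • ContinuousLinearMap.proj 0

theorem shadow_apply (w : Fin n → ℝ) (z : Fin (n + 1) → ℝ) (i : Fin n) :
    shadow w z i = z i.succ + w i * z 0 := by
  simp [shadow]

/-- The line over `x` in the kernel direction of `shadow w`. -/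
noncomputable def shadowLine (w x : Fin n → ℝ) (z : ℝ) : Fin (n + 1) → ℝ :=
  Fin.cons 0 x + z • Fin.cons 1 (-w)

theorem shadowLine_eq (w x : Fin n → ℝ) (z : ℝ) :
    shadowLine w x z = Fin.cons z (x - z • w) := by
  ext i
  refine Fin.cases ?_ (fun i => ?_) i
  · simp [shadowLine]
  · simp [shadowLine, sub_eq_add_neg]

theorem shadow_shadowLine (w x : Fin n → ℝ) (z : ℝ) : shadow w (shadowLine w x z) = x := by
  ext i
  simp [shadowLine_eq, shadow_apply]
  ring

theorem shadowLine_shadow (w : Fin n → ℝ) (y : Fin (n + 1) → ℝ) :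
    shadowLine w (shadow w y) (y 0) = y := by
  ext i
  refine Fin.cases ?_ (fun i => ?_) i
  · simp [shadowLine_eq]
  · simp [shadowLine_eq, shadow_apply]
    ring

/-- In the coordinates `(x, z)` this is a shear followed by a permutation of coordinates. -/
theorem measurePreserving_shadowLine (w : Fin n → ℝ) :
    MeasurePreserving (fun p : (Fin n → ℝ) × ℝ => shadowLine w p.1 p.2)
      (volume.prod volume) volume := by
  have h1 : MeasurePreserving (fun p : ℝ × (Fin n → ℝ) => (p.1, p.2 - p.1 • w))
      (volume.prod volume) (volume.prod volume) := by
    refine (MeasurePreserving.id volume).skew_product (g := fun z x => x - z • w)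
      (by fun_prop) (Filter.Eventually.of_forall fun z => ?_)
    exact (measurePreserving_sub_right volume (z • w)).map_eq
  have h2 := (volume_preserving_piFinSuccAbove (fun _ : Fin (n + 1) => ℝ) 0).symm
  have h3 := (h2.comp h1).comp (Measure.measurePreserving_swap
    (μ := (volume : Measure (Fin n → ℝ))) (ν := (volume : Measure ℝ)))
  have e : (fun p : (Fin n → ℝ) × ℝ => shadowLine w p.1 p.2)
      = ((MeasurableEquiv.piFinSuccAbove (fun _ : Fin (n + 1) => ℝ) 0).symm ∘
        fun p => (p.1, p.2 - p.1 • w)) ∘ Prod.swap := by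
    ext p : 1
    rw [shadowLine_eq]
    simp [MeasurableEquiv.piFinSuccAbove, Fin.insertNthEquiv]
  rw [e]
  exact h3

theorem volume_eq_lintegral_shadowLine (w : Fin n → ℝ) {K : Set (Fin (n + 1) → ℝ)}
    (hK : IsClosed K) : volume K = ∫⁻ x, volume {z | shadowLine w x z ∈ K} := by
  rw [← (measurePreserving_shadowLine w).measure_preimage hK.measurableSet.nullMeasurableSet,
    Measure.prod_apply ((measurePreserving_shadowLine w).measurable hK.measurableSet)]
  rfl

theorem exists_fiber_eq_Icc (w x : Fin n → ℝ) {K : Set (Fin (n + 1) → ℝ)} (hK : IsCompact K)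
    (hc : Convex ℝ K) (hx : x ∈ shadow w '' K) :
    ∃ p q : ℝ, p ≤ q ∧ {z | shadowLine w x z ∈ K} = Set.Icc p q := by
  have hcont : Continuous (shadowLine w x) := by unfold shadowLine; fun_prop
  have hcl : IsClosed {z | shadowLine w x z ∈ K} := hK.isClosed.preimage hcont
  have hsub : {z | shadowLine w x z ∈ K} ⊆ (fun y : Fin (n + 1) → ℝ => y 0) '' K :=
    fun z hz => ⟨_, hz, by simp [shadowLine_eq]⟩
  have hcomp : IsCompact {z | shadowLine w x z ∈ K} :=
    (hK.image (continuous_apply 0)).of_isClosed_subset hcl hsub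
  have hconv : Convex ℝ {z | shadowLine w x z ∈ K} := by
    have : shadowLine w x = AffineMap.lineMap (k := ℝ) (Fin.cons 0 x : Fin (n + 1) → ℝ)
        (Fin.cons 0 x + Fin.cons 1 (-w)) := by
      ext z : 1
      rw [AffineMap.lineMap_apply, shadowLine, vsub_eq_sub, vadd_eq_add, add_sub_cancel_left]
      exact add_comm _ _
    rw [this]
    exact hc.affine_preimage _
  have hne : {z | shadowLine w x z ∈ K}.Nonempty := by
    obtain ⟨y, hy, rfl⟩ := hx
    exact ⟨y 0, by rwa [Set.mem_ofPred_eq, shadowLine_shadow]⟩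
  have h := eq_Icc_of_connected_compact ⟨hne, hconv.isPreconnected⟩ hcomp
  refine ⟨_, _, ?_, h⟩
  rw [h] at hne
  exact Set.nonempty_Icc.1 hne

/-- The vector `Fin.cons 1 (-w)` spans the kernel of `shadow w`. Adding the segment lengthens every
nonempty fibre, an interval, by exactly `a`, and the nonempty fibres are those over the shadow. -/
theorem volume_add_segment (w : Fin n → ℝ) {a : ℝ} (ha : 0 ≤ a) {K : Set (Fin (n + 1) → ℝ)}
    (hK : IsCompact K) (hc : Convex ℝ K) :
    volume (K + segment ℝ 0 (a • (Fin.cons 1 (-w) : Fin (n + 1) → ℝ)))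
      = volume K + ENNReal.ofReal a * volume (shadow w '' K) := by
  have hKL := hK.add (isCompact_segment 0 (a • (Fin.cons 1 (-w) : Fin (n + 1) → ℝ)))
  have hsh : IsCompact (shadow w '' K) := hK.image (shadow w).continuous
  have hfib : ∀ x, {z | shadowLine w x z ∈
      K + segment ℝ 0 (a • (Fin.cons 1 (-w) : Fin (n + 1) → ℝ))}
        = {z | shadowLine w x z ∈ K} + Set.Icc 0 a := by
    intro x
    have hseg : segment ℝ 0 (a • (Fin.cons 1 (-w) : Fin (n + 1) → ℝ))
        = (fun t : ℝ => t • (Fin.cons 1 (-w) : Fin (n + 1) → ℝ)) '' Set.Icc 0 a := by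
      rw [segment_eq_image]
      ext y
      constructor
      · rintro ⟨θ, hθ, rfl⟩
        exact ⟨θ * a, ⟨mul_nonneg hθ.1 ha, mul_le_of_le_one_left ha hθ.2⟩, by simp [smul_smul]⟩
      · rintro ⟨t, ht, rfl⟩
        rcases ha.eq_or_lt with rfl | ha
        · have : t = 0 := le_antisymm ht.2 ht.1
          exact ⟨0, by simp, by simp [this]⟩
        · exact ⟨t / a, ⟨div_nonneg ht.1 ha.le, div_le_one_of_le₀ ht.2 ha.le⟩, by
            simp [smul_smul, div_mul_cancel₀ _ ha.ne']⟩
    ext z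
    rw [hseg, Set.mem_ofPred_eq, Set.mem_add, Set.mem_add]
    constructor
    · rintro ⟨y, hy, _, ⟨t, ht, rfl⟩, h⟩
      refine ⟨z - t, ?_, t, ht, by ring⟩
      have : shadowLine w x (z - t) = y := by
        rw [shadowLine, sub_smul, ← add_sub_assoc]
        exact (eq_sub_of_add_eq h).symm
      rwa [Set.mem_ofPred_eq, this]
    · rintro ⟨z', hz', t, ht, rfl⟩
      exact ⟨_, hz', _, ⟨t, ht, rfl⟩, by simp only [shadowLine, add_smul, add_assoc]⟩
  have hpt : ∀ x, volume ({z | shadowLine w x z ∈ K} + Set.Icc 0 a)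
      = volume {z | shadowLine w x z ∈ K}
        + (shadow w '' K).indicator (fun _ => ENNReal.ofReal a) x := by
    intro x
    by_cases hx : x ∈ shadow w '' K
    · obtain ⟨p, q, hpq, h⟩ := exists_fiber_eq_Icc w x hK hc hx
      rw [h, Set.Icc_add_Icc hpq ha, Real.volume_Icc, Real.volume_Icc, Set.indicator_of_mem hx,
        ← ENNReal.ofReal_add (by linarith) ha]
      congr 1
      ring
    · have : {z | shadowLine w x z ∈ K} = ∅ :=
        Set.eq_empty_of_forall_notMem fun z hz => hx ⟨_, hz, shadow_shadowLine w x z⟩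
      rw [this, Set.empty_add, Set.indicator_of_notMem hx]
      simp
  rw [volume_eq_lintegral_shadowLine w hKL.isClosed, volume_eq_lintegral_shadowLine w hK.isClosed]
  simp_rw [hfib, hpt]
  rw [lintegral_add_right _ (measurable_const.indicator hsh.measurableSet),
    lintegral_indicator_const hsh.measurableSet]

theorem volumeReal_add_segment (w : Fin n → ℝ) {a : ℝ} (ha : 0 ≤ a) {K : Set (Fin (n + 1) → ℝ)}
    (hK : IsCompact K) (hc : Convex ℝ K) :
    volume.real (K + segment ℝ 0 (a • (Fin.cons 1 (-w) : Fin (n + 1) → ℝ)))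
      = volume.real K + a * volume.real (shadow w '' K) := by
  rw [Measure.real, volume_add_segment w ha hK hc, ENNReal.toReal_add hK.measure_ne_top
    (ENNReal.mul_ne_top ENNReal.ofReal_ne_top (hK.image (shadow w).continuous).measure_ne_top),
    ENNReal.toReal_mul, ENNReal.toReal_ofReal ha]
  rfl

/-- Pairing the index sets with and without `0` leaves only the volume increments caused by `L`. -/
theorem polarVol_cons (L : Set (Fin (n + 1) → ℝ)) (K : Fin n → Set (Fin (n + 1) → ℝ)) :
    polarVol (Fin.cons L K : Fin (n + 1) → Set (Fin (n + 1) → ℝ))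
      = ∑ S : Finset (Fin n), (-1 : ℝ) ^ (n - S.card) *
          (volume.real (∑ i ∈ S, K i + L) - volume.real (∑ i ∈ S, K i)) := by
  classical
  have huniv : (Finset.univ : Finset (Finset (Fin (n + 1))))
      = (insert 0 (Finset.univ.map (Fin.succEmb n))).powerset := by
    rw [← Finset.powerset_univ, Fin.univ_succ, Finset.cons_eq_insert]
    rfl
  have h0 : (0 : Fin (n + 1)) ∉ Finset.univ.map (Fin.succEmb n) := by simp
  have hmap : (Finset.univ.map (Fin.succEmb n)).powerset
      = (Finset.univ : Finset (Finset (Fin n))).map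
        ⟨fun S => S.map (Fin.succEmb n), Finset.map_injective _⟩ := by
    ext T
    simp only [Finset.mem_powerset, Finset.mem_map, Finset.mem_univ, true_and,
      Function.Embedding.coeFn_mk]
    rw [Finset.subset_map_iff]
    simp [eq_comm]
  rw [polarVol, huniv, Finset.sum_powerset_insert h0, hmap, Finset.sum_map, Finset.sum_map,
    ← Finset.sum_add_distrib]
  refine Finset.sum_congr rfl fun S _ => ?_
  have h0S : (0 : Fin (n + 1)) ∉ S.map (Fin.succEmb n) := by simp
  have hS : S.card ≤ n := by simpa using S.card_le_univ
  simp only [Function.Embedding.coeFn_mk, Finset.card_insert_of_notMem h0S, Finset.card_map,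
    Finset.sum_insert h0S, Finset.sum_map, Fin.coe_succEmb, Fin.cons_succ, Fin.cons_zero,
    Fintype.card_fin, Nat.add_sub_add_right]
  rw [Nat.succ_sub hS, pow_succ, add_comm L]
  ring

/-- Each increment is `a` times the volume of a shadow, and shadows commute with Minkowski sums.
Thus mixed volumes with a segment are mixed volumes of projections. -/
theorem polarVol_cons_segment (w : Fin n → ℝ) {a : ℝ} (ha : 0 ≤ a)
    {K : Fin n → Set (Fin (n + 1) → ℝ)} (hK : ∀ i, IsCompact (K i)) (hc : ∀ i, Convex ℝ (K i)) :
    polarVol (Fin.cons (segment ℝ 0 (a • (Fin.cons 1 (-w) : Fin (n + 1) → ℝ))) K :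
      Fin (n + 1) → Set (Fin (n + 1) → ℝ)) = a * polarVol fun i => shadow w '' K i := by
  rw [polarVol_cons, polarVol, Finset.mul_sum]
  refine Finset.sum_congr rfl fun S _ => ?_
  rw [volumeReal_add_segment w ha (isCompact_finset_sum S hK) (convex_finset_sum S hc),
    Set.image_finsetSum, Fintype.card_fin]
  ring

end Petty

namespace Petty

/-! ### Approximation of convex bodies by polytopes from inside -/

/-- An increasing sequence of convex sets that exhausts a dense subset of the compact set `K`. -/
structure Exhausts {E : Type*} [AddCommGroup E] [Module ℝ E] [TopologicalSpace E]
    (U : ℕ → Set E) (K : Set E) : Prop where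
  monotone : Monotone U
  convex : ∀ j, Convex ℝ (U j)
  isCompact : IsCompact K
  subset : ∀ j, U j ⊆ K
  subset_closure : K ⊆ closure (⋃ j, U j)

namespace Exhausts

theorem image {E F : Type*} [AddCommGroup E] [Module ℝ E] [TopologicalSpace E]
    [AddCommGroup F] [Module ℝ F] [TopologicalSpace F] {U : ℕ → Set E} {K : Set E}
    (h : Exhausts U K) (T : E →L[ℝ] F) : Exhausts (fun j => T '' U j) (T '' K) where
  monotone _ _ hij := Set.image_mono (h.monotone hij)
  convex j := (h.convex j).linear_image T.toLinearMap
  isCompact := h.isCompact.image T.continuous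
  subset j := Set.image_mono (h.subset j)
  subset_closure := by
    rw [← Set.image_iUnion]
    exact (Set.image_mono h.subset_closure).trans (image_closure_subset_closure_image T.continuous)

variable {E : Type*} [AddCommGroup E] [Module ℝ E] [TopologicalSpace E] [ContinuousAdd E]

theorem add {U U' : ℕ → Set E} {K K' : Set E} (h : Exhausts U K) (h' : Exhausts U' K') :
    Exhausts (U + U') (K + K') where
  monotone _ _ hij := Set.add_subset_add (h.monotone hij) (h'.monotone hij)
  convex j := (h.convex j).add (h'.convex j)
  isCompact := h.isCompact.add h'.isCompact
  subset j := Set.add_subset_add (h.subset j) (h'.subset j)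
  subset_closure := by
    rintro _ ⟨x, hx, y, hy, rfl⟩
    refine map_mem_closure₂ continuous_add (h.subset_closure hx) (h'.subset_closure hy) ?_
    intro a ha b hb
    obtain ⟨i, hi⟩ := Set.mem_iUnion.1 ha
    obtain ⟨j, hj⟩ := Set.mem_iUnion.1 hb
    exact Set.mem_iUnion.2 ⟨max i j, Set.add_mem_add (h.monotone (le_max_left i j) hi)
      (h'.monotone (le_max_right i j) hj)⟩

theorem zero : Exhausts (0 : ℕ → Set E) 0 where
  monotone _ _ _ := le_rfl
  convex _ := convex_singleton (0 : E)
  isCompact := isCompact_singleton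
  subset _ := subset_rfl
  subset_closure := (Set.subset_iUnion (fun _ : ℕ => (0 : Set E)) 0).trans _root_.subset_closure

theorem sum {α : Type*} (S : Finset α) {U : α → ℕ → Set E} {K : α → Set E}
    (h : ∀ a, Exhausts (U a) (K a)) : Exhausts (fun j => ∑ a ∈ S, U a j) (∑ a ∈ S, K a) := by
  classical
  have h' : Exhausts (∑ a ∈ S, U a) (∑ a ∈ S, K a) := by
    induction S using Finset.induction_on with
    | empty => exact zero
    | insert a S ha ih =>
      rw [Finset.sum_insert ha, Finset.sum_insert ha]
      exact (h a).add ih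
  convert h' using 1
  ext1 j
  rw [Finset.sum_apply]

/-- The union of the sequence is convex with closure `K`, and the frontier of a convex set is null;
continuity of measure from below does the rest. -/
theorem tendsto_volumeReal {ι : Type*} [Fintype ι] {U : ℕ → Set (ι → ℝ)} {K : Set (ι → ℝ)}
    (h : Exhausts U K) :
    Filter.Tendsto (fun j => volume.real (U j)) Filter.atTop (nhds (volume.real K)) := by
  have hconv : Convex ℝ (⋃ j, U j) :=
    Directed.convex_iUnion h.monotone.directed_le fun {j} => h.convex j
  have hcl : closure (⋃ j, U j) = K :=
    (closure_minimal (Set.iUnion_subset h.subset) h.isCompact.isClosed).antisymm h.subset_closure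
  have hvol : volume K = volume (⋃ j, U j) := by
    refine le_antisymm ?_ (measure_mono (Set.iUnion_subset h.subset))
    calc volume K = volume ((⋃ j, U j) ∪ frontier (⋃ j, U j)) := by
          rw [← closure_eq_self_union_frontier, hcl]
      _ ≤ volume (⋃ j, U j) + volume (frontier (⋃ j, U j)) := measure_union_le _ _
      _ = volume (⋃ j, U j) := by rw [hconv.addHaar_frontier volume, add_zero]
  have ht := tendsto_measure_iUnion_atTop (μ := volume) h.monotone
  rw [← hvol] at ht
  exact (ENNReal.tendsto_toReal h.isCompact.measure_ne_top).comp ht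

end Exhausts

theorem exists_exhausts_polytope {ι : Type*} [Fintype ι] {K : Set (ι → ℝ)} (hK : IsCompact K)
    (hc : Convex ℝ K) (hne : K.Nonempty) :
    ∃ U : ℕ → Set (ι → ℝ), Exhausts U K ∧
      ∀ j, ∃ s : Set (ι → ℝ), s.Finite ∧ s.Nonempty ∧ U j = convexHull ℝ s := by
  have := hne.to_subtype
  obtain ⟨p, hp⟩ := TopologicalSpace.exists_dense_seq K
  have hfin : ∀ j, ((fun k => (p k : ι → ℝ)) '' Set.Iic j).Finite :=
    fun j => (Set.finite_Iic j).image _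
  refine ⟨fun j => convexHull ℝ ((fun k => (p k : ι → ℝ)) '' Set.Iic j), ⟨?_, ?_, hK, ?_, ?_⟩,
    fun j => ⟨_, hfin j, ⟨_, ⟨j, Set.mem_Iic.2 le_rfl, rfl⟩⟩, rfl⟩⟩
  · exact fun i j hij => convexHull_mono (Set.image_mono (Set.Iic_subset_Iic.2 hij))
  · exact fun j => convex_convexHull ℝ _
  · exact fun j => convexHull_min (by rintro _ ⟨k, _, rfl⟩; exact (p k).2) hc
  · intro x hx
    have h1 : (⟨x, hx⟩ : K) ∈ closure (Set.range p) := hp _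
    have h2 := image_closure_subset_closure_image continuous_subtype_val ⟨_, h1, rfl⟩
    refine closure_mono ?_ h2
    rintro _ ⟨_, ⟨k, rfl⟩, rfl⟩
    exact Set.mem_iUnion.2 ⟨k, subset_convexHull _ _ ⟨k, Set.mem_Iic.2 le_rfl, rfl⟩⟩

/-! ### Convexity of mixed volumes of shadows -/

variable {n : ℕ}

/-- The kernel vector `(1, -w)` is affine in `w`, so the kernel vector of the combined shadow is the
combination of the two kernel vectors. Subadditivity in the end point of the segment upstairs
becomes convexity downstairs. -/
theorem polarVol_shadow_le_of_isPotential {K : Fin n → Set (Fin (n + 1) → ℝ)}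
    (hK : ∀ i, IsCompact (K i)) (hc : ∀ i, Convex ℝ (K i))
    (hP : ∀ i, ∃ φ G A, IsPotential (K i) φ G A) (u v : Fin n → ℝ) {a b : ℝ} (ha : 0 ≤ a)
    (hb : 0 ≤ b) (hab : a + b = 1) :
    polarVol (fun i => shadow (a • u + b • v) '' K i)
      ≤ a * polarVol (fun i => shadow u '' K i) + b * polarVol (fun i => shadow v '' K i) := by
  have hP' : ∀ i, ∃ φ G A, IsPotential
      ((Fin.cons (segment ℝ 0 0) K : Fin (n + 1) → Set (Fin (n + 1) → ℝ)) i) φ G A :=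
    Fin.cases (exists_isPotential_segment 0) hP
  choose φ G A h using hP'
  have hsub := polarVol_update_segment_le
    (K := (Fin.cons (segment ℝ 0 0) K : Fin (n + 1) → Set (Fin (n + 1) → ℝ)))
    (Fin.cases (isCompact_segment _ _) hK) (Fin.cases (convex_segment _ _) hc) h 0
    (a • (Fin.cons 1 (-u) : Fin (n + 1) → ℝ)) (b • (Fin.cons 1 (-v) : Fin (n + 1) → ℝ))
  have e : a • (Fin.cons 1 (-u) : Fin (n + 1) → ℝ) + b • (Fin.cons 1 (-v) : Fin (n + 1) → ℝ)
      = (1 : ℝ) • (Fin.cons 1 (-(a • u + b • v)) : Fin (n + 1) → ℝ) := by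
    ext i
    refine Fin.cases ?_ (fun i => ?_) i
    · simp [hab]
    · simp; ring
  rw [e, Fin.update_cons_zero, Fin.update_cons_zero, Fin.update_cons_zero,
    polarVol_cons_segment _ zero_le_one hK hc, polarVol_cons_segment _ ha hK hc,
    polarVol_cons_segment _ hb hK hc, one_mul] at hsub
  exact hsub

/-- Mixed volumes of shadows are convex functions of the direction of projection. -/
theorem polarVol_shadow_le {K : Fin n → Set (Fin (n + 1) → ℝ)}
    (hK : ∀ i, IsCompact (K i)) (hc : ∀ i, Convex ℝ (K i)) (hne : ∀ i, (K i).Nonempty)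
    (u v : Fin n → ℝ) {a b : ℝ} (ha : 0 ≤ a) (hb : 0 ≤ b) (hab : a + b = 1) :
    polarVol (fun i => shadow (a • u + b • v) '' K i)
      ≤ a * polarVol (fun i => shadow u '' K i) + b * polarVol (fun i => shadow v '' K i) := by
  choose U hU hs using fun i => exists_exhausts_polytope (hK i) (hc i) (hne i)
  have hlim : ∀ w : Fin n → ℝ, Filter.Tendsto (fun j => polarVol fun i => shadow w '' U i j)
      Filter.atTop (nhds (polarVol fun i => shadow w '' K i)) := fun w =>
    tendsto_finsetSum _ fun S _ =>
      (Exhausts.sum S fun i => (hU i).image (shadow w)).tendsto_volumeReal.const_mul _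
  refine le_of_tendsto_of_tendsto' (hlim _) (((hlim u).const_mul a).add ((hlim v).const_mul b))
    fun j => ?_
  refine polarVol_shadow_le_of_isPotential (fun i => ?_) (fun i => (hU i).convex j) (fun i => ?_)
    u v ha hb hab
  · obtain ⟨s, hs, -, e⟩ := hs i j
    rw [e]
    exact hs.isCompact_convexHull ℝ
  · obtain ⟨s, hs, hne, e⟩ := hs i j
    rw [e]
    exact exists_isPotential_convexHull hs hne

end Petty

namespace Petty

/-! ### Mixed volumes of linear images of fixed bodies -/

variable {n : ℕ} {κ : Type*} [Fintype κ]

theorem volumeReal_image_equiv {α β : Type*} [MeasureSpace α] [MeasureSpace β] (e : α ≃ᵐ β)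
    (he : MeasurePreserving e) (A : Set α) : volume.real (e '' A) = volume.real A := by
  rw [Measure.real, Measure.real, ← he.measure_preimage_equiv, Set.preimage_image_eq _ e.injective]

theorem mixedVolume_eq_polarVol (K : Fin n → Set (EuclideanSpace ℝ (Fin n))) :
    mixedVolume K = (n.factorial : ℝ)⁻¹ *
      polarVol fun i => EuclideanSpace.equiv (Fin n) ℝ '' K i := by
  rw [mixedVolume, polarVol]
  congr 1
  refine Finset.sum_congr rfl fun S _ => ?_
  rw [← Set.image_finsetSum, Fintype.card_fin]
  congr 1
  exact (volumeReal_image_equiv (MeasurableEquiv.toLp 2 (Fin n → ℝ)).symm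
    (EuclideanSpace.volume_preserving_symm_measurableEquiv_toLp (Fin n)) _).symm

theorem mixedVolume_isometry (g : EuclideanSpace ℝ (Fin n) ≃ₗᵢ[ℝ] EuclideanSpace ℝ (Fin n))
    (K : Fin n → Set (EuclideanSpace ℝ (Fin n))) :
    mixedVolume (fun i => g '' K i) = mixedVolume K := by
  rw [mixedVolume, mixedVolume]
  congr 1
  refine Finset.sum_congr rfl fun S _ => ?_
  rw [← Set.image_finsetSum]
  congr 1
  exact volumeReal_image_equiv g.toMeasurableEquiv g.measurePreserving _

theorem matImage_eq_image (X : κ → EuclideanSpace ℝ (Fin n)) (D : Set (κ → ℝ)) :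
    matImage X D = Fintype.linearCombination ℝ X '' D := rfl

theorem matImage_isometry (g : EuclideanSpace ℝ (Fin n) ≃ₗᵢ[ℝ] EuclideanSpace ℝ (Fin n))
    (X : κ → EuclideanSpace ℝ (Fin n)) (D : Set (κ → ℝ)) :
    matImage (fun k => g (X k)) D = g '' matImage X D := by
  rw [matImage, matImage, Set.image_image]
  refine Set.image_congr fun c _ => ?_
  simp

/-- Projection along the compact set `D` is a closed map. Closedness of the graph yields
measurability of the volumes in the columns. -/
theorem isClosed_graph_matImage {D : Set (κ → ℝ)} (hD : IsCompact D) :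
    IsClosed {q : (κ → EuclideanSpace ℝ (Fin n)) × EuclideanSpace ℝ (Fin n) |
      q.2 ∈ matImage q.1 D} := by
  have := isCompact_iff_compactSpace.1 hD
  have h : IsClosed {r : D × (κ → EuclideanSpace ℝ (Fin n)) × EuclideanSpace ℝ (Fin n) |
      ∑ k, (r.1 : κ → ℝ) k • r.2.1 k = r.2.2} :=
    isClosed_eq (continuous_finsetSum _ fun k _ =>
      ((continuous_apply k).comp (continuous_subtype_val.comp continuous_fst)).smul
        ((continuous_apply k).comp (continuous_fst.comp continuous_snd))) (by fun_prop)
  convert isClosedMap_snd_of_compactSpace _ h using 1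
  ext ⟨X, p⟩
  simp [matImage]

theorem measurable_volumeReal_matImage {D : Set (κ → ℝ)} (hD : IsCompact D) :
    Measurable fun X : κ → EuclideanSpace ℝ (Fin n) => volume.real (matImage X D) :=
  (measurable_measure_prodMk_left (isClosed_graph_matImage hD).measurableSet).ennreal_toReal

theorem measurable_mixedVolume_matImage {D : Fin n → Set (κ → ℝ)} (hD : ∀ i, IsCompact (D i)) :
    Measurable fun X : κ → EuclideanSpace ℝ (Fin n) => mixedVolume fun i => matImage X (D i) := by
  refine (Finset.measurable_fun_sum _ fun S _ => ?_).const_mul _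
  simp_rw [matImage_eq_image, ← Set.image_finsetSum]
  exact (measurable_volumeReal_matImage (isCompact_finset_sum S hD)).const_mul _

/-- A shadow system: coefficients `c` are lifted to the pair of the velocity `∑ cₖ (tₖ - sₖ)` and
the initial position `∑ cₖ (Yₖ + sₖ e)`. Position at time `r` is the shadow of this fixed lift along
`w r = r e`, so convexity in the columns is convexity in the direction of projection. -/
theorem mixedVolume_line_le {d : ℕ} {D : Fin (d + 1) → Set (κ → ℝ)} (hD : ∀ i, IsCompact (D i))
    (hDc : ∀ i, Convex ℝ (D i)) (hDne : ∀ i, (D i).Nonempty)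
    (Y : κ → EuclideanSpace ℝ (Fin (d + 1))) (e : EuclideanSpace ℝ (Fin (d + 1)))
    (s t : κ → ℝ) {a b : ℝ} (ha : 0 ≤ a) (hb : 0 ≤ b) (hab : a + b = 1) :
    mixedVolume (fun i => matImage (fun k => Y k + (a • s + b • t) k • e) (D i))
      ≤ a * mixedVolume (fun i => matImage (fun k => Y k + s k • e) (D i))
        + b * mixedVolume (fun i => matImage (fun k => Y k + t k • e) (D i)) := by
  set T : (κ → ℝ) →ₗ[ℝ] (Fin (d + 1 + 1) → ℝ) := LinearMap.pi (Fin.cons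
    (Fintype.linearCombination ℝ fun k => t k - s k)
    fun i => (LinearMap.proj i ∘ₗ (EuclideanSpace.equiv (Fin (d + 1)) ℝ).toLinearMap) ∘ₗ
      Fintype.linearCombination ℝ fun k => Y k + s k • e) with hT
  set w : ℝ → Fin (d + 1) → ℝ := fun r => r • EuclideanSpace.equiv (Fin (d + 1)) ℝ e with hw
  have key : ∀ (r : ℝ) (D : Set (κ → ℝ)), EuclideanSpace.equiv (Fin (d + 1)) ℝ ''
      matImage (fun k => Y k + (s k + r * (t k - s k)) • e) D = shadow (w r) '' (T '' D) := by
    intro r D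
    rw [matImage, Set.image_image, Set.image_image]
    refine Set.image_congr fun c _ => ?_
    ext i
    rw [shadow_apply]
    simp only [hT, hw, LinearMap.pi_apply, Fin.cons_succ, Fin.cons_zero, LinearMap.comp_apply,
      LinearMap.proj_apply, Fintype.linearCombination_apply, map_sum, Finset.sum_apply,
      Pi.smul_apply, smul_eq_mul, Finset.mul_sum, map_smul, map_add, Pi.add_apply,
      ContinuousLinearEquiv.coe_toLinearEquiv, LinearEquiv.coe_coe]
    rw [← Finset.sum_add_distrib]
    exact Finset.sum_congr rfl fun k _ => by ring
  have hlin : ∀ p q : ℝ, w (p * 0 + q * 1) = p • w 0 + q • w 1 := by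
    intro p q; simp [hw]
  have h := polarVol_shadow_le (K := fun i => T '' D i)
    (fun i => (hD i).image T.continuous_of_finiteDimensional) (fun i => (hDc i).linear_image T)
    (fun i => (hDne i).image _) (w 0) (w 1) ha hb hab
  rw [← hlin] at h
  simp only [← key] at h
  have e0 : ∀ k, s k + 0 * (t k - s k) = s k := fun k => by ring
  have e1 : ∀ k, s k + 1 * (t k - s k) = t k := fun k => by ring
  have e2 : ∀ k, s k + (a * 0 + b * 1) * (t k - s k) = (a • s + b • t) k := fun k => by
    obtain rfl : a = 1 - b := by linarith
    simp; ring
  simp only [e0, e1, e2] at h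
  simp only [mixedVolume_eq_polarVol]
  have hf : (0 : ℝ) ≤ ((d + 1).factorial : ℝ)⁻¹ := by positivity
  nlinarith [mul_le_mul_of_nonneg_left h hf]

theorem isSteinerConvex_mixedVolume_le {d : ℕ} {D : Fin (d + 1) → Set (κ → ℝ)}
    (hD : ∀ i, IsCompact (D i)) (hDc : ∀ i, Convex ℝ (D i)) (hDne : ∀ i, (D i).Nonempty) {c : ℝ}
    (hc : 0 ≤ c) :
    IsSteinerConvex {X : κ → EuclideanSpace ℝ (Fin (d + 1)) |
      c * mixedVolume (fun i => matImage X (D i)) ≤ 1} where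
  measurableSet := measurableSet_le ((measurable_mixedVolume_matImage hD).const_mul c)
    measurable_const
  isometry_mem g X hX := by
    simpa only [Set.mem_ofPred_eq, matImage_isometry, mixedVolume_isometry] using hX
  convex Y s hs t ht a b ha hb hab := by
    have h := mul_le_mul_of_nonneg_left (mixedVolume_line_le hD hDc hDne Y
      (EuclideanSpace.single 0 1) s t ha hb hab) hc
    have h1 := mul_le_mul_of_nonneg_left hs ha
    have h2 := mul_le_mul_of_nonneg_left ht hb
    rw [Set.mem_ofPred_eq, Set.mem_ofPred_eq]
    linarith

end Petty

namespace Petty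

/-! ### The mixed projection body as a function of the columns -/

section Columns

variable {σ : Type*} [Fintype σ] {d : ℕ}

/-- Extension of a vector of coefficients by `0` at `none`. -/
def extendZero (σ : Type*) : (σ → ℝ) →ₗ[ℝ] (Option σ → ℝ) where
  toFun c k := k.elim 0 c
  map_add' c c' := by ext k; cases k <;> simp
  map_smul' r c := by ext k; cases k <;> simp

/-- Coefficient bodies: those of the columns, and one segment for the direction. -/
def coeffBody (C : Fin d → Set (σ → ℝ)) : Fin (d + 1) → Set (Option σ → ℝ) :=
  Fin.snoc (α := fun _ => Set (Option σ → ℝ)) (fun i => extendZero σ '' C i)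
    (segment ℝ 0 fun k => k.elim 1 0)

theorem coeffBody_induction {p : Set (Option σ → ℝ) → Prop} {C : Fin d → Set (σ → ℝ)}
    (h : ∀ i, p (extendZero σ '' C i)) (h' : ∀ u, p (segment ℝ 0 u)) (i : Fin (d + 1)) :
    p (coeffBody C i) := by
  refine Fin.lastCases ?_ (fun i => ?_) i
  · simpa [coeffBody] using h' _
  · simpa [coeffBody] using h i

/-- The direction `X none` is treated as another column: its segment is the image of the segment
from `0` to the unit vector at `none`. All arguments of the mixed volume are then images of fixed
bodies under one matrix. -/
theorem matImage_coeffBody (C : Fin d → Set (σ → ℝ))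
    (X : Option σ → EuclideanSpace ℝ (Fin (d + 1))) :
    (fun i => matImage X (coeffBody C i))
      = Fin.snoc (α := fun _ => Set (EuclideanSpace ℝ (Fin (d + 1))))
        (fun i => matImage (fun k => X (some k)) (C i)) (segment ℝ 0 (X none)) := by
  ext1 i
  refine Fin.lastCases ?_ (fun i => ?_) i
  · rw [coeffBody, Fin.snoc_last, Fin.snoc_last, matImage_eq_image, ← LinearMap.coe_toAffineMap,
      image_segment]
    simp [Fintype.linearCombination_apply, Fintype.sum_option]
  · rw [coeffBody, Fin.snoc_castSucc, Fin.snoc_castSucc, matImage, matImage, Set.image_image]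
    refine Set.image_congr fun c _ => ?_
    simp [Fintype.sum_option, extendZero]

theorem isSteinerConvex_mixedProjSupport_le {C : Fin d → Set (σ → ℝ)}
    (hC : ∀ i, IsCompact (C i)) (hCc : ∀ i, Convex ℝ (C i)) (hCne : ∀ i, (C i).Nonempty) :
    IsSteinerConvex {X : Option σ → EuclideanSpace ℝ (Fin (d + 1)) |
      mixedProjSupport (fun i => matImage (fun k => X (some k)) (C i)) (X none) ≤ 1} := by
  have h := isSteinerConvex_mixedVolume_le (D := coeffBody C) (c := ((d + 1 : ℕ) : ℝ))
    (coeffBody_induction (fun i => (hC i).image (extendZero σ).continuous_of_finiteDimensional)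
      fun u => isCompact_segment 0 u)
    (coeffBody_induction (fun i => (hCc i).linear_image _) fun u => convex_segment 0 u)
    (coeffBody_induction (fun i => (hCne i).image _) fun u => ⟨0, left_mem_segment ℝ 0 u⟩)
    (Nat.cast_nonneg _)
  simp only [matImage_coeffBody] at h
  exact h

end Columns

/-! ### Random columns with densities -/

theorem lintegral_pi_prod_eq_prod {α : Type*} [MeasurableSpace α] (μ : Measure α) [SigmaFinite μ]
    {σ : Type*} [Fintype σ] {f : σ → α → ℝ≥0∞} (hf : ∀ i, Measurable (f i)) :
    ∫⁻ x : σ → α, ∏ i, f i (x i) ∂(Measure.pi fun _ => μ) = ∏ i, ∫⁻ x, f i x ∂μ := by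
  refine Fintype.induction_empty_option (P := fun σ _ => ∀ f : σ → α → ℝ≥0∞,
    (∀ i, Measurable (f i)) → ∫⁻ x : σ → α, ∏ i, f i (x i) ∂(Measure.pi fun _ => μ)
      = ∏ i, ∫⁻ x, f i x ∂μ) ?_ ?_ ?_ σ f hf
  · intro σ τ _ e ih f hf
    let _ := Fintype.ofEquiv τ e.symm
    have hp := measurePreserving_piCongrLeft (fun _ : τ => μ) e
    rw [← hp.lintegral_comp_emb (MeasurableEquiv.measurableEmbedding _), ← e.prod_comp,
      ← ih _ fun i => hf (e i)]
    refine lintegral_congr fun x => ?_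
    rw [← e.prod_comp]
    refine Finset.prod_congr rfl fun i _ => ?_
    rw [MeasurableEquiv.piCongrLeft_apply_apply]
  · intro f hf
    simp
  · intro σ _ ih f hf
    have hp : MeasurePreserving (MeasurableEquiv.piOptionEquivProd fun _ : Option σ => α).symm
        ((Measure.pi fun _ => μ).prod μ) (Measure.pi fun _ => μ) :=
      ⟨MeasurableEquiv.measurable _, Measure.pi_map_piOptionEquivProd fun _ => μ⟩
    have hm : Measurable fun x : σ → α => ∏ i, f (some i) (x i) :=
      Finset.measurable_fun_prod _ fun i _ => (hf (some i)).comp (measurable_pi_apply i)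
    rw [← hp.lintegral_comp_emb (MeasurableEquiv.measurableEmbedding _), Fintype.prod_option,
      ← ih _ fun i => hf (some i), mul_comm,
      ← lintegral_prod_mul hm.aemeasurable (hf none).aemeasurable]
    refine lintegral_congr fun q => ?_
    rw [Fintype.prod_option, mul_comm]
    rfl

theorem pi_withDensity {σ α : Type*} [Fintype σ] [MeasurableSpace α] (μ : Measure α) [SigmaFinite μ]
    {f : σ → α → ℝ≥0∞} (hf : ∀ i, Measurable (f i)) [∀ i, SigmaFinite (μ.withDensity (f i))] :
    Measure.pi (fun i => μ.withDensity (f i))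
      = (Measure.pi fun _ => μ).withDensity fun x => ∏ i, f i (x i) := by
  refine (Measure.pi_eq fun s hs => ?_)
  have e : ∀ x : σ → α, (Set.univ.pi s).indicator (fun x => ∏ i, f i (x i)) x
      = ∏ i, (s i).indicator (f i) (x i) := by
    intro x
    by_cases hx : ∀ i, x i ∈ s i
    · rw [Set.indicator_of_mem (by simpa using hx)]
      exact Finset.prod_congr rfl fun i _ => (Set.indicator_of_mem (hx i) _).symm
    · rw [Set.indicator_of_notMem (by simpa using hx)]
      push Not at hx
      obtain ⟨i, hi⟩ := hx
      exact (Finset.prod_eq_zero (Finset.mem_univ i) (Set.indicator_of_notMem hi _)).symm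
  rw [withDensity_apply _ (MeasurableSet.univ_pi hs),
    ← lintegral_indicator (MeasurableSet.univ_pi hs)]
  simp_rw [e]
  rw [lintegral_pi_prod_eq_prod μ fun i => (hf i).indicator (hs i)]
  refine Finset.prod_congr rfl fun i _ => ?_
  rw [lintegral_indicator (hs i), withDensity_apply _ (hs i)]

/-- Independence makes the joint law a product density; Tonelli then merges the random columns and
the variable `θ` of the radial measure into one integral over `G`. -/
theorem lintegral_radialMeasure_section {n : ℕ} {σ : Type*} [Fintype σ]
    {f : σ → EuclideanSpace ℝ (Fin n) → ℝ≥0∞} (hf : ∀ k, Measurable (f k))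
    {Ω : Type*} [MeasurableSpace Ω] (P : Measure Ω) [IsProbabilityMeasure P]
    {X : σ → Ω → EuclideanSpace ℝ (Fin n)} (hX : ∀ k, AEMeasurable (X k) P)
    (hind : iIndepFun X P) (hlaw : ∀ k, P.map (X k) = volume.withDensity (f k))
    {ρ : ℝ≥0 → ℝ≥0∞} (hρ : Measurable ρ) {G : Set (Option σ → EuclideanSpace ℝ (Fin n))}
    (hG : MeasurableSet G) :
    ∫⁻ ω, radialMeasure n ρ {θ | (fun k : Option σ => k.elim θ fun k => X k ω) ∈ G} ∂P
      = ∫⁻ Z in G, ρ ‖Z none‖₊ * ∏ k, f k (Z (some k)) := by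
  set e := MeasurableEquiv.piOptionEquivProd (fun _ : Option σ => EuclideanSpace ℝ (Fin n)) with he
  have hes : ∀ x θ, e.symm (x, θ) = fun k : Option σ => k.elim θ x := by
    intro x θ
    ext1 k
    cases k <;> rfl
  have hpres : MeasurePreserving e.symm (volume.prod volume) volume :=
    ⟨e.symm.measurable, Measure.pi_map_piOptionEquivProd fun _ => volume⟩
  have hprob : ∀ k, IsProbabilityMeasure (volume.withDensity (f k)) :=
    fun k => hlaw k ▸ Measure.isProbabilityMeasure_map (hX k)
  have hmap : P.map (fun ω k => X k ω)
      = volume.withDensity fun x : σ → EuclideanSpace ℝ (Fin n) => ∏ k, f k (x k) := by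
    rw [(iIndepFun_iff_map_fun_eq_pi_map hX).1 hind]
    simp_rw [hlaw]
    exact pi_withDensity volume hf
  set F : (σ → EuclideanSpace ℝ (Fin n)) × EuclideanSpace ℝ (Fin n) → ℝ≥0∞ :=
    fun q => (e.symm ⁻¹' G).indicator (fun q => ρ ‖q.2‖₊) q with hF
  have hFm : Measurable F :=
    (hρ.comp measurable_snd.nnnorm).indicator (e.symm.measurable hG)
  have hsec : ∀ x : σ → EuclideanSpace ℝ (Fin n),
      radialMeasure n ρ {θ | (fun k : Option σ => k.elim θ x) ∈ G} = ∫⁻ θ, F (x, θ) := by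
    intro x
    have hm : MeasurableSet {θ | (fun k : Option σ => k.elim θ x) ∈ G} := by
      simp_rw [← hes]
      exact measurable_prodMk_left (e.symm.measurable hG)
    rw [radialMeasure, withDensity_apply _ hm, ← lintegral_indicator hm]
    refine lintegral_congr fun θ => ?_
    have hiff : θ ∈ {θ | (fun k : Option σ => k.elim θ x) ∈ G} ↔ (x, θ) ∈ e.symm ⁻¹' G := by
      rw [Set.mem_preimage, hes, Set.mem_ofPred_eq]
    classical exact if_congr hiff rfl rfl
  have hpm : Measurable fun x : σ → EuclideanSpace ℝ (Fin n) => ∏ k, f k (x k) :=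
    Finset.measurable_fun_prod _ fun k _ => (hf k).comp (measurable_pi_apply k)
  calc _ = ∫⁻ ω, (fun x => ∫⁻ θ, F (x, θ)) (fun k => X k ω) ∂P :=
        lintegral_congr fun ω => hsec _
    _ = ∫⁻ x, (∫⁻ θ, F (x, θ)) ∂(P.map fun ω k => X k ω) :=
        (lintegral_map' hFm.lintegral_prod_right'.aemeasurable (aemeasurable_pi_lambda _ hX)).symm
    _ = ∫⁻ x : σ → EuclideanSpace ℝ (Fin n), ∫⁻ θ, (∏ k, f k (x k)) * F (x, θ) := by
        rw [hmap, lintegral_withDensity_eq_lintegral_mul _ hpm hFm.lintegral_prod_right']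
        refine lintegral_congr fun x => ?_
        exact (lintegral_const_mul _ (hFm.comp measurable_prodMk_left)).symm
    _ = ∫⁻ q : (σ → EuclideanSpace ℝ (Fin n)) × EuclideanSpace ℝ (Fin n),
          (∏ k, f k (q.1 k)) * F q ∂(volume.prod volume) :=
        (lintegral_prod _ ((hpm.comp measurable_fst).mul hFm).aemeasurable).symm
    _ = ∫⁻ q, (G.indicator fun Z => ρ ‖Z none‖₊ * ∏ k, f k (Z (some k))) (e.symm q)
          ∂(volume.prod volume) := by
        refine lintegral_congr fun q => ?_
        by_cases hq : e.symm q ∈ G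
        · simp only [hF, Set.indicator_of_mem hq, Set.indicator_of_mem (Set.mem_preimage.2 hq)]
          exact mul_comm _ _
        · simp only [hF, Set.indicator_of_notMem hq,
            Set.indicator_of_notMem (fun h => hq (Set.mem_preimage.1 h)), mul_zero]
    _ = _ := by
        rw [hpres.lintegral_comp_emb e.symm.measurableEmbedding, lintegral_indicator hG]

end Petty

theorem theorem1p1 {d : ℕ} (m : Fin d → ℕ)
    (C : Fin d → Set ((Σ i : Fin d, Fin (m i)) → ℝ))
    (hCne : ∀ i, (C i).Nonempty) (hCcomp : ∀ i, IsCompact (C i))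
    (hCconv : ∀ i, Convex ℝ (C i))
    (f : (i : Fin d) → Fin (m i) → EuclideanSpace ℝ (Fin (d + 1)) → ℝ≥0∞)
    (hf : ∀ i j, Measurable (f i j))
    {Ω Ω' : Type*} [MeasurableSpace Ω] [MeasurableSpace Ω']
    (P : Measure Ω) [IsProbabilityMeasure P] (P' : Measure Ω') [IsProbabilityMeasure P']
    (X : (i : Fin d) → Fin (m i) → Ω → EuclideanSpace ℝ (Fin (d + 1)))
    (hXmeas : ∀ i j, AEMeasurable (X i j) P)
    (hXindep : iIndepFun (fun k : Σ i : Fin d, Fin (m i) => X k.1 k.2) P)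
    (hXlaw : ∀ i j, P.map (X i j) = volume.withDensity (f i j))
    (Y : (i : Fin d) → Fin (m i) → Ω' → EuclideanSpace ℝ (Fin (d + 1)))
    (hYmeas : ∀ i j, AEMeasurable (Y i j) P')
    (hYindep : iIndepFun (fun k : Σ i : Fin d, Fin (m i) => Y k.1 k.2) P')
    (hYlaw : ∀ i j, P'.map (Y i j) =
      volume.withDensity (Petty.symmDecrRearrangement (f i j)))
    (ρ : ℝ≥0 → ℝ≥0∞) (hρ : Antitone ρ) :
    ∫⁻ ω, Petty.radialMeasure (d + 1) ρ (Petty.polarMixedProj fun i =>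
        Petty.matImage (fun k : Σ i : Fin d, Fin (m i) => X k.1 k.2 ω) (C i)) ∂P
      ≤ ∫⁻ ω, Petty.radialMeasure (d + 1) ρ (Petty.polarMixedProj fun i =>
        Petty.matImage (fun k : Σ i : Fin d, Fin (m i) => Y k.1 k.2 ω) (C i)) ∂P' := by
  have hG := Petty.isSteinerConvex_mixedProjSupport_le hCcomp hCconv hCne
  have hfin : ∀ k : Σ i : Fin d, Fin (m i), ∫⁻ x, f k.1 k.2 x ≠ ∞ := by
    intro k
    have := Measure.isProbabilityMeasure_map (hXmeas k.1 k.2)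
    rw [← setLIntegral_univ, ← withDensity_apply _ MeasurableSet.univ, ← hXlaw, measure_univ]
    exact ENNReal.one_ne_top
  -- Both expectations are integrals over the same set `G` and differ only in the densities. Mass
  -- one of each `f i j` makes its positive level sets finite in volume, as the rearrangement
  -- requires.
  have h := hG.lintegral_prod_mul_le (fun k : Σ i : Fin d, Fin (m i) => hf k.1 k.2) hfin hρ
  rw [← Petty.lintegral_radialMeasure_section (fun k : Σ i : Fin d, Fin (m i) => hf k.1 k.2) P
      (fun k => hXmeas k.1 k.2) hXindep (fun k => hXlaw k.1 k.2) hρ.measurable hG.measurableSet,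
    ← Petty.lintegral_radialMeasure_section (fun k : Σ i : Fin d, Fin (m i) =>
      Petty.measurable_symmDecrRearrangement (f k.1 k.2)) P'
      (fun k => hYmeas k.1 k.2) hYindep (fun k => hYlaw k.1 k.2) hρ.measurable
      hG.measurableSet] at h
  exact h
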